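/- **Conventions.** Let $[N]=\{1,\dots,N\}$. For a permutation $\pi$ of $[N]$, $\#(\pi)$ is the number of its cycles, fixed points included; cycles are identified with the sets of their elements. $NC(N)$ is the set of non-crossing partitions of $[N]$, also regarded as permutations whose cycles are the blocks in increasing order. Let $\gamma_{n,m}=(1,\dots,n)(n+1,\dots,n+m)$. * $S_{NC}(n,m)$ is the set of permutations $\pi$ of $[n+m]$ such that the join of the cycle partitions of $\pi$ and $\gamma_{n,m}$ is the one-block partition and $\#(\pi)+\#(\pi^{-1}\gamma_{n,m})=n+m$. * $S'_{NC}(n,m)$ is the set of pairs $(\mathcal U,\pi)$ with $\pi=\pi_1\times\pi_2\in NC(n)\times NC(m)$ and $\mathcal U$ a partition of $[n+m]$ whose blocks are the cycles of $\pi$, except that one cycle $A$ of $\pi_1$ and one cycle $B$ of $\pi_2$ are merged into one block $A\cup B$. **Cumulants.** A second order probability space $(\mathcal A,\varphi,\varphi^2)$ consists of a unital complex algebra $\mathcal A$, a linear $\varphi:\mathcal A\to\mathbb C$ with $\varphi(1)=1$, and a bilinear $\varphi^2:\mathcal A\times\mathcal A\to\mathbb C$, tracial in each argument, with $\varphi^2(x,1)=0=\varphi^2(1,x)$.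 The free cumulants $\kappa_n$ and the second order free cumulants $\kappa_{n,m}$ $(n,m\ge1)$ are defined recursively by $$\varphi(x_1\cdots x_n)=\sum_{P\in NC(n)}\prod_{V\in P}\kappa_{|V|}(x_V),$$ $$\varphi^2(x_1\cdots x_n,\,x_{n+1}\cdots x_{n+m})=\sum_{\pi\in S_{NC}(n,m)}\ \prod_{C\in\pi}\kappa_{|C|}(x_C)+\sum_{(\mathcal U,\pi)\in S'_{NC}(n,m)}\kappa_{|A|,|B|}(x_A,x_B)\prod_{V\in\pi\setminus\{A,B\}}\kappa_{|V|}(x_V),$$ where $x_V$ lists the $x_i$, $i\in V$, in increasing order of $i$, and for a cycle $C$ of $\pi\in S_{NC}(n,m)$, $x_C$ lists the $x_i$ in the order of the cycle, starting from its smallest element. Write $\kappa^c_n=\kappa_n(c,\dots,c)$, $\kappa^c_{n,m}=\kappa_{n,m}(c,\dots,c)$, and $\kappa^c_\sigma=\prod_{V\in\sigma}\kappa^c_{|V|}$ for a set $\sigma$ of blocks. Elements $a,b\in\mathcal A$ are second order free if all mixed cumulants vanish: $\kappa_n(x_1,\dots,x_n)=0$ and $\kappa_{n,m}(x_1,\dots,x_{n+m})=0$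 whenever each entry is chosen as one of $a$, $b$ and both choices occur. **Graphs and index sets.** For a partition $\mathcal U$ of $[2N]$ let $\mathcal G_{\mathcal U}$ be the multigraph (loops allowed) whose vertices are the blocks of $\mathcal U$, with one edge, for each $k=1,\dots,N$, between the block containing $2k-1$ and the block containing $2k$; for a permutation $\pi$, $\mathcal G_\pi$ is the graph of its cycle partition. Let $\gamma=\gamma_{2n,2m}$. * $\mathcal J_{2n,2m}$ is the set of $\pi\in S_{NC}(2n,2m)$ such that $\mathcal G_\pi$ is bipartite and no cycle of $\pi^{-1}\gamma$ contains two different even numbers. For such $\pi$, let $\pi'$ (resp. $\pi''$) be the set of cycles at even (resp. odd) distance in $\mathcal G_\pi$ from the cycle containing $1$. * $\mathcal X_{2n,2m}$ is the set of $(\mathcal U,\pi)\in S'_{NC}(2n,2m)$ such that $\mathcal G_{\mathcal U}$ is connected and bipartite. For such a pair, with merged cycles $A\subset[2n]$ and $B\subset\{2n+1,\dots,2n+2m\}$, let $\pi'$ (resp. $\pi''$) be the set of cycles of $\pi$ other than $A,B$ at even (resp. odd) distance in $\mathcal G_{\mathcal U}$ from the block $A\cup B$. **Theorem.** Let $a,b$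 be second order free elements of a second order probability space. Then for all $n,m\ge1$, $$\kappa^{ab+ba}_{n,m}=\sum_{\pi\in\mathcal J_{2n,2m}}\left(\kappa^a_{\pi'}\kappa^b_{\pi''}+\kappa^b_{\pi'}\kappa^a_{\pi''}\right)+\sum_{(\mathcal U,\pi)\in\mathcal X_{2n,2m}}\left(\kappa^a_{|A|,|B|}\,\kappa^a_{\pi'}\,\kappa^b_{\pi''}+\kappa^b_{|A|,|B|}\,\kappa^b_{\pi'}\,\kappa^a_{\pi''}\right).$$ -/

import Mathlib

open Finset

noncomputable section

namespace Annular

/-! ### Partitions and permutations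

The set `[N] = {1, …, N}` is modelled by `Fin N`: the element `i : Fin N` stands for the number
`i.val + 1`. -/

/-- A partition of `[N]` is non-crossing if `i < j < k < l` with `i, k` in a block `V` and
`j, l` in a block `W` forces `V = W`. -/
def IsNoncrossing {N : ℕ} (P : Finpartition (univ : Finset (Fin N))) : Prop :=
  ∀ i j k l : Fin N, i < j → j < k → k < l → ∀ V ∈ P.parts, ∀ W ∈ P.parts,
    i ∈ V → k ∈ V → j ∈ W → l ∈ W → V = W

open scoped Classical in
/-- The set `NC(N)` of non-crossing partitions of `[N]`. -/
def noncrossingPartitions (N : ℕ) : Finset (Finpartition (univ : Finset (Fin N))) :=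
  univ.filter IsNoncrossing

open scoped Classical in
/-- The partition of `[N]` into the cycles of a permutation (fixed points are cycles). -/
def cyclePartition {N : ℕ} (π : Equiv.Perm (Fin N)) : Finpartition (univ : Finset (Fin N)) :=
  Finpartition.ofSetoid (Equiv.Perm.SameCycle.setoid π)

/-- The number `#(π)` of cycles of `π`, fixed points included. -/
def numCycles {N : ℕ} (π : Equiv.Perm (Fin N)) : ℕ := (cyclePartition π).parts.card

/-- A non-crossing partition of `[N]` seen as a permutation: the cycles of `π` form a non-crossing
partition, and each cycle runs through its elements in increasing order, that is, `π i` is the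
next larger element of the cycle of `i` if there is one, and otherwise `i` is the
largest element of its cycle and `π i` the smallest. -/
def IsNoncrossingPerm {N : ℕ} (π : Equiv.Perm (Fin N)) : Prop :=
  IsNoncrossing (cyclePartition π) ∧
    ∀ i j : Fin N, π.SameCycle i j → ¬ (i < j ∧ j < π i) ∧ (π i ≤ i → π i ≤ j ∧ j ≤ i)

/-- The permutation `π₁ × π₂` of `[n + m]` acting as `π₁` on the first `n` and as `π₂` on the last
`m` elements. -/
def prodPerm {n m : ℕ} (π₁ : Equiv.Perm (Fin n)) (π₂ : Equiv.Perm (Fin m)) :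
    Equiv.Perm (Fin (n + m)) :=
  finSumFinEquiv.permCongr (Equiv.sumCongr π₁ π₂)

/-- The permutation `γ_{n,m} = (1, …, n)(n + 1, …, n + m)`. -/
def gamma (n m : ℕ) : Equiv.Perm (Fin (n + m)) := prodPerm (finRotate n) (finRotate m)

open scoped Classical in
/-- The set `S_NC(n,m)` of non-crossing annular permutations: `π ∨ γ_{n,m} = 1` (join of the cycle
partitions) and `#(π) + #(π⁻¹ γ_{n,m}) = n + m`. -/
def annularNC (n m : ℕ) : Finset (Equiv.Perm (Fin (n + m))) :=
  univ.filter fun π =>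
    Equiv.Perm.SameCycle.setoid π ⊔ Equiv.Perm.SameCycle.setoid (gamma n m) = ⊤ ∧
      numCycles π + numCycles (π⁻¹ * gamma n m) = n + m

/-- The pairs `(U, π)` of type 2: `π = π₁ × π₂ ∈ NC(n) × NC(m)`, and the blocks of `U` are the
cycles of `π`, except that one cycle `A` of `π₁` and one cycle `B` of `π₂` are merged into the
single block `A ∪ B`. -/
def IsTypeTwo (n m : ℕ) (U : Finpartition (univ : Finset (Fin (n + m))))
    (π : Equiv.Perm (Fin (n + m))) : Prop :=
  (∃ (π₁ : Equiv.Perm (Fin n)) (π₂ : Equiv.Perm (Fin m)),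
    IsNoncrossingPerm π₁ ∧ IsNoncrossingPerm π₂ ∧ π = prodPerm π₁ π₂) ∧
  ∃ A ∈ (cyclePartition π).parts, ∃ B ∈ (cyclePartition π).parts,
    (∀ i ∈ A, i.val < n) ∧ (∀ i ∈ B, n ≤ i.val) ∧
    U.parts = insert (A ∪ B) (((cyclePartition π).parts.erase A).erase B)

open scoped Classical in
/-- The set `S'_NC(n,m)` of non-crossing annular partitioned permutations of type 2. -/
def typeTwo (n m : ℕ) :
    Finset (Finpartition (univ : Finset (Fin (n + m))) × Equiv.Perm (Fin (n + m))) :=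
  univ.filter fun p => IsTypeTwo n m p.1 p.2

open scoped Classical in
/-- The cycle `A` of a pair `(U, π)` of type 2: the elements of `{1, …, n}` whose block in `U`
meets `{n + 1, …, n + m}`. -/
def leftCycle (n m : ℕ) (U : Finpartition (univ : Finset (Fin (n + m)))) : Finset (Fin (n + m)) :=
  univ.filter fun i => i.val < n ∧ ∃ j ∈ U.part i, n ≤ j.val

open scoped Classical in
/-- The cycle `B` of a pair `(U, π)` of type 2: the elements of `{n + 1, …, n + m}` whose block in
`U` meets `{1, …, n}`. -/
def rightCycle (n m : ℕ) (U : Finpartition (univ : Finset (Fin (n + m)))) :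
    Finset (Fin (n + m)) :=
  univ.filter fun i => n ≤ i.val ∧ ∃ j ∈ U.part i, j.val < n

/-- The block of `U` that is merged from two cycles, for a pair `(U, π)` of type 2. -/
def mergedBlock (n m : ℕ) (U : Finpartition (univ : Finset (Fin (n + m)))) :
    Finset (Fin (n + m)) :=
  leftCycle n m U ∪ rightCycle n m U

/-! ### Auxiliary facts on the one-block partition -/

theorem parts_top_univ {N : ℕ} (hN : 1 ≤ N) :
    (⊤ : Finpartition (univ : Finset (Fin N))).parts = {univ} := by
  have h : (univ : Finset (Fin N)) ≠ ⊥ := (univ_nonempty_iff.mpr ⟨⟨0, hN⟩⟩).ne_empty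
  change Finpartition.parts (dite _ _ _) = _
  rw [dif_neg h]
  rfl

theorem eq_top_of_univ_mem {N : ℕ} {P : Finpartition (univ : Finset (Fin N))}
    (h : univ ∈ P.parts) : P = ⊤ := by
  refine le_antisymm le_top ?_
  intro b _
  exact ⟨univ, h, subset_univ b⟩

theorem part_top {N : ℕ} (i : Fin N) :
    (⊤ : Finpartition (univ : Finset (Fin N))).part i = univ := by
  refine Finpartition.part_eq_of_mem _ ?_ (mem_univ i)
  rw [parts_top_univ (Nat.succ_le_of_lt (Nat.lt_of_le_of_lt (Nat.zero_le _) i.isLt))]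
  exact mem_singleton_self _

theorem mem_part_cyclePartition {N : ℕ} (π : Equiv.Perm (Fin N)) (i j : Fin N) :
    j ∈ (cyclePartition π).part i ↔ π.SameCycle i j := by
  classical
  exact Finpartition.mem_part_ofSetoid_iff_rel

theorem sameCycle_finRotate {N : ℕ} (i j : Fin N) : (finRotate N).SameCycle i j := by
  match N with
  | 0 => exact i.elim0
  | 1 => rw [Subsingleton.elim i j]
  | N + 2 =>
    have h : ∀ k : Fin (N + 2), finRotate (N + 2) k ≠ k := fun k => by
      rw [← Equiv.Perm.mem_support, support_finRotate]
      exact mem_univ k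
    exact isCycle_finRotate.sameCycle (h i) (h j)

theorem val_finRotate {N : ℕ} (i : Fin N) :
    (finRotate N i).val = if i.val + 1 = N then 0 else i.val + 1 := by
  match N with
  | 0 => exact i.elim0
  | N + 1 =>
    rw [coe_finRotate]
    simp only [Fin.ext_iff, Fin.val_last, Nat.add_right_cancel_iff]

theorem isNoncrossingPerm_finRotate (N : ℕ) : IsNoncrossingPerm (finRotate N) := by
  refine ⟨fun i j k l _ _ _ V hV W hW hi _ hj _ => ?_, fun i j _ => ⟨fun h => ?_, fun h => ?_⟩⟩
  · rw [← Finpartition.part_eq_of_mem _ hV hi, ← Finpartition.part_eq_of_mem _ hW hj]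
    refine Finpartition.part_eq_of_mem _ ((cyclePartition _).part_mem.2 (mem_univ j)) ?_
    exact (mem_part_cyclePartition _ _ _).2 (sameCycle_finRotate j i)
  · rw [Fin.lt_def, Fin.lt_def, val_finRotate] at h
    split_ifs at h <;> omega
  · rw [Fin.le_def, val_finRotate] at h
    rw [Fin.le_def, Fin.le_def, val_finRotate]
    split_ifs at h ⊢ <;> omega

theorem eq_finRotate {N : ℕ} {π : Equiv.Perm (Fin N)} (hπ : IsNoncrossingPerm π)
    (h : ∀ i j, π.SameCycle i j) : π = finRotate N := by
  ext i
  rw [val_finRotate]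
  have key := fun j => hπ.2 i j (h i j)
  simp only [Fin.lt_def, Fin.le_def] at key
  have hi := i.isLt
  have hp := (π i).isLt
  by_cases hc : (π i).val ≤ i.val
  · have h0 := (key ⟨0, by omega⟩).2 hc
    have h1 := (key ⟨N - 1, by omega⟩).2 hc
    simp only at h0 h1
    split_ifs <;> omega
  · have h0 := (key ⟨i.val + 1, by omega⟩).1
    simp only at h0
    split_ifs <;> omega

theorem prodPerm_castAdd {n m : ℕ} (π₁ : Equiv.Perm (Fin n)) (π₂ : Equiv.Perm (Fin m))
    (i : Fin n) : prodPerm π₁ π₂ (Fin.castAdd m i) = Fin.castAdd m (π₁ i) := by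
  simp [prodPerm, Equiv.permCongr_apply]

theorem prodPerm_natAdd {n m : ℕ} (π₁ : Equiv.Perm (Fin n)) (π₂ : Equiv.Perm (Fin m))
    (i : Fin m) : prodPerm π₁ π₂ (Fin.natAdd n i) = Fin.natAdd n (π₂ i) := by
  simp [prodPerm, Equiv.permCongr_apply]

theorem prodPerm_pow_castAdd {n m : ℕ} (π₁ : Equiv.Perm (Fin n)) (π₂ : Equiv.Perm (Fin m))
    (k : ℕ) (i : Fin n) :
    (prodPerm π₁ π₂ ^ k) (Fin.castAdd m i) = Fin.castAdd m ((π₁ ^ k) i) := by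
  induction k with
  | zero => rfl
  | succ k ih => rw [pow_succ', Equiv.Perm.mul_apply, ih, prodPerm_castAdd, pow_succ',
      Equiv.Perm.mul_apply]

theorem prodPerm_pow_natAdd {n m : ℕ} (π₁ : Equiv.Perm (Fin n)) (π₂ : Equiv.Perm (Fin m))
    (k : ℕ) (i : Fin m) :
    (prodPerm π₁ π₂ ^ k) (Fin.natAdd n i) = Fin.natAdd n ((π₂ ^ k) i) := by
  induction k with
  | zero => rfl
  | succ k ih => rw [pow_succ', Equiv.Perm.mul_apply, ih, prodPerm_natAdd, pow_succ',
      Equiv.Perm.mul_apply]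

theorem sameCycle_castAdd {n m : ℕ} {π₁ : Equiv.Perm (Fin n)} {π₂ : Equiv.Perm (Fin m)}
    {i : Fin n} {j : Fin (n + m)} :
    (prodPerm π₁ π₂).SameCycle (Fin.castAdd m i) j ↔
      ∃ l, π₁.SameCycle i l ∧ j = Fin.castAdd m l := by
  constructor
  · intro h
    obtain ⟨k, hk⟩ := h.exists_nat_pow_eq
    rw [prodPerm_pow_castAdd] at hk
    exact ⟨_, ⟨k, by simp⟩, hk.symm⟩
  · rintro ⟨l, h, rfl⟩
    obtain ⟨k, rfl⟩ := h.exists_nat_pow_eq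
    exact ⟨k, by rw [zpow_natCast, prodPerm_pow_castAdd]⟩

theorem sameCycle_natAdd {n m : ℕ} {π₁ : Equiv.Perm (Fin n)} {π₂ : Equiv.Perm (Fin m)}
    {i : Fin m} {j : Fin (n + m)} :
    (prodPerm π₁ π₂).SameCycle (Fin.natAdd n i) j ↔
      ∃ l, π₂.SameCycle i l ∧ j = Fin.natAdd n l := by
  constructor
  · intro h
    obtain ⟨k, hk⟩ := h.exists_nat_pow_eq
    rw [prodPerm_pow_natAdd] at hk
    exact ⟨_, ⟨k, by simp⟩, hk.symm⟩
  · rintro ⟨l, h, rfl⟩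
    obtain ⟨k, rfl⟩ := h.exists_nat_pow_eq
    exact ⟨k, by rw [zpow_natCast, prodPerm_pow_natAdd]⟩

theorem top_mem_typeTwo {n m : ℕ} (hn : 1 ≤ n) (hm : 1 ≤ m) :
    (⊤, gamma n m) ∈ typeTwo n m := by
  classical
  have hA : ∀ i : Fin n, (cyclePartition (gamma n m)).part (Fin.castAdd m i) =
      univ.map (Fin.castAddEmb m) := fun i => by
    ext j
    rw [mem_part_cyclePartition, gamma, sameCycle_castAdd]
    simp [sameCycle_finRotate, eq_comm]
  have hB : ∀ i : Fin m, (cyclePartition (gamma n m)).part (Fin.natAdd n i) =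
      univ.map (Fin.natAddEmb n) := fun i => by
    ext j
    rw [mem_part_cyclePartition, gamma, sameCycle_natAdd]
    simp [sameCycle_finRotate, eq_comm]
  simp only [typeTwo, mem_filter, mem_univ, true_and]
  refine ⟨⟨_, _, isNoncrossingPerm_finRotate n, isNoncrossingPerm_finRotate m, rfl⟩,
    univ.map (Fin.castAddEmb m), ?_, univ.map (Fin.natAddEmb n), ?_, ?_, ?_, ?_⟩
  · rw [← hA ⟨0, hn⟩]
    exact (cyclePartition _).part_mem.2 (mem_univ _)
  · rw [← hB ⟨0, hm⟩]
    exact (cyclePartition _).part_mem.2 (mem_univ _)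
  · intro i hi
    obtain ⟨j, _, rfl⟩ := mem_map.1 hi
    exact j.isLt
  · intro i hi
    obtain ⟨j, _, rfl⟩ := mem_map.1 hi
    exact Nat.le_add_right _ _
  · have h1 : (univ.map (Fin.castAddEmb m) ∪ univ.map (Fin.natAddEmb n) : Finset (Fin (n + m))) =
        univ := by
      ext i
      refine Fin.addCases (fun j => ?_) (fun j => ?_) i <;> simp
    have h2 : ((cyclePartition (gamma n m)).parts.erase (univ.map (Fin.castAddEmb m))).erase
        (univ.map (Fin.natAddEmb n)) = ∅ := by
      refine eq_empty_of_forall_notMem fun V hV => ?_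
      obtain ⟨hVB, hVA, hV⟩ := mem_erase.1 hV |>.imp_right mem_erase.1
      obtain ⟨i, hi⟩ := (cyclePartition _).nonempty_of_mem_parts hV
      rw [← Finpartition.part_eq_of_mem _ hV hi] at hVA hVB
      revert hVA hVB
      refine Fin.addCases (fun j => ?_) (fun j => ?_) i
      · exact fun _ h => h (hA j)
      · exact fun h _ => h (hB j)
    rw [parts_top_univ (hn.trans (Nat.le_add_right n m)), h1, h2, insert_empty]

theorem card_lt_of_mem_typeTwo {n m : ℕ}
    {p : Finpartition (univ : Finset (Fin (n + m))) × Equiv.Perm (Fin (n + m))}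
    (hp : p ∈ typeTwo n m) (hne : p ≠ (⊤, gamma n m)) :
    (leftCycle n m p.1).card + (rightCycle n m p.1).card < n + m := by
  classical
  obtain ⟨U, π⟩ := p
  simp only [typeTwo, mem_filter, mem_univ, true_and] at hp
  obtain ⟨⟨π₁, π₂, h₁, h₂, rfl⟩, A, hA, B, hB, hAl, hBr, hU⟩ := hp
  by_contra hcon
  apply hne
  have hdisj : Disjoint (leftCycle n m U) (rightCycle n m U) := by
    rw [disjoint_left]
    intro i hi hi'
    simp only [leftCycle, rightCycle, mem_filter] at hi hi'
    omega
  have hun : leftCycle n m U ∪ rightCycle n m U = univ := by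
    rw [← card_eq_iff_eq_univ, Fintype.card_fin]
    refine le_antisymm ((card_le_univ _).trans_eq (Fintype.card_fin _)) ?_
    rw [card_union_of_disjoint hdisj]
    exact not_lt.1 hcon
  have hside : ∀ i j : Fin (n + m), (prodPerm π₁ π₂).SameCycle i j → (i.val < n ↔ j.val < n) := by
    intro i j
    refine Fin.addCases (fun k => ?_) (fun k => ?_) i
    · rw [sameCycle_castAdd]
      rintro ⟨l, _, rfl⟩
      simp
    · rw [sameCycle_natAdd]
      rintro ⟨l, _, rfl⟩
      simp
  have hpart : ∀ i : Fin (n + m), U.part i = A ∪ B := by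
    intro i
    have hi : i ∈ leftCycle n m U ∪ rightCycle n m U := hun ▸ mem_univ i
    have hmem : U.part i ∈ U.parts := U.part_mem.2 (mem_univ i)
    have hii : i ∈ U.part i := U.mem_part (mem_univ i)
    rw [hU, mem_insert] at hmem
    refine hmem.resolve_right fun h => ?_
    have h' := mem_of_mem_erase (mem_of_mem_erase h)
    have hall : ∀ j ∈ U.part i, (i.val < n ↔ j.val < n) := fun j hj => by
      refine hside i j ((mem_part_cyclePartition _ _ _).1 ?_)
      rwa [Finpartition.part_eq_of_mem _ h' hii]
    simp only [leftCycle, rightCycle, mem_union, mem_filter, mem_univ, true_and] at hi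
    rcases hi with ⟨h1, j, hj, h2⟩ | ⟨h1, j, hj, h2⟩
    · have := hall j hj
      omega
    · have := hall j hj
      omega
  have hAB : ∀ i, i ∈ A ∪ B := fun i => hpart i ▸ U.mem_part (mem_univ i)
  have htop : U = ⊤ := by
    refine eq_top_of_univ_mem ?_
    have hmem : A ∪ B ∈ U.parts := hU ▸ mem_insert_self _ _
    have huniv : A ∪ B = univ := eq_univ_of_forall hAB
    generalize A ∪ B = C at hmem huniv
    subst huniv
    exact hmem
  have e₁ : π₁ = finRotate n := by
    refine eq_finRotate h₁ fun i j => ?_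
    have hmemA : ∀ k : Fin n, Fin.castAdd m k ∈ A := fun k =>
      (mem_union.1 (hAB _)).resolve_right fun h => absurd (hBr _ h) (not_le.2 k.isLt)
    have h := (mem_part_cyclePartition _ _ _).1
      ((Finpartition.part_eq_of_mem _ hA (hmemA i)).symm ▸ hmemA j)
    obtain ⟨l, hl, hjl⟩ := sameCycle_castAdd.1 h
    rwa [Fin.castAdd_injective n m hjl]
  have e₂ : π₂ = finRotate m := by
    refine eq_finRotate h₂ fun i j => ?_
    have hmemB : ∀ k : Fin m, Fin.natAdd n k ∈ B := fun k =>
      (mem_union.1 (hAB _)).resolve_left fun h => absurd (hAl _ h) (by simp)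
    have h := (mem_part_cyclePartition _ _ _).1
      ((Finpartition.part_eq_of_mem _ hB (hmemB i)).symm ▸ hmemB j)
    obtain ⟨l, hl, hjl⟩ := sameCycle_natAdd.1 h
    rwa [Fin.natAdd_injective m n hjl]
  rw [htop, e₁, e₂, gamma]

/-! ### Second order probability spaces and free cumulants -/

/-- A second order non-commutative probability space `(A, φ, φ²)`: a unital linear functional `φ` and
a bilinear functional `φ²`, tracial in both arguments, with `φ²(x, 1) = 0 = φ²(1, x)`. -/
structure SecondOrderSpace (A : Type*) [Ring A] [Algebra ℂ A] where
  φ : A →ₗ[ℂ] ℂ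
  map_one : φ 1 = 1
  φ₂ : A →ₗ[ℂ] A →ₗ[ℂ] ℂ
  tracial_left : ∀ x y z : A, φ₂ (x * y) z = φ₂ (y * x) z
  tracial_right : ∀ x y z : A, φ₂ z (x * y) = φ₂ z (y * x)
  map_one_right : ∀ x : A, φ₂ x 1 = 0
  map_one_left : ∀ x : A, φ₂ 1 x = 0

/-- The restriction of a tuple to `V`, in the natural order of the indices. -/
def restrict {A : Type*} {N : ℕ} (x : Fin N → A) (V : Finset (Fin N)) : Fin V.card → A :=
  fun j => x (V.orderEmbOfFin rfl j)

namespace SecondOrderSpace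

variable {A : Type*} [Ring A] [Algebra ℂ A]

/-- The free cumulants `κ_n`: the moment-cumulant formula
`φ(x₁ ⋯ x_n) = ∑_{P ∈ NC(n)} ∏_{V ∈ P} κ_{|V|}(x_V)`, solved recursively for the
term of the one-block partition `P = ⊤`; see `moment_eq_sum`. -/
def cumulant (S : SecondOrderSpace A) (n : ℕ) (x : Fin n → A) : ℂ :=
  S.φ (List.ofFn x).prod -
    ∑ P ∈ (noncrossingPartitions n).erase ⊤, ∏ V ∈ P.parts,
      if _h : V.card < n then S.cumulant V.card (restrict x V) else 0
termination_by n

open scoped Classical in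
/-- `κ_π(x) = ∏ κ_{|C|}(x_C)` over the cycles `C` of a permutation `π`, the arguments of
`κ_{|C|}` being read along the cycle `i, π i, π² i, …`, from its smallest element `i` on. -/
def cumulantPerm (S : SecondOrderSpace A) {N : ℕ} (π : Equiv.Perm (Fin N)) (x : Fin N → A) : ℂ :=
  ∏ i ∈ univ.filter (fun i => ∀ j, π.SameCycle i j → i ≤ j),
    S.cumulant ((cyclePartition π).part i).card (fun k => x ((π ^ k.val) i))

/-- The second order free cumulants `κ_{n,m}`: the moment-cumulant formula
`φ²(x₁ ⋯ x_n, y₁ ⋯ y_m) = ∑_{S_NC(n,m)} κ_π + ∑_{S'_NC(n,m)} κ_{(U,π)}`, where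
`κ_{(U,π)} = κ_{|A|,|B|} ∏ κ_{|V|}` over the blocks `V ≠ A ∪ B` of `U`, solved recursively for the
term of the pair `(1, γ_{n,m})`; see `secondMoment_eq_sum`. -/
def cumulant₂ (S : SecondOrderSpace A) (n m : ℕ) (x : Fin n → A) (y : Fin m → A) : ℂ :=
  S.φ₂ (List.ofFn x).prod (List.ofFn y).prod -
    ∑ π ∈ annularNC n m, S.cumulantPerm π (Fin.append x y) -
    ∑ p ∈ (typeTwo n m).erase (⊤, gamma n m),
      (if _h : (leftCycle n m p.1).card + (rightCycle n m p.1).card < n + m then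
          S.cumulant₂ (leftCycle n m p.1).card (rightCycle n m p.1).card
            (restrict (Fin.append x y) (leftCycle n m p.1))
            (restrict (Fin.append x y) (rightCycle n m p.1))
        else 0) *
      ∏ V ∈ p.1.parts.erase (mergedBlock n m p.1),
        S.cumulant V.card (restrict (Fin.append x y) V)
termination_by n + m

/-- The free cumulants `κ_n^a = κ_n(a, …, a)` of one variable. -/
def cumulantOf (S : SecondOrderSpace A) (a : A) (n : ℕ) : ℂ := S.cumulant n fun _ => a

/-- The second order free cumulants `κ_{n,m}^a = κ_{n,m}(a, …, a)` of one variable. -/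
def cumulantOf₂ (S : SecondOrderSpace A) (a : A) (n m : ℕ) : ℂ :=
  S.cumulant₂ n m (fun _ => a) fun _ => a

/-- `κ_σ^a = ∏_{V ∈ σ} κ_{|V|}^a` for a set `σ` of blocks. -/
def cumulantBlocks (S : SecondOrderSpace A) (a : A) {N : ℕ} (σ : Finset (Finset (Fin N))) : ℂ :=
  ∏ V ∈ σ, S.cumulantOf a V.card

/-- Second order freeness of `a` and `b`: all mixed free cumulants of first and second order
vanish. A tuple with entries in `{a, b}` is given by a word `w` in two letters; it is mixed if both
letters occur in `w`. -/
def SecondOrderFree (S : SecondOrderSpace A) (a b : A) : Prop :=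
  (∀ (n : ℕ) (w : Fin n → Bool), (∃ i j, w i ≠ w j) →
    S.cumulant n (fun i => if w i then a else b) = 0) ∧
  ∀ (n m : ℕ) (w : Fin (n + m) → Bool), 1 ≤ n → 1 ≤ m → (∃ i j, w i ≠ w j) →
    S.cumulant₂ n m (fun i => if w (Fin.castAdd m i) then a else b)
      (fun j => if w (Fin.natAdd n j) then a else b) = 0

/-! ### The moment-cumulant formulas

The recursive definitions above do satisfy the formulas by which the cumulants are defined. -/

theorem cumulant_congr (S : SecondOrderSpace A) {n n' : ℕ} (h : n = n') {x : Fin n → A}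
    {x' : Fin n' → A} (hx : ∀ i, x i = x' (Fin.cast h i)) : S.cumulant n x = S.cumulant n' x' := by
  subst h
  congr 1
  funext i
  exact hx i

theorem cumulant₂_congr (S : SecondOrderSpace A) {n n' m m' : ℕ} (h : n = n') (h' : m = m')
    {x : Fin n → A} {x' : Fin n' → A} {y : Fin m → A} {y' : Fin m' → A}
    (hx : ∀ i, x i = x' (Fin.cast h i)) (hy : ∀ i, y i = y' (Fin.cast h' i)) :
    S.cumulant₂ n m x y = S.cumulant₂ n' m' x' y' := by
  subst h
  subst h'
  congr 1
  · funext i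
    exact hx i
  · funext i
    exact hy i

/-- The moment-cumulant formula which defines the free cumulants. -/
theorem moment_eq_sum (S : SecondOrderSpace A) {n : ℕ} (hn : 1 ≤ n) (x : Fin n → A) :
    S.φ (List.ofFn x).prod =
      ∑ P ∈ noncrossingPartitions n, ∏ V ∈ P.parts, S.cumulant V.card (restrict x V) := by
  have htop : (⊤ : Finpartition (univ : Finset (Fin n))).parts = {univ} := parts_top_univ hn
  have hmem : (⊤ : Finpartition (univ : Finset (Fin n))) ∈ noncrossingPartitions n := by
    simp only [noncrossingPartitions, mem_filter, mem_univ, true_and]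
    intro i j k l _ _ _ V hV W hW _ _ _ _
    rw [htop, mem_singleton] at hV hW
    rw [hV, hW]
  rw [← add_sum_erase _ _ hmem, htop, prod_singleton]
  have h1 : S.cumulant (univ : Finset (Fin n)).card (restrict x univ) = S.cumulant n x := by
    refine cumulant_congr S (card_fin n) fun i => ?_
    unfold restrict
    congr 1
    exact (congrFun (orderEmbOfFin_unique (s := (univ : Finset (Fin n))) rfl
      (f := Fin.cast (card_fin n)) (fun _ => mem_univ _) (fun _ _ h => h)) i).symm
  rw [h1, cumulant, sub_add_eq_add_sub, eq_sub_iff_add_eq]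
  congr 1
  refine sum_congr rfl fun P hP => prod_congr rfl fun V hV => ?_
  rw [dif_pos]
  refine (card_lt_card (ssubset_univ_iff.mpr ?_)).trans_eq (card_fin n)
  rintro rfl
  exact (mem_erase.mp hP).1 (eq_top_of_univ_mem hV)

/-- The moment-cumulant formula which defines the second order free cumulants. -/
theorem secondMoment_eq_sum (S : SecondOrderSpace A) {n m : ℕ} (hn : 1 ≤ n) (hm : 1 ≤ m)
    (x : Fin n → A) (y : Fin m → A) :
    S.φ₂ (List.ofFn x).prod (List.ofFn y).prod =
      ∑ π ∈ annularNC n m, S.cumulantPerm π (Fin.append x y) +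
      ∑ p ∈ typeTwo n m,
        S.cumulant₂ (leftCycle n m p.1).card (rightCycle n m p.1).card
            (restrict (Fin.append x y) (leftCycle n m p.1))
            (restrict (Fin.append x y) (rightCycle n m p.1)) *
          ∏ V ∈ p.1.parts.erase (mergedBlock n m p.1),
            S.cumulant V.card (restrict (Fin.append x y) V) := by
  have hnm : 1 ≤ n + m := hn.trans (Nat.le_add_right n m)
  have htop : (⊤ : Finpartition (univ : Finset (Fin (n + m)))).parts = {univ} :=
    parts_top_univ hnm
  have hL : leftCycle n m ⊤ = univ.map (Fin.castAddEmb m) := by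
    ext i
    simp only [leftCycle, part_top, mem_filter, mem_univ, true_and, mem_map]
    constructor
    · rintro ⟨hi, _⟩
      exact ⟨⟨i.val, hi⟩, rfl⟩
    · rintro ⟨j, rfl⟩
      exact ⟨j.isLt, Fin.natAdd n ⟨0, hm⟩, Nat.le_add_right _ _⟩
  have hR : rightCycle n m ⊤ = univ.map (Fin.natAddEmb n) := by
    ext i
    simp only [rightCycle, part_top, mem_filter, mem_univ, true_and, mem_map]
    constructor
    · rintro ⟨hi, _⟩
      exact ⟨⟨i.val - n, by omega⟩, Fin.ext (by simp; omega)⟩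
    · rintro ⟨j, rfl⟩
      exact ⟨Nat.le_add_right _ _, Fin.castAdd m ⟨0, hn⟩, hn⟩
  have hLm : ∀ i, Fin.castAdd m i ∈ leftCycle n m ⊤ := fun i => by
    rw [hL]
    exact mem_map_of_mem (Fin.castAddEmb m) (mem_univ i)
  have hRm : ∀ i, Fin.natAdd n i ∈ rightCycle n m ⊤ := fun i => by
    rw [hR]
    exact mem_map_of_mem (Fin.natAddEmb n) (mem_univ i)
  have hLc : (leftCycle n m ⊤).card = n := by rw [hL]; simp
  have hRc : (rightCycle n m ⊤).card = m := by rw [hR]; simp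
  have hM : mergedBlock n m ⊤ = univ := by
    rw [← card_eq_iff_eq_univ, Fintype.card_fin, mergedBlock, card_union_of_disjoint, hLc, hRc]
    rw [disjoint_left]
    intro i hi hi'
    simp only [leftCycle, rightCycle, mem_filter] at hi hi'
    omega
  rw [← add_sum_erase _ _ (top_mem_typeTwo hn hm)]
  have h1 : S.cumulant₂ (leftCycle n m ⊤).card (rightCycle n m ⊤).card
      (restrict (Fin.append x y) (leftCycle n m ⊤))
      (restrict (Fin.append x y) (rightCycle n m ⊤)) = S.cumulant₂ n m x y := by
    refine cumulant₂_congr S hLc hRc (fun i => ?_) fun i => ?_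
    · unfold restrict
      rw [← congrFun (orderEmbOfFin_unique (s := leftCycle n m ⊤) rfl
        (f := fun i => Fin.castAdd m (Fin.cast hLc i)) (fun i => hLm _)
        (fun _ _ h => h)) i, Fin.append_left]
    · unfold restrict
      rw [← congrFun (orderEmbOfFin_unique (s := rightCycle n m ⊤) rfl
        (f := fun i => Fin.natAdd n (Fin.cast hRc i)) (fun i => hRm _)
        (fun _ _ h => Nat.add_lt_add_left h n)) i, Fin.append_right]
  rw [h1, hM, htop, erase_singleton, prod_empty, mul_one, cumulant₂]
  have h2 : ∀ p ∈ (typeTwo n m).erase (⊤, gamma n m),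
      (leftCycle n m p.1).card + (rightCycle n m p.1).card < n + m :=
    fun p hp => card_lt_of_mem_typeTwo (mem_of_mem_erase hp) (ne_of_mem_erase hp)
  have h3 : ∀ u v w : ℂ, u = v + (u - v - w + w) := fun u v w => by ring
  refine (h3 _ _ _).trans (congrArg _ (congrArg _ ?_))
  refine sum_congr rfl fun p hp => ?_
  rw [dif_pos (h2 p hp)]

end SecondOrderSpace

/-! ### The graph of a partition -/

/-- `i` and `j` stand for the numbers `2k - 1` and `2k`, for some `k`. -/
def IsEdge {N : ℕ} (i j : Fin N) : Prop := Even i.val ∧ j.val = i.val + 1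

/-- The simple graph underlying the multigraph `G_U`: the vertices are the blocks of `U`, and two
different blocks are adjacent if for some `k` one contains `2k - 1` and the other `2k`. Loops and
multiple edges, which are dropped here, affect neither connectedness nor distances. -/
def blockGraph {N : ℕ} (U : Finpartition (univ : Finset (Fin N))) :
    SimpleGraph {V : Finset (Fin N) // V ∈ U.parts} :=
  SimpleGraph.fromRel fun V W => ∃ i j, IsEdge i j ∧ i ∈ V.1 ∧ j ∈ W.1

/-- The multigraph `G_U` is bipartite: for some set `T` of blocks every edge, loops included, joins
a block in `T` to a block not in `T`. -/
def IsBipartiteGraph {N : ℕ} (U : Finpartition (univ : Finset (Fin N))) : Prop :=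
  ∃ T : Set (Finset (Fin N)), ∀ i j, IsEdge i j → ¬ (U.part i ∈ T ↔ U.part j ∈ T)

/-- The distance of two blocks of `U` in `G_U` is defined and even. -/
def EvenDist {N : ℕ} (U : Finpartition (univ : Finset (Fin N))) (V W : Finset (Fin N)) : Prop :=
  ∃ (hV : V ∈ U.parts) (hW : W ∈ U.parts), (blockGraph U).Reachable ⟨V, hV⟩ ⟨W, hW⟩ ∧
    Even ((blockGraph U).dist ⟨V, hV⟩ ⟨W, hW⟩)

/-- The distance of two blocks of `U` in `G_U` is defined and odd. -/
def OddDist {N : ℕ} (U : Finpartition (univ : Finset (Fin N))) (V W : Finset (Fin N)) : Prop :=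
  ∃ (hV : V ∈ U.parts) (hW : W ∈ U.parts), (blockGraph U).Reachable ⟨V, hV⟩ ⟨W, hW⟩ ∧
    Odd ((blockGraph U).dist ⟨V, hV⟩ ⟨W, hW⟩)

open scoped Classical in
/-- The block of `U` which contains the number `1`. -/
def firstBlock {N : ℕ} (U : Finpartition (univ : Finset (Fin N))) : Finset (Fin N) :=
  univ.filter fun i => ∃ j ∈ U.part i, j.val = 0

open scoped Classical in
/-- The blocks of `U` at even distance from the block `R`. -/
def evenBlocks {N : ℕ} (U : Finpartition (univ : Finset (Fin N))) (R : Finset (Fin N)) :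
    Finset (Finset (Fin N)) :=
  U.parts.filter fun V => EvenDist U R V

open scoped Classical in
/-- The blocks of `U` at odd distance from the block `R`. -/
def oddBlocks {N : ℕ} (U : Finpartition (univ : Finset (Fin N))) (R : Finset (Fin N)) :
    Finset (Finset (Fin N)) :=
  U.parts.filter fun V => OddDist U R V

/-- No cycle of `σ` contains two different even numbers. -/
def SeparatesEven {N : ℕ} (σ : Equiv.Perm (Fin N)) : Prop :=
  ∀ i j : Fin N, Even (i.val + 1) → Even (j.val + 1) → σ.SameCycle i j → i = j

open scoped Classical in
/-- The set `J_{2n,2m}` of all `π ∈ S_NC(2n,2m)` such that `G_π` is bipartite and `π⁻¹ γ_{2n,2m}`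
separates even numbers. -/
def setJ (n m : ℕ) : Finset (Equiv.Perm (Fin (2 * n + 2 * m))) :=
  (annularNC (2 * n) (2 * m)).filter fun π =>
    IsBipartiteGraph (cyclePartition π) ∧ SeparatesEven (π⁻¹ * gamma (2 * n) (2 * m))

open scoped Classical in
/-- The set `X_{2n,2m}` of all `(U, π) ∈ S'_NC(2n,2m)` such that `G_U` is bipartite and connected. -/
def setX (n m : ℕ) :
    Finset (Finpartition (univ : Finset (Fin (2 * n + 2 * m))) ×
      Equiv.Perm (Fin (2 * n + 2 * m))) :=
  (typeTwo (2 * n) (2 * m)).filter fun p => IsBipartiteGraph p.1 ∧ (blockGraph p.1).Connected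

/-- The part `π'` of `π ∈ J_{2n,2m}`: the cycles at even distance from the cycle containing `1`. -/
def cycleEven {N : ℕ} (π : Equiv.Perm (Fin N)) : Finset (Finset (Fin N)) :=
  evenBlocks (cyclePartition π) (firstBlock (cyclePartition π))

/-- The part `π''` of `π ∈ J_{2n,2m}`: the cycles at odd distance from the cycle containing `1`. -/
def cycleOdd {N : ℕ} (π : Equiv.Perm (Fin N)) : Finset (Finset (Fin N)) :=
  oddBlocks (cyclePartition π) (firstBlock (cyclePartition π))

/-- The part `π'` of `(U, π) ∈ X_{2n,2m}`: the cycles of `π` other than `A` and `B`, that is, the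
blocks of `U` other than `A ∪ B`, at even distance from `A ∪ B` in `G_U`. -/
def typeTwoEven (n m : ℕ) (U : Finpartition (univ : Finset (Fin (n + m)))) :
    Finset (Finset (Fin (n + m))) :=
  (evenBlocks U (mergedBlock n m U)).erase (mergedBlock n m U)

/-- The part `π''` of `(U, π) ∈ X_{2n,2m}`: the cycles of `π` at odd distance from `A ∪ B`. -/
def typeTwoOdd (n m : ℕ) (U : Finpartition (univ : Finset (Fin (n + m)))) :
    Finset (Finset (Fin (n + m))) :=
  oddBlocks U (mergedBlock n m U)

end Annular

end

/-! Both moment-cumulant formulas are sums over one kind of object. Give a partitioned permutation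
`(U, π)` the length `|(U, π)| = 2|U| - |π|`, where `|U|` and `|π|` are the number of elements minus
the number of blocks or cycles. Lengths obey a triangle inequality relative to a permutation `γ`,
and `defect` measures the failure of equality. The pairs of defect `0` with `U ∨ γ = ⊤` are the
non-crossing partitions if `γ` is a single cycle (`isNoncrossingPerm_iff`,
`mem_planarPairs_finRotate`), and `S_NC(n,m)` together with `S'_NC(n,m)` if `γ = γ_{n,m}`
(`mem_planarPairs_gamma`). So one argument serves both orders.

Put `c = ab + ba`. Expanding a product of `c`'s chooses `ab` or `ba` for each factor, so the moments
of `c` are sums over planar pairs `(U, π)` of the doubled permutation `dbl γ`, weighted by the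
cumulants of the letters. For each `π` there is exactly one `σ` such that `π⁻¹ * dbl σ` separates
even numbers (`exists_sep`, `sep_unique`). If `V` is the projection of `U ∨ dbl σ`, the defects add:
that of `(U, π)` relative to `dbl γ` is that of `(U, π)` relative to `dbl σ` plus that of `(V, σ)`
relative to `γ` (`Sep.defect_dbl`). Hence the planar pairs of `dbl γ` fibre over those of `γ`
(`sum_planarPairs_dbl`), and the sum over a fibre is a product over the blocks of `V`
(`exists_sum_colourSum_eq_prod`). The moment-cumulant formula for the single variable `c` is a sum
over the same base. By induction on the size all terms except the one of `(⊤, γ)` agree, so these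
agree as well: the cumulant of `c` is the sum over the planar `(U, π)` for which `π⁻¹ * dbl γ`
separates even numbers (`combined_finRotate`, `combined_gamma`).

By freeness a choice of letters contributes only if it is constant on the blocks of `U`; the two
letters of a factor differ. The choices that matter are thus the proper 2-colourings of `G_U`.
Separation of even numbers makes `G_U` connected (`connected_of_separatesEven`), so there are no
such colourings or exactly two, read off from parities of distances
(`sum_pairVal_of_isBipartiteGraph`). For pairs of type 2 connectedness conversely implies separation
(`separatesEven_of_connected`), which is why `X_{2n,2m}` asks only for a connected graph. -/

noncomputable section

namespace Annular

open scoped Classical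

set_option linter.unusedSectionVars false

/-! ### Lattice of set partitions -/

/-- The partition into cycles of a permutation. -/
abbrev cyc {Y : Type*} (f : Equiv.Perm Y) : Setoid Y := Equiv.Perm.SameCycle.setoid f

/-- The number of blocks of a partition. -/
def nq {Y : Type*} (s : Setoid Y) : ℕ := Nat.card (Quotient s)

/-- The number of cycles of a permutation. -/
abbrev nc {Y : Type*} (f : Equiv.Perm Y) : ℕ := nq (cyc f)

instance {Y : Type*} [Finite Y] : Finite (Setoid Y) :=
  Finite.of_injective (fun s : Setoid Y => fun a b => s a b) fun _ _ h =>
    Setoid.ext fun a b => iff_of_eq (congrFun (congrFun h a) b)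

instance {Y : Type*} [Fintype Y] : Fintype (Setoid Y) := Fintype.ofFinite _

section Lattice

variable {Y : Type*} {s t : Setoid Y} {x y : Y} {f g : Equiv.Perm Y}

theorem cyc_apply (a b : Y) : cyc f a b ↔ f.SameCycle a b := Iff.rfl

theorem cyc_le_iff [Finite Y] : cyc f ≤ s ↔ ∀ a, s a (f a) := by
  refine ⟨fun h a => h (Equiv.Perm.sameCycle_apply_right.2 (Equiv.Perm.SameCycle.refl f a)),
    fun h a b hab => ?_⟩
  obtain ⟨k, rfl⟩ := Equiv.Perm.SameCycle.exists_nat_pow_eq hab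
  clear hab
  induction k with
  | zero => exact s.refl _
  | succ k ih =>
    rw [pow_succ', Equiv.Perm.mul_apply]
    exact s.trans ih (h _)

theorem cyc_inv : cyc f⁻¹ = cyc f := Setoid.ext fun _ _ => Equiv.Perm.sameCycle_inv

theorem cyc_one : cyc (1 : Equiv.Perm Y) = ⊥ := by
  ext a b
  simp [cyc_apply]

theorem eq_one_of_cyc_eq_bot (h : cyc f = ⊥) : f = 1 := by
  ext a
  have : cyc f a (f a) := Equiv.Perm.sameCycle_apply_right.2 (Equiv.Perm.SameCycle.refl f a)
  rw [h] at this
  exact (this : a = f a).symm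

theorem nq_bot : nq (⊥ : Setoid Y) = Nat.card Y :=
  Nat.card_congr (Equiv.ofBijective (fun y => (Quotient.mk ⊥ y : Quotient (⊥ : Setoid Y)))
    ⟨fun _ _ h => Quotient.exact h, Quotient.mk_surjective⟩).symm

theorem nq_top [Nonempty Y] : nq (⊤ : Setoid Y) = 1 := by
  rw [nq, Nat.card_eq_one_iff_unique]
  exact ⟨⟨fun a b => Quotient.inductionOn₂ a b fun _ _ => Quotient.sound trivial⟩,
    ‹Nonempty Y›.map (Quotient.mk ⊤)⟩

theorem eq_top_of_nq_le_one [Finite Y] (h : nq s ≤ 1) : s = ⊤ := by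
  ext a b
  have : Subsingleton (Quotient s) := Finite.card_le_one_iff_subsingleton.1 h
  exact ⟨fun _ => trivial, fun _ => Quotient.exact (Subsingleton.elim _ _)⟩

theorem one_le_nq [Finite Y] [Nonempty Y] : 1 ≤ nq s := by
  have : Nonempty (Quotient s) := ‹Nonempty Y›.map (Quotient.mk s)
  exact Nat.card_pos

theorem nq_le_of_le [Finite Y] (h : s ≤ t) : nq t ≤ nq s :=
  Nat.card_le_card_of_surjective (Setoid.map_of_le h) fun q =>
    Quotient.inductionOn q fun a => ⟨Quotient.mk s a, rfl⟩

theorem eq_of_le_of_nq_le [Finite Y] (h : s ≤ t) (hn : nq s ≤ nq t) : s = t := by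
  have hs : Function.Surjective (Setoid.map_of_le h) := fun q =>
    Quotient.inductionOn q fun a => ⟨Quotient.mk s a, rfl⟩
  have hb : Function.Bijective (Setoid.map_of_le h) :=
    (Nat.bijective_iff_surjective_and_card _).2 ⟨hs, le_antisymm hn (nq_le_of_le h)⟩
  refine le_antisymm h fun a b hab => ?_
  exact Quotient.exact (hb.1 (Quotient.sound hab : (Quotient.mk t a) = Quotient.mk t b))

theorem nq_comap_of_surjective {Z : Type*} {p : Z → Y} (hp : Function.Surjective p) :
    nq (s.comap p) = nq s := by
  refine Nat.card_congr (Equiv.ofBijective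
    (Quotient.map' p fun _ _ h => h : Quotient (s.comap p) → Quotient s) ⟨?_, ?_⟩)
  · intro a b
    refine Quotient.inductionOn₂ a b fun a b h => ?_
    exact Quotient.sound (Quotient.exact h : s (p a) (p b))
  · intro q
    refine Quotient.inductionOn q fun a => ?_
    obtain ⟨z, rfl⟩ := hp a
    exact ⟨Quotient.mk _ z, rfl⟩

/-- The partition obtained by merging the blocks of `x` and `y`. -/
def joinPair (s : Setoid Y) (x y : Y) : Setoid Y where
  r a b := s a b ∨ (s a x ∧ s y b) ∨ (s a y ∧ s x b)
  iseqv := by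
    refine ⟨fun a => Or.inl (s.refl a), fun {a b} h => ?_, fun {a b c} h h' => ?_⟩
    · rcases h with h | ⟨h, h'⟩ | ⟨h, h'⟩
      · exact Or.inl (s.symm h)
      · exact Or.inr (Or.inr ⟨s.symm h', s.symm h⟩)
      · exact Or.inr (Or.inl ⟨s.symm h', s.symm h⟩)
    · have tr : ∀ {a b c}, s a b → s b c → s a c := s.trans
      rcases h with h | ⟨h1, h2⟩ | ⟨h1, h2⟩ <;> rcases h' with h' | ⟨h3, h4⟩ | ⟨h3, h4⟩
      · exact Or.inl (tr h h')
      · exact Or.inr (Or.inl ⟨tr h h3, h4⟩)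
      · exact Or.inr (Or.inr ⟨tr h h3, h4⟩)
      · exact Or.inr (Or.inl ⟨h1, tr h2 h'⟩)
      · exact Or.inr (Or.inl ⟨h1, h4⟩)
      · exact Or.inl (tr h1 h4)
      · exact Or.inr (Or.inr ⟨h1, tr h2 h'⟩)
      · exact Or.inl (tr h1 h4)
      · exact Or.inr (Or.inr ⟨h1, h4⟩)

theorem joinPair_apply (a b : Y) :
    joinPair s x y a b ↔ s a b ∨ (s a x ∧ s y b) ∨ (s a y ∧ s x b) := Iff.rfl

theorem joinPair_le_iff : joinPair s x y ≤ t ↔ s ≤ t ∧ t x y := by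
  refine ⟨fun h => ⟨fun a b hab => h (Or.inl hab),
    h (Or.inr (Or.inl ⟨s.refl x, s.refl y⟩))⟩, fun ⟨h, hxy⟩ a b hab => ?_⟩
  rcases hab with h' | ⟨h1, h2⟩ | ⟨h1, h2⟩
  · exact h h'
  · exact t.trans (h h1) (t.trans hxy (h h2))
  · exact t.trans (h h1) (t.trans (t.symm hxy) (h h2))

theorem le_joinPair : s ≤ joinPair s x y := (joinPair_le_iff.1 le_rfl).1

theorem joinPair_pair : joinPair s x y x y := (joinPair_le_iff.1 le_rfl).2

theorem joinPair_eq_self (h : s x y) : joinPair s x y = s :=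
  le_antisymm (joinPair_le_iff.2 ⟨le_rfl, h⟩) le_joinPair

theorem joinPair_sup : joinPair s x y ⊔ t = joinPair (s ⊔ t) x y := by
  refine le_antisymm (sup_le (joinPair_le_iff.2 ⟨le_sup_left.trans le_joinPair, joinPair_pair⟩)
    (le_sup_right.trans le_joinPair)) (joinPair_le_iff.2 ⟨sup_le_sup_right le_joinPair t, ?_⟩)
  exact (le_sup_left : _ ≤ joinPair s x y ⊔ t) joinPair_pair

theorem nq_joinPair [Finite Y] (h : ¬ s x y) : nq (joinPair s x y) + 1 = nq s := by
  have : Fintype (Quotient s) := Fintype.ofFinite _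
  -- The merged block is represented by the block of `x`, so deleting the block of `y` leaves one
  -- representative for each block of the coarser partition.
  let F : {q : Quotient s // q ≠ Quotient.mk s y} → Quotient (joinPair s x y) :=
    fun q => Setoid.map_of_le le_joinPair q.1
  have hF : Function.Bijective F := by
    constructor
    · rintro ⟨q, hq⟩ ⟨q', hq'⟩ hqq
      induction q using Quotient.inductionOn with | _ a =>
      induction q' using Quotient.inductionOn with | _ b =>
      refine Subtype.ext ?_
      have hab : joinPair s x y a b := Quotient.exact hqq
      rcases hab with h | ⟨_, h2⟩ | ⟨h2, _⟩
      · exact Quotient.sound h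
      · exact absurd (Quotient.sound (s.symm h2)) hq'
      · exact absurd (Quotient.sound h2) hq
    · intro q
      induction q using Quotient.inductionOn with | _ a =>
      by_cases hay : s a y
      · refine ⟨⟨Quotient.mk s x, fun h' => h (Quotient.exact h')⟩, Quotient.sound ?_⟩
        exact Or.inr (Or.inl ⟨s.refl x, s.symm hay⟩)
      · exact ⟨⟨Quotient.mk s a, fun h' => hay (Quotient.exact h')⟩, rfl⟩
  rw [nq, ← Nat.card_congr (Equiv.ofBijective F hF), nq, Nat.card_eq_fintype_card,
    Nat.card_eq_fintype_card, Fintype.card_subtype_compl, Fintype.card_subtype_eq]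
  have : 0 < Fintype.card (Quotient s) := Fintype.card_pos_iff.2 ⟨Quotient.mk s y⟩
  omega

/-! ### Semimodularity of the number of blocks, by linear algebra -/

/-- The functions which are constant on the blocks of a partition. -/
def blockFunctions (s : Setoid Y) : Submodule ℚ (Y → ℚ) where
  carrier := {u | ∀ a b, s a b → u a = u b}
  add_mem' hu hv a b h := congrArg₂ (· + ·) (hu a b h) (hv a b h)
  zero_mem' _ _ _ := rfl
  smul_mem' c _ hu a b h := congrArg (c * ·) (hu a b h)

theorem finrank_blockFunctions [Finite Y] : Module.finrank ℚ (blockFunctions s) = nq s := by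
  have : Fintype (Quotient s) := Fintype.ofFinite _
  let e : blockFunctions s ≃ₗ[ℚ] (Quotient s → ℚ) :=
    { toFun := fun u => Quotient.lift u.1 u.2
      invFun := fun v => ⟨fun a => v (Quotient.mk s a), fun a b h =>
        congrArg v (Quotient.sound h)⟩
      map_add' := fun u v => funext fun q => Quotient.inductionOn q fun _ => rfl
      map_smul' := fun c u => funext fun q => Quotient.inductionOn q fun _ => rfl
      left_inv := fun u => rfl
      right_inv := fun v => funext fun q => Quotient.inductionOn q fun _ => rfl }
  rw [e.finrank_eq, Module.finrank_fintype_fun_eq_card, nq, Nat.card_eq_fintype_card]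

/-- A function is constant on the blocks of both partitions exactly when its kernel contains both,
hence their join. Block counts thereby become dimensions, and joins become intersections. -/
theorem blockFunctions_sup : blockFunctions (s ⊔ t) = blockFunctions s ⊓ blockFunctions t := by
  refine le_antisymm (le_inf (fun u hu a b h => hu a b ((le_sup_left : s ≤ s ⊔ t) h))
    fun u hu a b h => hu a b ((le_sup_right : t ≤ s ⊔ t) h)) fun u hu => ?_
  have h : s ⊔ t ≤ Setoid.ker u := sup_le (fun {a b} h => hu.1 a b h) fun {a b} h => hu.2 a b h
  exact fun a b hab => h hab

theorem blockFunctions_anti (h : s ≤ t) : blockFunctions t ≤ blockFunctions s :=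
  fun _ hu a b hab => hu a b (h hab)

/-- Joining with a partition does not enlarge the difference of block numbers. -/
theorem nq_add_nq_sup_le [Finite Y] {u : Setoid Y} (h : s ≤ u) :
    nq u + nq (s ⊔ t) ≤ nq s + nq (u ⊔ t) := by
  have : Fintype Y := Fintype.ofFinite _
  -- The dimension formula for the functions of `u` and of `s ⊔ t`: their intersection belongs to `u
  -- ⊔ t`, and their sum lies in the space of `s`, of dimension `nq s`.
  have key := Submodule.finrank_sup_add_finrank_inf_eq (blockFunctions u) (blockFunctions (s ⊔ t))
  rw [← blockFunctions_sup, ← sup_assoc, sup_eq_left.2 h, finrank_blockFunctions,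
    finrank_blockFunctions, finrank_blockFunctions] at key
  have hle : Module.finrank ℚ ↥(blockFunctions u ⊔ blockFunctions (s ⊔ t)) ≤ nq s := by
    rw [← finrank_blockFunctions (s := s)]
    exact Submodule.finrank_mono (sup_le (blockFunctions_anti h) (blockFunctions_anti le_sup_left))
  omega

/-- If `u` arises from `s` by a single merging, it merges the blocks of any `x`, `y` that it
relates in addition. -/
theorem eq_joinPair [Finite Y] {u : Setoid Y} (h : s ≤ u) (hn : nq s = nq u + 1)
    (hxy : ¬ s x y) (hu : u x y) : u = joinPair s x y := by
  refine (eq_of_le_of_nq_le (joinPair_le_iff.2 ⟨h, hu⟩) ?_).symm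
  have := nq_joinPair hxy
  omega

/-! ### Multiplication by a transposition -/

/-- The orbit of `x` under the product follows that of `f` until `f` would return to `x`; there the
transposition diverts it to `y`. So `x` and `y` become related, and nothing else changes. -/
theorem cyc_swap_mul [Finite Y] [DecidableEq Y] (h : ¬ cyc f x y) :
    cyc (Equiv.swap x y * f) = joinPair (cyc f) x y := by
  set g := Equiv.swap x y * f with hg
  have hgf : ∀ a, g a = Equiv.swap x y (f a) := fun _ => rfl
  have hfa : ∀ a, cyc f a (f a) := cyc_le_iff.1 le_rfl
  have hga : ∀ a, cyc g a (g a) := cyc_le_iff.1 le_rfl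
  have hxy : cyc g x y := by
    have claim : ∀ k : ℕ, cyc g x ((f ^ k) x) ∨ cyc g x y := by
      intro k
      induction k with
      | zero => exact Or.inl ((cyc g).refl x)
      | succ k ih =>
        refine ih.elim (fun hk => ?_) Or.inr
        rw [pow_succ', Equiv.Perm.mul_apply]
        have h1 := (cyc g).trans hk (hga _)
        rw [hgf] at h1
        by_cases hx : f ((f ^ k) x) = x
        · rw [hx, Equiv.swap_apply_left] at h1
          exact Or.inr h1
        · rw [Equiv.swap_apply_of_ne_of_ne hx] at h1
          · exact Or.inl h1
          · intro hy
            apply h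
            rw [← hy]
            exact ⟨(k + 1 : ℕ), by rw [zpow_natCast, pow_succ', Equiv.Perm.mul_apply]⟩
    -- With this `k` the next step of `f` is a return to `x`, which the transposition turns into
    -- `y`.
    obtain ⟨k, hk⟩ : ∃ k : ℕ, k + 1 = orderOf f :=
      ⟨orderOf f - 1, Nat.sub_add_cancel (orderOf_pos f)⟩
    refine (claim k).elim (fun h1 => ?_) id
    have h2 : cyc g x (g ((f ^ k) x)) := (cyc g).trans h1 (hga _)
    rwa [hgf, ← Equiv.Perm.mul_apply f, ← pow_succ', hk, pow_orderOf_eq_one, Equiv.Perm.one_apply,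
      Equiv.swap_apply_left] at h2
  have hsw : ∀ (s : Setoid Y), s x y → ∀ a, s a (Equiv.swap x y a) := by
    intro s hs a
    by_cases hx : a = x
    · rw [hx, Equiv.swap_apply_left]
      exact hs
    · by_cases hy : a = y
      · rw [hy, Equiv.swap_apply_right]
        exact s.symm hs
      · rw [Equiv.swap_apply_of_ne_of_ne hx hy]
  refine le_antisymm (cyc_le_iff.2 fun a => ?_)
    (joinPair_le_iff.2 ⟨cyc_le_iff.2 fun a => ?_, hxy⟩)
  · exact (joinPair (cyc f) x y).trans (le_joinPair (hfa a)) (hsw _ joinPair_pair _)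
  · exact (cyc g).trans (hga a) ((cyc g).symm (hsw _ hxy (f a)))

/-- Let `k` be the first time at which `f` takes `x` to `y`. The transposition sends that step back
to `x`, so the new orbit of `x` is confined to `x, f x, …, f^(k-1) x` and misses `y`. -/
theorem not_cyc_swap_mul [Finite Y] [DecidableEq Y] (hne : x ≠ y) (h : cyc f x y) :
    ¬ cyc (Equiv.swap x y * f) x y := by
  have hex : ∃ k : ℕ, (f ^ k) x = y := Equiv.Perm.SameCycle.exists_nat_pow_eq h
  set k := Nat.find hex with hk
  have hky : (f ^ k) x = y := Nat.find_spec hex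
  have hmin : ∀ i < k, (f ^ i) x ≠ y := fun i hi => Nat.find_min hex hi
  have hk0 : k ≠ 0 := fun h0 => hne (by rw [← hky, h0]; rfl)
  have hnx : ∀ i, 0 < i → i < k → (f ^ i) x ≠ x := by
    intro i hi hik hx
    apply hmin (k - i) (by omega)
    have : (f ^ (k - i)) ((f ^ i) x) = y := by
      rw [← Equiv.Perm.mul_apply, ← pow_add, Nat.sub_add_cancel hik.le, hky]
    rwa [hx] at this
  have inv : ∀ l : ℕ, ∃ i < k, ((Equiv.swap x y * f) ^ l) x = (f ^ i) x := by
    intro l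
    induction l with
    | zero => exact ⟨0, Nat.pos_of_ne_zero hk0, rfl⟩
    | succ l ih =>
      obtain ⟨i, hi, hl⟩ := ih
      have e : ((Equiv.swap x y * f) ^ (l + 1)) x = Equiv.swap x y ((f ^ (i + 1)) x) := by
        rw [pow_succ', Equiv.Perm.mul_apply, hl, pow_succ']
        rfl
      rw [e]
      by_cases hik : i + 1 = k
      · exact ⟨0, Nat.pos_of_ne_zero hk0, by rw [hik, hky, Equiv.swap_apply_right]; rfl⟩
      · exact ⟨i + 1, by omega, Equiv.swap_apply_of_ne_of_ne (hnx _ (by omega) (by omega))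
          (hmin _ (by omega))⟩
  intro hxy
  obtain ⟨l, hl⟩ := Equiv.Perm.SameCycle.exists_nat_pow_eq hxy
  obtain ⟨i, hi, hi'⟩ := inv l
  exact hmin i hi (hi' ▸ hl)

theorem nc_swap_mul_of_not [Finite Y] [DecidableEq Y] (h : ¬ cyc f x y) :
    nc (Equiv.swap x y * f) + 1 = nc f := by
  rw [nc, cyc_swap_mul h, nq_joinPair h]

theorem nc_swap_mul_of_cyc [Finite Y] [DecidableEq Y] (hne : x ≠ y) (h : cyc f x y) :
    nc (Equiv.swap x y * f) = nc f + 1 := by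
  have := nc_swap_mul_of_not (not_cyc_swap_mul hne h)
  rw [Equiv.swap_mul_self_mul] at this
  omega

/-! ### The genus inequality and the defect -/

theorem nc_inv : nc f⁻¹ = nc f := by rw [nc, cyc_inv]

theorem nc_conj : nc (g * f * g⁻¹) = nc f := by
  have : cyc (g * f * g⁻¹) = (cyc f).comap ⇑(g⁻¹) := Setoid.ext fun _ _ =>
    Equiv.Perm.sameCycle_conj
  rw [nc, this, nq_comap_of_surjective (g⁻¹).surjective]

/-- The inverse of `f⁻¹ * g` is conjugate by `f` to `f * g⁻¹`. In the second form a transposition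
multiplied to `f` from the left stays on the left, which the induction for the genus inequality
needs. -/
theorem nc_inv_mul : nc (f⁻¹ * g) = nc (f * g⁻¹) := by
  rw [← nc_inv, ← nc_conj (g := f) (f := (f⁻¹ * g)⁻¹), mul_inv_rev, inv_inv, mul_assoc, mul_assoc,
    mul_inv_cancel, mul_one]

/-- Every permutation other than the identity arises from one with smaller support by merging a
fixed point with another cycle. -/
theorem perm_merge_induction [Finite Y] [DecidableEq Y] {P : Equiv.Perm Y → Prop} (one : P 1)
    (merge : ∀ (f : Equiv.Perm Y) (x y : Y), ¬ cyc f x y → P f → P (Equiv.swap x y * f))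
    (f : Equiv.Perm Y) : P f := by
  have : Fintype Y := Fintype.ofFinite _
  induction hn : f.support.card using Nat.strong_induction_on generalizing f with
  | _ n ih =>
    by_cases h1 : f = 1
    · exact h1 ▸ one
    · obtain ⟨x, hx⟩ : ∃ x, f x ≠ x := by
        by_contra hcon
        push Not at hcon
        exact h1 (Equiv.ext hcon)
      have hlt := Equiv.Perm.card_support_swap_mul hx
      have h := merge (Equiv.swap x (f x) * f) x (f x)
        (not_cyc_swap_mul hx.symm (cyc_le_iff.1 le_rfl x)) (ih _ (hn ▸ hlt) _ rfl)
      rwa [Equiv.swap_mul_self_mul] at h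

/-- The genus inequality. -/
theorem nc_add_nc_add_nc_le [Finite Y] (f g : Equiv.Perm Y) :
    nc f + nc (f⁻¹ * g) + nc g ≤ Nat.card Y + 2 * nq (cyc f ⊔ cyc g) := by
  rw [nc_inv_mul]
  induction f using perm_merge_induction with
  | one =>
    rw [one_mul, nc_inv, nc, cyc_one, nq_bot, bot_sup_eq]
    unfold nc
    omega
  | merge f x y h ih =>
    have h1 := nc_swap_mul_of_not h
    have h2 : cyc (Equiv.swap x y * f) ⊔ cyc g = joinPair (cyc f ⊔ cyc g) x y := by
      rw [cyc_swap_mul h, joinPair_sup]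
    rw [h2, mul_assoc]
    have hne : x ≠ y := fun e => h (e ▸ (cyc f).refl x)
    -- The merge lowers `nc f` by one. If it splits a cycle of `f * g⁻¹`, then `x` and `y` already
    -- lie in one block of the join and both sides are unchanged. Otherwise the left side drops by
    -- two and the right side by at most two.
    by_cases hK : cyc (f * g⁻¹) x y
    · have h3 := nc_swap_mul_of_cyc hne hK
      have h4 : cyc (f * g⁻¹) ≤ cyc f ⊔ cyc g := cyc_le_iff.2 fun a => by
        refine (cyc f ⊔ cyc g).trans ((le_sup_right : cyc g ≤ _) ?_)
          ((le_sup_left : cyc f ≤ _) (cyc_le_iff.1 le_rfl (g⁻¹ a)))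
        exact Equiv.Perm.SameCycle.symm ⟨1, by simp⟩
      rw [joinPair_eq_self (h4 hK)]
      omega
    · have h3 := nc_swap_mul_of_not hK
      by_cases h5 : (cyc f ⊔ cyc g) x y
      · rw [joinPair_eq_self h5]
        omega
      · have := nq_joinPair h5
        omega

/-- The defect of a partitioned permutation relative to a permutation. -/
def defect (U : Setoid Y) (π γ : Equiv.Perm Y) : ℤ :=
  -- This is `|(U, π)| + |π⁻¹ γ| - |(U ∨ γ, γ)|` with `|(U, π)| = 2|U| - |π|`. It is integer-valued,
  -- so that no truncated subtraction occurs.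
  Nat.card Y + 2 * nq (U ⊔ cyc γ) + nc π - 2 * nq U - nc (π⁻¹ * γ) - nc γ

/-- The defect is the gap in the genus inequality for `π` and `γ` plus twice the gap in the
semimodular inequality `nq_add_nq_sup_le` for `cyc π ≤ U`. It therefore vanishes exactly when both
gaps do. -/
theorem defect_nonneg [Finite Y] {U : Setoid Y} {π γ : Equiv.Perm Y} (h : cyc π ≤ U) :
    0 ≤ defect U π γ := by
  have h1 := nc_add_nc_add_nc_le π γ
  have h2 := nq_add_nq_sup_le (t := cyc γ) h
  unfold defect
  unfold nc at *
  omega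

/-- A partitioned permutation of defect `0` is planar, and merges cycles only across `γ`. -/
theorem defect_eq_zero_iff [Finite Y] {U : Setoid Y} {π γ : Equiv.Perm Y} (h : cyc π ≤ U) :
    defect U π γ = 0 ↔ nc π + nc (π⁻¹ * γ) + nc γ = Nat.card Y + 2 * nq (cyc π ⊔ cyc γ) ∧
      nq U + nq (cyc π ⊔ cyc γ) = nc π + nq (U ⊔ cyc γ) := by
  have h1 := nc_add_nc_add_nc_le π γ
  have h2 := nq_add_nq_sup_le (t := cyc γ) h
  unfold defect
  unfold nc at *
  omega

end Lattice

/-- The partitioned permutations `(U, π)` of defect `0` relative to `γ` with `U ∨ γ = V`. -/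
def planarPairs {Y : Type*} [Fintype Y] (V : Setoid Y) (γ : Equiv.Perm Y) :
    Finset (Setoid Y × Equiv.Perm Y) :=
  univ.filter fun p => cyc p.2 ≤ p.1 ∧ p.1 ⊔ cyc γ = V ∧ defect p.1 p.2 γ = 0

theorem mem_planarPairs {Y : Type*} [Fintype Y] {V : Setoid Y} {γ : Equiv.Perm Y}
    {p : Setoid Y × Equiv.Perm Y} : p ∈ planarPairs V γ ↔
      cyc p.2 ≤ p.1 ∧ p.1 ⊔ cyc γ = V ∧ defect p.1 p.2 γ = 0 := by
  simp [planarPairs]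

/-! ### Blocks -/

section Blocks

variable {Y : Type*} [Fintype Y]

/-- The class of the quotient element `q` as a finite set. -/
def cls (U : Setoid Y) (q : Quotient U) : Finset Y := univ.filter fun y => Quotient.mk U y = q

theorem mem_cls {U : Setoid Y} {q : Quotient U} {y : Y} : y ∈ cls U q ↔ Quotient.mk U y = q := by
  simp [cls]

theorem mem_cls_mk {U : Setoid Y} {x y : Y} : y ∈ cls U (Quotient.mk U x) ↔ U x y := by
  rw [mem_cls, eq_comm]
  exact Quotient.eq

/-- The finite set of all blocks of a partition. -/
def blocks (U : Setoid Y) : Finset (Finset Y) := univ.image (cls U)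

theorem cls_injective (U : Setoid Y) : Function.Injective (cls U) := by
  intro q q' h
  induction q using Quotient.inductionOn with | _ a =>
  have : a ∈ cls U (Quotient.mk U a) := mem_cls.2 rfl
  rw [h] at this
  exact mem_cls.1 this

theorem prod_blocks {M : Type*} [CommMonoid M] (U : Setoid Y) (F : Finset Y → M) :
    ∏ B ∈ blocks U, F B = ∏ q : Quotient U, F (cls U q) :=
  prod_image fun _ _ _ _ h => cls_injective U h

theorem card_blocks (U : Setoid Y) : (blocks U).card = nq U := by
  rw [blocks, card_image_of_injective _ (cls_injective U), nq, Nat.card_eq_fintype_card, card_univ]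

theorem mem_blocks {U : Setoid Y} {B : Finset Y} : B ∈ blocks U ↔ ∃ y, B = cls U (Quotient.mk U y) := by
  simp only [blocks, mem_image, mem_univ, true_and]
  constructor
  · rintro ⟨q, rfl⟩
    exact Quotient.inductionOn q fun y => ⟨y, rfl⟩
  · rintro ⟨y, rfl⟩
    exact ⟨_, rfl⟩

end Blocks

/-! ### Gluing partitions and permutations along a decomposition of the ground set -/

section Glue

variable {ι : Type*} {Z : ι → Type*} {Y : Type*} (e : (Σ b, Z b) ≃ Y)

/-- The inclusion of a piece of a decomposition. -/
def piece (b : ι) : Z b ↪ Y := ⟨fun z => e ⟨b, z⟩, fun z z' h => by simpa using h⟩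

theorem piece_apply (b : ι) (z : Z b) : piece e b z = e ⟨b, z⟩ := rfl

theorem exists_piece (y : Y) : ∃ b z, piece e b z = y :=
  ⟨(e.symm y).1, (e.symm y).2, e.apply_symm_apply y⟩

/-- The partition with given restrictions to the pieces. -/
def glueS (U : ∀ b, Setoid (Z b)) : Setoid Y where
  r y y' := ∃ b z z', piece e b z = y ∧ piece e b z' = y' ∧ U b z z'
  iseqv := by
    refine ⟨fun y => ?_, ?_, ?_⟩
    · obtain ⟨b, z, rfl⟩ := exists_piece e y
      exact ⟨b, z, z, rfl, rfl, (U b).refl z⟩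
    · rintro _ _ ⟨b, z, z', rfl, rfl, h⟩
      exact ⟨b, z', z, rfl, rfl, (U b).symm h⟩
    · rintro _ _ _ ⟨b, z, z', rfl, rfl, h⟩ ⟨b', w, w', h1, rfl, h'⟩
      cases e.injective h1
      exact ⟨b, z, w', rfl, rfl, (U b).trans h h'⟩

variable {e}

theorem glueS_piece {U : ∀ b, Setoid (Z b)} {b : ι} {z z' : Z b} :
    glueS e U (piece e b z) (piece e b z') ↔ U b z z' := by
  constructor
  · rintro ⟨b', w, w', h1, h2, h⟩
    cases e.injective h1
    cases e.injective h2
    exact h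
  · exact fun h => ⟨b, z, z', rfl, rfl, h⟩

theorem eq_of_glueS {U : ∀ b, Setoid (Z b)} {b b' : ι} {z : Z b} {z' : Z b'}
    (h : glueS e U (piece e b z) (piece e b' z')) : b = b' := by
  obtain ⟨b'', w, w', h1, h2, h⟩ := h
  cases e.injective h1
  cases e.injective h2
  rfl

theorem glueS_le_iff {U : ∀ b, Setoid (Z b)} {t : Setoid Y} :
    glueS e U ≤ t ↔ ∀ b, U b ≤ t.comap (piece e b) := by
  constructor
  · exact fun h b z z' hz => h (glueS_piece.2 hz)
  · rintro h _ _ ⟨b, z, z', rfl, rfl, hz⟩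
    exact h b hz

theorem comap_glueS (U : ∀ b, Setoid (Z b)) (b : ι) : (glueS e U).comap (piece e b) = U b :=
  Setoid.ext fun _ _ => glueS_piece

theorem glueS_le_glueS {U U' : ∀ b, Setoid (Z b)} :
    glueS e U ≤ glueS e U' ↔ ∀ b, U b ≤ U' b := by
  simp only [glueS_le_iff, comap_glueS]

theorem glueS_injective : Function.Injective (glueS e) := fun U U' h => funext fun b => by
  rw [← comap_glueS (e := e) U b, h, comap_glueS]

theorem glueS_sup (U U' : ∀ b, Setoid (Z b)) :
    glueS e U ⊔ glueS e U' = glueS e fun b => U b ⊔ U' b := by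
  refine le_antisymm (sup_le (glueS_le_glueS.2 fun _ => le_sup_left)
    (glueS_le_glueS.2 fun _ => le_sup_right)) (glueS_le_iff.2 fun b => sup_le ?_ ?_)
  · exact glueS_le_iff.1 le_sup_left b
  · exact glueS_le_iff.1 le_sup_right b

theorem glueS_comap {S : Setoid Y} (h : S ≤ glueS e fun _ => ⊤) :
    glueS e (fun b => S.comap (piece e b)) = S := by
  refine le_antisymm (glueS_le_iff.2 fun b => le_rfl) fun y y' hy => ?_
  obtain ⟨b, z, z', rfl, rfl, -⟩ := h hy
  exact ⟨b, z, z', rfl, rfl, hy⟩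

variable (e)

/-- The permutation with given restrictions to the pieces. -/
def glueP (π : ∀ b, Equiv.Perm (Z b)) : Equiv.Perm Y := e.permCongr (Equiv.sigmaCongrRight π)

variable {e}

theorem glueP_piece (π : ∀ b, Equiv.Perm (Z b)) (b : ι) (z : Z b) :
    glueP e π (piece e b z) = piece e b (π b z) := by
  simp [glueP, piece_apply]

theorem perm_ext_piece {f g : Equiv.Perm Y} (h : ∀ b z, f (piece e b z) = g (piece e b z)) :
    f = g := by
  ext y
  obtain ⟨b, z, rfl⟩ := exists_piece e y
  exact h b z

theorem glueP_mul (π σ : ∀ b, Equiv.Perm (Z b)) :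
    glueP e π * glueP e σ = glueP e fun b => π b * σ b :=
  perm_ext_piece (e := e) fun b z => by simp [glueP_piece]

theorem glueP_inv (π : ∀ b, Equiv.Perm (Z b)) : (glueP e π)⁻¹ = glueP e fun b => (π b)⁻¹ :=
  inv_eq_of_mul_eq_one_right <| perm_ext_piece (e := e) fun b z => by simp [glueP_piece]

theorem glueP_injective : Function.Injective (glueP e) := fun π σ h => funext fun b => by
  ext z
  refine (piece e b).injective ?_
  rw [← glueP_piece, h, glueP_piece]

theorem cyc_glueP [Finite Y] (π : ∀ b, Equiv.Perm (Z b)) :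
    cyc (glueP e π) = glueS e fun b => cyc (π b) := by
  have : ∀ b, Finite (Z b) := fun b => Finite.of_injective _ (piece e b).injective
  refine le_antisymm (cyc_le_iff.2 fun y => ?_) (glueS_le_iff.2 fun b => cyc_le_iff.2 fun z => ?_)
  · obtain ⟨b, z, rfl⟩ := exists_piece e y
    rw [glueP_piece]
    exact glueS_piece.2 (cyc_le_iff.1 le_rfl z)
  · rw [Setoid.comap_rel, ← glueP_piece]
    exact cyc_le_iff.1 le_rfl _

/-- A permutation whose cycles stay inside the pieces restricts to an injection of each finite
piece, hence to a permutation of it. -/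
theorem exists_eq_glueP [Finite Y] {π : Equiv.Perm Y} (h : cyc π ≤ glueS e fun _ => ⊤) :
    ∃ π' : ∀ b, Equiv.Perm (Z b), π = glueP e π' := by
  have : ∀ b, Finite (Z b) := fun b => Finite.of_injective _ (piece e b).injective
  have key : ∀ b (z : Z b), ∃ z' : Z b, piece e b z' = π (piece e b z) := by
    intro b z
    obtain ⟨b', w, w', h1, h2, -⟩ := cyc_le_iff.1 h (piece e b z)
    cases e.injective h1
    exact ⟨w', h2⟩
  choose g hg using key
  have hinj : ∀ b, Function.Injective (g b) := fun b z z' hz => by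
    refine (piece e b).injective (π.injective ?_)
    rw [← hg, ← hg, hz]
  refine ⟨fun b => Equiv.ofBijective (g b) (Finite.injective_iff_bijective.1 (hinj b)), ?_⟩
  refine perm_ext_piece (e := e) fun b z => ?_
  rw [glueP_piece, ← hg]
  rfl

variable (e)

/-- The blocks of a glued partition. -/
def glueQuotient (U : ∀ b, Setoid (Z b)) : (Σ b, Quotient (U b)) ≃ Quotient (glueS e U) :=
  Equiv.ofBijective
    (fun q => Quotient.map (piece e q.1) (fun _ _ h => glueS_piece.2 h) q.2) <| by
    constructor
    · rintro ⟨b, q⟩ ⟨b', q'⟩ h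
      induction q using Quotient.inductionOn with | _ z =>
      induction q' using Quotient.inductionOn with | _ z' =>
      have h' : glueS e U (piece e b z) (piece e b' z') := Quotient.exact h
      obtain rfl := eq_of_glueS h'
      rw [Quotient.sound (glueS_piece.1 h')]
    · intro q
      induction q using Quotient.inductionOn with | _ y =>
      obtain ⟨b, z, rfl⟩ := exists_piece e y
      exact ⟨⟨b, Quotient.mk _ z⟩, rfl⟩


/-- Glueing of partitioned permutations. -/
def glue (p : ∀ b, Setoid (Z b) × Equiv.Perm (Z b)) : Setoid Y × Equiv.Perm Y :=
  (glueS e fun b => (p b).1, glueP e fun b => (p b).2)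

variable {e}

theorem glue_injective : Function.Injective (glue e) := fun p p' h => by
  have h1 := glueS_injective (congrArg Prod.fst h)
  have h2 := glueP_injective (congrArg Prod.snd h)
  exact funext fun b => Prod.ext (congrFun h1 b) (congrFun h2 b)

variable [Fintype ι] [∀ b, Fintype (Z b)] [Fintype Y]

theorem nq_glueS (U : ∀ b, Setoid (Z b)) : nq (glueS e U) = ∑ b, nq (U b) := by
  rw [nq, ← Nat.card_congr (glueQuotient e U), Nat.card_sigma]
  rfl

theorem cls_glueQuotient (U : ∀ b, Setoid (Z b)) (b : ι) (q : Quotient (U b)) :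
    cls (glueS e U) (glueQuotient e U ⟨b, q⟩) = (cls (U b) q).map (piece e b) := by
  induction q using Quotient.inductionOn with | _ z =>
  ext y
  have : glueQuotient e U ⟨b, Quotient.mk (U b) z⟩ = Quotient.mk (glueS e U) (piece e b z) := rfl
  rw [this, mem_cls_mk, mem_map]
  constructor
  · intro h
    obtain ⟨b', z', rfl⟩ := exists_piece e y
    obtain rfl := eq_of_glueS h
    exact ⟨z', mem_cls_mk.2 (glueS_piece.1 h), rfl⟩
  · rintro ⟨z', h, rfl⟩
    exact glueS_piece.2 (mem_cls_mk.1 h)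

theorem prod_blocks_glueS {M : Type*} [CommMonoid M] (U : ∀ b, Setoid (Z b)) (F : Finset Y → M) :
    ∏ B ∈ blocks (glueS e U), F B = ∏ b, ∏ B ∈ blocks (U b), F (B.map (piece e b)) := by
  simp_rw [prod_blocks]
  rw [← Equiv.prod_comp (glueQuotient e U), Fintype.prod_sigma]
  simp_rw [cls_glueQuotient]

/-- Every ingredient of the defect is additive: cardinality, numbers of blocks and cycles, and
joins, which are formed piece by piece. -/
theorem defect_glue (U : ∀ b, Setoid (Z b)) (π γ : ∀ b, Equiv.Perm (Z b)) :
    defect (glueS e U) (glueP e π) (glueP e γ) = ∑ b, defect (U b) (π b) (γ b) := by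
  have hY : (Nat.card Y : ℤ) = ∑ b, (Nat.card (Z b) : ℤ) := by
    rw [← Nat.card_congr e, Nat.card_sigma, Nat.cast_sum]
  unfold defect nc
  rw [glueP_inv, glueP_mul, cyc_glueP, cyc_glueP, cyc_glueP, glueS_sup, nq_glueS, nq_glueS,
    nq_glueS, nq_glueS, nq_glueS, hY]
  push_cast
  simp only [sum_add_distrib, sum_sub_distrib, mul_sum]

/-- The defects of the pieces are nonnegative, so their sum vanishes only if each of them does. -/
theorem glue_mem_planarPairs {V : ∀ b, Setoid (Z b)} {γ : ∀ b, Equiv.Perm (Z b)}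
    {p : ∀ b, Setoid (Z b) × Equiv.Perm (Z b)} :
    glue e p ∈ planarPairs (glueS e V) (glueP e γ) ↔ ∀ b, p b ∈ planarPairs (V b) (γ b) := by
  simp only [mem_planarPairs, glue, defect_glue, cyc_glueP, glueS_sup, glueS_le_glueS,
    glueS_injective.eq_iff, funext_iff, forall_and]
  refine and_congr_right fun h1 => and_congr_right fun _ => ?_
  rw [sum_eq_zero_iff_of_nonneg fun b _ => defect_nonneg (h1 b)]
  simp

theorem exists_glue_of_mem_planarPairs {V : ∀ b, Setoid (Z b)} {γ : Equiv.Perm Y}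
    {p : Setoid Y × Equiv.Perm Y} (h : p ∈ planarPairs (glueS e V) γ) : ∃ p', p = glue e p' := by
  obtain ⟨h1, h2, -⟩ := mem_planarPairs.1 h
  have hU : p.1 ≤ glueS e fun _ => ⊤ :=
    (le_sup_left.trans_eq h2).trans (glueS_le_glueS.2 fun _ => le_top)
  obtain ⟨π, hπ⟩ := exists_eq_glueP (h1.trans hU)
  exact ⟨fun b => (p.1.comap (piece e b), π b), Prod.ext (glueS_comap hU).symm hπ⟩

/-- Sums over partitioned permutations of a decomposed set factor. -/
theorem sum_planarPairs_glue {R : Type*} [CommSemiring R] (V : ∀ b, Setoid (Z b))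
    (γ : ∀ b, Equiv.Perm (Z b)) {Q : Setoid Y × Equiv.Perm Y → Prop}
    {Q' : ∀ b, Setoid (Z b) × Equiv.Perm (Z b) → Prop} (hQ : ∀ p, Q (glue e p) ↔ ∀ b, Q' b (p b))
    {w : Setoid Y × Equiv.Perm Y → R} {w' : ∀ b, Setoid (Z b) × Equiv.Perm (Z b) → R}
    (hw : ∀ p, w (glue e p) = ∏ b, w' b (p b)) :
    ∑ p ∈ (planarPairs (glueS e V) (glueP e γ)).filter Q, w p =
      ∏ b, ∑ p ∈ (planarPairs (V b) (γ b)).filter (Q' b), w' b p := by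
  rw [prod_univ_sum]
  symm
  refine sum_bij (fun p _ => glue e p) (fun p hp => ?_) (fun p _ p' _ h => glue_injective h)
    (fun p hp => ?_) (fun p _ => (hw p).symm)
  · rw [Fintype.mem_piFinset] at hp
    exact mem_filter.2 ⟨glue_mem_planarPairs.2 fun b => (mem_filter.1 (hp b)).1,
      (hQ p).2 fun b => (mem_filter.1 (hp b)).2⟩
  · obtain ⟨h1, h2⟩ := mem_filter.1 hp
    obtain ⟨p', rfl⟩ := exists_glue_of_mem_planarPairs h1
    refine ⟨p', Fintype.mem_piFinset.2 fun b => mem_filter.2 ⟨glue_mem_planarPairs.1 h1 b, ?_⟩, rfl⟩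
    exact (hQ p').1 h2 b

end Glue

/-! ### Doubling the ground set

In `X ⊕ X` the elements `inl k` and `inr k` stand for the numbers `2k - 1` and `2k`. -/

section Double

variable {X : Type*}

/-- The projection `2k - 1, 2k ↦ k`. -/
abbrev proj : X ⊕ X → X := Sum.elim id id

theorem proj_surjective : Function.Surjective (proj : X ⊕ X → X) := fun x => ⟨Sum.inr x, rfl⟩

/-- The permutation `σ` acting on the even numbers. -/
def onEven (σ : Equiv.Perm X) : Equiv.Perm (X ⊕ X) := Equiv.Perm.sumCongr 1 σ

/-- The doubled permutation `2k - 1 ↦ 2k ↦ 2σ(k) - 1`. -/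
def dbl (σ : Equiv.Perm X) : Equiv.Perm (X ⊕ X) := Equiv.sumComm X X * onEven σ

theorem dbl_inl (σ : Equiv.Perm X) (x : X) : dbl σ (Sum.inl x) = Sum.inr x := rfl

theorem dbl_inr (σ : Equiv.Perm X) (x : X) : dbl σ (Sum.inr x) = Sum.inl (σ x) := rfl

/-- Different even numbers lie in different cycles. -/
def Sep (f : Equiv.Perm (X ⊕ X)) : Prop := ∀ x y, cyc f (Sum.inr x) (Sum.inr y) → x = y

theorem onEven_mul (σ τ : Equiv.Perm X) : onEven (σ * τ) = onEven σ * onEven τ := by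
  simp [onEven, Equiv.Perm.sumCongr_mul]

theorem onEven_one : onEven (1 : Equiv.Perm X) = 1 := Equiv.Perm.sumCongr_one

theorem onEven_inv (σ : Equiv.Perm X) : onEven σ⁻¹ = (onEven σ)⁻¹ := by
  simp [onEven, Equiv.Perm.sumCongr_inv]

theorem onEven_swap (x y : X) :
    onEven (Equiv.swap x y) = Equiv.swap (Sum.inr x) (Sum.inr y) :=
  Equiv.Perm.sumCongr_one_swap x y

theorem Sep.inv {f : Equiv.Perm (X ⊕ X)} (h : Sep f) : Sep f⁻¹ := fun x y hxy =>
  h x y (by rwa [cyc_inv] at hxy)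

variable [Finite X]

/-- Build `τ` up by transpositions that each merge two cycles. Since `f` separates the even
elements, `onEven τ * f` relates them exactly as `τ` does, so each transposition merges two cycles
there too and both cycle counts drop together. -/
theorem Sep.onEven_mul {f : Equiv.Perm (X ⊕ X)} (hf : Sep f) (τ : Equiv.Perm X) :
    (∀ x y, cyc (onEven τ * f) (Sum.inr x) (Sum.inr y) ↔ cyc τ x y) ∧
      nc (onEven τ * f) + Nat.card X = nc f + nc τ := by
  induction τ using perm_merge_induction with
  | one =>
    rw [onEven_one, one_mul, nc, nc, cyc_one, nq_bot]
    exact ⟨fun x y => ⟨fun h => hf x y h, fun h => (h : x = y) ▸ Setoid.refl' _ _⟩, rfl⟩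
  | merge τ x y h ih =>
    obtain ⟨ih1, ih2⟩ := ih
    have h' : ¬ cyc (onEven τ * f) (Sum.inr x) (Sum.inr y) := fun h' => h ((ih1 x y).1 h')
    rw [Annular.onEven_mul, onEven_swap, mul_assoc]
    have e1 := nc_swap_mul_of_not h
    have e2 := nc_swap_mul_of_not h'
    refine ⟨fun a b => ?_, by omega⟩
    rw [cyc_swap_mul h, cyc_swap_mul h', joinPair_apply, joinPair_apply]
    simp only [ih1]

theorem Sep.mul_onEven {f : Equiv.Perm (X ⊕ X)} (hf : Sep f) (τ : Equiv.Perm X) :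
    (∀ x y, cyc (f * onEven τ) (Sum.inr x) (Sum.inr y) ↔ cyc τ x y) ∧
      nc (f * onEven τ) + Nat.card X = nc f + nc τ := by
  have h := hf.inv.onEven_mul τ⁻¹
  rw [onEven_inv, ← mul_inv_rev, nc_inv, nc_inv, nc_inv, cyc_inv, cyc_inv] at h
  exact h

/-- Take `τ` with the largest number of cycles of the product. If two even elements shared a cycle,
one more transposition of even elements would split it. -/
theorem exists_sep_mul_onEven (f : Equiv.Perm (X ⊕ X)) :
    ∃ τ : Equiv.Perm X, Sep (f * onEven τ) := by
  obtain ⟨τ, hτ⟩ := Finite.exists_max fun τ : Equiv.Perm X => nc (f * onEven τ)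
  refine ⟨τ, fun x y hxy => ?_⟩
  by_contra hne
  have h1 : cyc (f * onEven τ)⁻¹ (Sum.inr x) (Sum.inr y) := by rwa [cyc_inv]
  have h2 := nc_swap_mul_of_cyc (fun h => hne (Sum.inr_injective h)) h1
  have h3 := hτ (τ * Equiv.swap x y)
  rw [Annular.onEven_mul, onEven_swap, ← mul_assoc] at h3
  rw [← nc_inv, mul_inv_rev, inv_inv, Equiv.swap_inv, nc_inv] at h2
  omega

theorem cyc_sumComm : cyc (Equiv.sumComm X X : Equiv.Perm (X ⊕ X)) = (⊥ : Setoid X).comap proj := by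
  refine le_antisymm (cyc_le_iff.2 ?_) ?_
  · rintro (x | x) <;> exact rfl
  · have h : ∀ x, cyc (Equiv.sumComm X X : Equiv.Perm (X ⊕ X)) (Sum.inl x) (Sum.inr x) :=
      fun x => cyc_le_iff.1 le_rfl (Sum.inl x)
    rintro (x | x) (y | y) (hxy : x = y) <;> subst hxy
    · exact Setoid.refl' _ _
    · exact h x
    · exact Setoid.symm' _ (h x)
    · exact Setoid.refl' _ _

/-- The involution exchanging `2k - 1` and `2k` is the base point: `dbl σ` arises from it by
multiplication with `onEven σ`, so `Sep.mul_onEven` counts the cycles of `dbl σ`. -/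
theorem sep_sumComm : Sep (Equiv.sumComm X X : Equiv.Perm (X ⊕ X)) := fun x y h => by
  rw [cyc_sumComm] at h
  exact h

theorem nc_sumComm : nc (Equiv.sumComm X X : Equiv.Perm (X ⊕ X)) = Nat.card X := by
  rw [nc, cyc_sumComm, nq_comap_of_surjective proj_surjective, nq_bot]

theorem nc_dbl (σ : Equiv.Perm X) : nc (dbl σ) = nc σ := by
  have := (sep_sumComm.mul_onEven σ).2
  rw [nc_sumComm] at this
  unfold dbl
  omega

theorem cyc_dbl (σ : Equiv.Perm X) : cyc (dbl σ) = (cyc σ).comap proj := by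
  have h : ∀ a : X ⊕ X, cyc (dbl σ) a (Sum.inr (proj a)) := by
    rintro (x | x)
    · exact cyc_le_iff.1 le_rfl (Sum.inl x)
    · exact Setoid.refl' _ _
  ext a b
  rw [Setoid.comap_rel, ← (sep_sumComm.mul_onEven σ).1]
  change _ ↔ cyc (dbl σ) _ _
  exact ⟨fun hab => Setoid.trans' _ (Setoid.symm' _ (h a)) (Setoid.trans' _ hab (h b)),
    fun hab => Setoid.trans' _ (h a) (Setoid.trans' _ hab (Setoid.symm' _ (h b)))⟩

theorem exists_sep (π : Equiv.Perm (X ⊕ X)) : ∃ σ : Equiv.Perm X, Sep (π⁻¹ * dbl σ) := by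
  obtain ⟨σ, hσ⟩ := exists_sep_mul_onEven (π⁻¹ * Equiv.sumComm X X)
  exact ⟨σ, by rwa [mul_assoc] at hσ⟩

theorem dbl_mul (σ τ : Equiv.Perm X) : dbl (σ * τ) = dbl σ * onEven τ := by
  rw [dbl, onEven_mul, ← mul_assoc, dbl]

/-- The two products differ by `onEven (σ⁻¹ * τ)`. By `Sep.mul_onEven` the cycles of `σ⁻¹ * τ` are
visible on the even elements of the second product, which separates them, so `σ⁻¹ * τ` is the
identity. -/
theorem sep_unique {π : Equiv.Perm (X ⊕ X)} {σ τ : Equiv.Perm X} (hσ : Sep (π⁻¹ * dbl σ))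
    (hτ : Sep (π⁻¹ * dbl τ)) : σ = τ := by
  have h := (hσ.mul_onEven (σ⁻¹ * τ)).1
  rw [mul_assoc, ← dbl_mul, mul_inv_cancel_left] at h
  rw [← inv_mul_eq_one]
  refine eq_one_of_cyc_eq_bot (le_bot_iff.1 fun x y hxy => ?_)
  exact hτ x y ((h x y).2 hxy)

theorem Sep.nc_dbl {π : Equiv.Perm (X ⊕ X)} {σ : Equiv.Perm X} (hσ : Sep (π⁻¹ * dbl σ))
    (γ : Equiv.Perm X) : nc (π⁻¹ * dbl γ) + Nat.card X = nc (π⁻¹ * dbl σ) + nc (σ⁻¹ * γ) := by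
  have h := (hσ.mul_onEven (σ⁻¹ * γ)).2
  rwa [mul_assoc, ← dbl_mul, mul_inv_cancel_left] at h

/-- Let `K = π⁻¹ * dbl σ` and follow its cycle from an even element `x`. The first step lands next
to `dbl σ x` in its `π`-cycle. Until the return to `x` only odd elements are met, and from these `K`
passes to the partner in the pair and then along `π`. So the whole way stays in the class of `dbl σ
x`, and at its end this class contains `x`. -/
theorem Sep.cyc_dbl_le {π : Equiv.Perm (X ⊕ X)} {σ : Equiv.Perm X} (hσ : Sep (π⁻¹ * dbl σ)) :
    cyc (dbl σ) ≤ cyc π ⊔ (⊥ : Setoid X).comap proj := by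
  set W := cyc π ⊔ (⊥ : Setoid X).comap proj
  have hρ : ∀ a b : X ⊕ X, proj a = proj b → W a b := fun a b h =>
    (le_sup_right : (⊥ : Setoid X).comap proj ≤ W) h
  have hπ : ∀ a : X ⊕ X, W (π⁻¹ a) a := fun a =>
    (le_sup_left : cyc π ≤ W) ⟨1, by simp⟩
  refine cyc_le_iff.2 ?_
  rintro (x | x)
  · exact hρ _ _ rfl
  set K := π⁻¹ * dbl σ with hK
  have claim : ∀ j : ℕ, W ((K ^ (j + 1)) (Sum.inr x)) (dbl σ (Sum.inr x)) ∨
      W (Sum.inr x) (dbl σ (Sum.inr x)) := by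
    intro j
    induction j with
    | zero =>
      left
      rw [zero_add, pow_one]
      exact hπ _
    | succ j ih =>
      refine ih.elim (fun h => ?_) Or.inr
      rcases hy : (K ^ (j + 1)) (Sum.inr x) with y | y
      · left
        rw [pow_succ', Equiv.Perm.mul_apply, hy]
        rw [hy] at h
        exact Setoid.trans' _ (hπ _) (Setoid.trans' _ (hρ (Sum.inr y) (Sum.inl y) rfl) h)
      · have : x = y := hσ x y ⟨(j + 1 : ℕ), by rw [zpow_natCast]; exact hy⟩
        subst this
        right
        rwa [hy] at h
  obtain ⟨k, hk⟩ : ∃ k : ℕ, k + 1 = orderOf K :=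
    ⟨orderOf K - 1, Nat.sub_add_cancel (orderOf_pos K)⟩
  refine (claim k).elim (fun h => ?_) id
  rwa [hk, pow_orderOf_eq_one] at h

theorem comap_proj_le_comap {V V' : Setoid X} : V.comap proj ≤ V'.comap proj ↔ V ≤ V' :=
  ⟨fun h x y hxy => @h (Sum.inr x) (Sum.inr y) hxy, fun h _ _ hab => h hab⟩

theorem comap_proj_injective : Function.Injective fun V : Setoid X => V.comap proj :=
  fun _ _ h => le_antisymm (comap_proj_le_comap.1 (le_of_eq h)) (comap_proj_le_comap.1 (ge_of_eq h))

theorem eq_comap_proj {S : Setoid (X ⊕ X)} (h : (⊥ : Setoid X).comap proj ≤ S) :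
    S = (S.comap Sum.inr).comap proj := by
  have h' : ∀ a : X ⊕ X, S a (Sum.inr (proj a)) := fun a => h (show proj a = _ from rfl)
  ext a b
  change _ ↔ S (Sum.inr (proj a)) (Sum.inr (proj b))
  exact ⟨fun hab => Setoid.trans' _ (Setoid.symm' _ (h' a)) (Setoid.trans' _ hab (h' b)),
    fun hab => Setoid.trans' _ (h' a) (Setoid.trans' _ hab (Setoid.symm' _ (h' b)))⟩

theorem Sep.sup_eq_top_iff {U : Setoid (X ⊕ X)} {π : Equiv.Perm (X ⊕ X)} {V : Setoid X}
    {σ : Equiv.Perm X} (hσ : Sep (π⁻¹ * dbl σ)) (hU : cyc π ≤ U)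
    (hV : U ⊔ cyc (dbl σ) = V.comap proj) (γ : Equiv.Perm X) :
    U ⊔ cyc (dbl γ) = ⊤ ↔ V ⊔ cyc γ = ⊤ := by
  have hbot : (⊥ : Setoid X).comap proj ≤ cyc (dbl γ) := by
    rw [cyc_dbl]
    exact comap_proj_le_comap.2 bot_le
  constructor
  · intro h
    refine top_le_iff.1 (comap_proj_le_comap.1 ?_)
    have h1 : U ≤ (V ⊔ cyc γ).comap proj :=
      (le_sup_left.trans_eq hV).trans (comap_proj_le_comap.2 le_sup_left)
    have h2 : cyc (dbl γ) ≤ (V ⊔ cyc γ).comap proj := by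
      rw [cyc_dbl]
      exact comap_proj_le_comap.2 le_sup_right
    exact le_top.trans (h.symm.le.trans (sup_le h1 h2))
  · intro h
    have h1 : V.comap proj ≤ U ⊔ cyc (dbl γ) := by
      rw [← hV]
      exact sup_le le_sup_left (hσ.cyc_dbl_le.trans (sup_le_sup hU hbot))
    rw [eq_comap_proj (hbot.trans le_sup_right)] at h1 ⊢
    have h2 : cyc (dbl γ) ≤ U ⊔ cyc (dbl γ) := le_sup_right
    rw [eq_comap_proj (hbot.trans le_sup_right), cyc_dbl] at h2
    rw [comap_proj_le_comap] at h1 h2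
    rw [cyc_dbl] at h1 ⊢
    rw [top_le_iff.1 (h.symm.le.trans (sup_le h1 h2))]
    rfl

/-- Doubling preserves the numbers of cycles and of blocks, and `Sep.nc_dbl` splits the cycle count
of `π⁻¹ * dbl γ` into those of `π⁻¹ * dbl σ` and `σ⁻¹ * γ`. All terms in `V` and `σ` then cancel. -/
theorem Sep.defect_dbl {U : Setoid (X ⊕ X)} {π : Equiv.Perm (X ⊕ X)} {V : Setoid X}
    {σ : Equiv.Perm X} (hσ : Sep (π⁻¹ * dbl σ)) (hV : U ⊔ cyc (dbl σ) = V.comap proj)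
    {γ : Equiv.Perm X} (h1 : U ⊔ cyc (dbl γ) = ⊤) (h2 : V ⊔ cyc γ = ⊤) :
    defect U π (dbl γ) = defect U π (dbl σ) + defect V σ γ := by
  have e1 := hσ.nc_dbl γ
  have e2 : Nat.card (X ⊕ X) = Nat.card X + Nat.card X := Nat.card_sum
  have e3 : nq (⊤ : Setoid (X ⊕ X)) = nq (⊤ : Setoid X) :=
    nq_comap_of_surjective (s := ⊤) proj_surjective
  unfold defect
  rw [h1, h2, hV, nq_comap_of_surjective proj_surjective, Annular.nc_dbl, Annular.nc_dbl, e2, e3]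
  omega

/-- A sum of two nonnegative defects vanishes exactly when both do. This is the fibration of planar
pairs. -/
theorem mem_planarPairs_dbl_iff {X : Type*} [Fintype X] {U : Setoid (X ⊕ X)}
    {π : Equiv.Perm (X ⊕ X)} {V : Setoid X} {σ : Equiv.Perm X} (hσ : Sep (π⁻¹ * dbl σ))
    (hV : U ⊔ cyc (dbl σ) = V.comap proj) (γ : Equiv.Perm X) :
    (U, π) ∈ planarPairs ⊤ (dbl γ) ↔
      (V, σ) ∈ planarPairs ⊤ γ ∧ (U, π) ∈ planarPairs (V.comap proj) (dbl σ) := by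
  have hσV : cyc σ ≤ V := by
    rw [← comap_proj_le_comap, ← hV, ← cyc_dbl]
    exact le_sup_right
  simp only [mem_planarPairs]
  constructor
  · rintro ⟨h1, h2, h3⟩
    have h4 := (hσ.sup_eq_top_iff h1 hV γ).1 h2
    have h5 := hσ.defect_dbl hV h2 h4
    have h6 := defect_nonneg (γ := dbl σ) h1
    have h7 := defect_nonneg (γ := γ) hσV
    exact ⟨⟨hσV, h4, by omega⟩, h1, hV, by omega⟩
  · rintro ⟨⟨_, h2, h3⟩, h4, _, h6⟩
    have h5 := (hσ.sup_eq_top_iff h4 hV γ).2 h2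
    exact ⟨h4, h5, by rw [hσ.defect_dbl hV h5 h2, h3, h6]; rfl⟩

/-- Every partitioned permutation of the doubled set sits over one of the original set. -/
theorem sum_planarPairs_dbl {X : Type*} [Fintype X] {R : Type*} [AddCommMonoid R]
    (γ : Equiv.Perm X) (w : Setoid (X ⊕ X) × Equiv.Perm (X ⊕ X) → R) :
    ∑ p ∈ planarPairs ⊤ (dbl γ), w p = ∑ q ∈ planarPairs ⊤ γ,
      ∑ p ∈ (planarPairs (q.1.comap proj) (dbl q.2)).filter fun p => Sep (p.2⁻¹ * dbl q.2), w p := by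
  rw [sum_sigma']
  symm
  refine sum_bij (fun x _ => x.2) ?_ ?_ ?_ fun _ _ => rfl
  · rintro ⟨⟨V, σ⟩, ⟨U, π⟩⟩ h
    obtain ⟨h1, h2⟩ := mem_sigma.1 h
    obtain ⟨h3, h4⟩ := mem_filter.1 h2
    exact (mem_planarPairs_dbl_iff h4 (mem_planarPairs.1 h3).2.1 γ).2 ⟨h1, h3⟩
  · rintro ⟨⟨V, σ⟩, ⟨U, π⟩⟩ h ⟨⟨V', σ'⟩, ⟨U', π'⟩⟩ h' heq
    obtain ⟨h3, h4⟩ := mem_filter.1 (mem_sigma.1 h).2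
    obtain ⟨h3', h4'⟩ := mem_filter.1 (mem_sigma.1 h').2
    cases heq
    obtain rfl := sep_unique h4 h4'
    obtain rfl := comap_proj_injective
      ((mem_planarPairs.1 h3).2.1.symm.trans (mem_planarPairs.1 h3').2.1)
    rfl
  -- The base point is forced: `σ` by separation, and `V` as the partition whose doubling is `U ⊔
  -- cyc (dbl σ)`, which contains all pairs `2k - 1, 2k`.
  · rintro ⟨U, π⟩ h
    obtain ⟨σ, hσ⟩ := exists_sep π
    have hbot : (⊥ : Setoid X).comap proj ≤ U ⊔ cyc (dbl σ) := by
      rw [cyc_dbl]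
      exact (comap_proj_le_comap.2 bot_le).trans le_sup_right
    have hV := eq_comap_proj hbot
    obtain ⟨h1, h2⟩ := (mem_planarPairs_dbl_iff hσ hV γ).1 h
    exact ⟨⟨(_, σ), (U, π)⟩, mem_sigma.2 ⟨h1, mem_filter.2 ⟨h2, hσ⟩⟩, rfl⟩

end Double

/-! ### Weights of partitioned permutations -/

/-! ### Bijections as decompositions with one piece -/

section Unit

variable {Y Y' : Type*} (e : Y' ≃ Y)

/-- A bijection as a decomposition with one piece. -/
def unitEquiv : (Σ _ : Unit, Y') ≃ Y := (Equiv.uniqueSigma fun _ : Unit => Y').trans e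

/-- With a single piece, gluing is transport along the bijection, so the gluing lemmas also yield
invariance under relabelling. -/
theorem glueP_unitEquiv {γ : Equiv.Perm Y} {γ' : Equiv.Perm Y'} (h : ∀ y, e (γ' y) = γ (e y)) :
    (glueP (unitEquiv e) fun _ => γ') = γ := perm_ext_piece (e := unitEquiv e) fun b z => by
  rw [glueP_piece]
  exact h z

theorem glueS_unitEquiv_top : (glueS (unitEquiv e) fun _ => ⊤) = ⊤ := eq_top_iff.2 fun x y _ => by
  obtain ⟨b, z, rfl⟩ := exists_piece (unitEquiv e) x
  obtain ⟨b', z', rfl⟩ := exists_piece (unitEquiv e) y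
  exact glueS_piece.2 trivial

end Unit

section Weights

variable {L : Type*} [Fintype L] (k₁ : L → ℕ → ℂ) (k₂ : L → ℕ → ℕ → ℂ)

/-- The cumulant of one letter attached to a block: of first order if the block is a single cycle
of `π`, and otherwise of second order, with the left and right part of the block as sizes. -/
def letterVal {Y : Type*} (π : Equiv.Perm Y) (s : Y → Bool) (B : Finset Y) (c : L) : ℂ :=
  if ∀ y ∈ B, ∀ y' ∈ B, cyc π y y' then k₁ c B.card
  else k₂ c (B.filter fun y => s y).card (B.filter fun y => ¬ s y).card

/-- The cumulant attached to a block whose elements carry letters; it vanishes unless all the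
letters agree. -/
def blockVal {Y : Type*} (π : Equiv.Perm Y) (g : Y → L) (s : Y → Bool) (B : Finset Y) : ℂ :=
  -- For a nonempty block at most one letter satisfies the condition, so the sum has at most one
  -- term and is `0` for mixed letters.
  ∑ c, if ∀ y ∈ B, g y = c then letterVal k₁ k₂ π s B c else 0

/-- The product of the cumulants of all blocks. -/
def pairVal {Y : Type*} [Fintype Y] (g : Y → L) (s : Y → Bool) (p : Setoid Y × Equiv.Perm Y) : ℂ :=
  ∏ B ∈ blocks p.1, blockVal k₁ k₂ p.2 g s B

theorem blockVal_of_forall {Y : Type*} {π : Equiv.Perm Y} {g : Y → L} {s : Y → Bool}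
    {B : Finset Y} (hB : B.Nonempty) {c : L} (h : ∀ y ∈ B, g y = c) :
    blockVal k₁ k₂ π g s B = letterVal k₁ k₂ π s B c := by
  rw [blockVal, sum_eq_single c, if_pos h]
  · intro c' _ hc
    obtain ⟨y, hy⟩ := hB
    exact if_neg fun h' => hc ((h' y hy).symm.trans (h y hy))
  · exact fun h => absurd (mem_univ c) h

theorem blockVal_eq_zero {Y : Type*} {π : Equiv.Perm Y} {g : Y → L} {s : Y → Bool}
    {B : Finset Y} {y y' : Y} (hy : y ∈ B) (hy' : y' ∈ B) (h : g y ≠ g y') :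
    blockVal k₁ k₂ π g s B = 0 :=
  sum_eq_zero fun _ _ => if_neg fun h' => h ((h' y hy).trans (h' y' hy').symm)

theorem pairVal_eq_zero {Y : Type*} [Fintype Y] {g : Y → L} {s : Y → Bool}
    {p : Setoid Y × Equiv.Perm Y} {y y' : Y} (hy : p.1 y y') (h : g y ≠ g y') :
    pairVal k₁ k₂ g s p = 0 :=
  prod_eq_zero (mem_blocks.2 ⟨y, rfl⟩)
    (blockVal_eq_zero k₁ k₂ (mem_cls_mk.2 (Setoid.refl' _ y)) (mem_cls_mk.2 hy) h)

section Glue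

variable {ι : Type*} {Z : ι → Type*} {Y : Type*} (e : (Σ b, Z b) ≃ Y)

theorem blockVal_glue [Finite Y] (π : ∀ b, Equiv.Perm (Z b)) (g : Y → L) (s : Y → Bool) (b : ι)
    (B : Finset (Z b)) : blockVal k₁ k₂ (glueP e π) g s (B.map (piece e b)) =
      blockVal k₁ k₂ (π b) (g ∘ piece e b) (s ∘ piece e b) B := by
  have h : ∀ z z', cyc (glueP e π) (piece e b z) (piece e b z') ↔ cyc (π b) z z' := fun z z' => by
    rw [cyc_glueP]
    exact glueS_piece
  unfold blockVal letterVal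
  simp only [h, forall_mem_map, card_map, filter_map, Function.comp_def]

theorem pairVal_glue [Fintype ι] [∀ b, Fintype (Z b)] [Fintype Y] (g : Y → L) (s : Y → Bool)
    (p : ∀ b, Setoid (Z b) × Equiv.Perm (Z b)) : pairVal k₁ k₂ g s (glue e p) =
      ∏ b, pairVal k₁ k₂ (g ∘ piece e b) (s ∘ piece e b) (p b) := by
  simp only [pairVal, glue, prod_blocks_glueS, blockVal_glue]

end Glue

end Weights

/-! ### Opposite colourings and the combined cumulant -/

section Double

/-- The word in which each letter `k` is replaced by two opposite letters. -/
abbrev colour {X : Type*} (f : X → Bool) : X ⊕ X → Bool := Sum.elim f fun x => !f x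

/-- The two copies of an element lie on the same side. -/
abbrev side {X : Type*} (s : X → Bool) : X ⊕ X → Bool := Sum.elim s s

variable (k₁ : Bool → ℕ → ℂ) (k₂ : Bool → ℕ → ℕ → ℂ)

/-- The sum of the weights of a partitioned permutation over all opposite colourings of pairs. -/
def colourSum {X : Type*} [Fintype X] (s : X → Bool)
    (p : Setoid (X ⊕ X) × Equiv.Perm (X ⊕ X)) : ℂ :=
  ∑ f : X → Bool, pairVal k₁ k₂ (colour f) (side s) p

/-- The sum over all `f : X → Bool` involves a decidability instance for `X`; this passes from the
classical one to the one at hand. -/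
theorem colourSum_eq {X : Type*} [Fintype X] [DecidableEq X] (s : X → Bool)
    (p : Setoid (X ⊕ X) × Equiv.Perm (X ⊕ X)) :
    colourSum k₁ k₂ s p = ∑ f : X → Bool, pairVal k₁ k₂ (colour f) (side s) p := by
  unfold colourSum
  congr
  exact Subsingleton.elim _ _

/-- The combined cumulant of `ab + ba` along a permutation. -/
def anticommCumulant {X : Type*} [Fintype X] (γ : Equiv.Perm X) (s : X → Bool) : ℂ :=
  ∑ p ∈ (planarPairs ⊤ (dbl γ)).filter fun p => Sep (p.2⁻¹ * dbl γ), colourSum k₁ k₂ s p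

section Glue

variable {ι : Type*} {Z : ι → Type*} {X : Type*} (e : (Σ b, Z b) ≃ X)

/-- The decomposition of the doubled set. -/
def doubleEquiv : (Σ b, Z b ⊕ Z b) ≃ X ⊕ X := (Equiv.sigmaSumDistrib Z Z).trans (e.sumCongr e)

theorem piece_doubleEquiv_inl (b : ι) (z : Z b) :
    piece (doubleEquiv e) b (Sum.inl z) = Sum.inl (piece e b z) := rfl

theorem piece_doubleEquiv_inr (b : ι) (z : Z b) :
    piece (doubleEquiv e) b (Sum.inr z) = Sum.inr (piece e b z) := rfl

theorem proj_piece (b : ι) (a : Z b ⊕ Z b) :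
    proj (piece (doubleEquiv e) b a) = piece e b (proj a) := by
  rcases a with z | z <;> rfl

theorem dbl_glueP (σ : ∀ b, Equiv.Perm (Z b)) :
    dbl (glueP e σ) = glueP (doubleEquiv e) fun b => dbl (σ b) := by
  refine perm_ext_piece (e := doubleEquiv e) fun b a => ?_
  rw [glueP_piece]
  rcases a with z | z
  · rfl
  · rw [piece_doubleEquiv_inr, dbl_inr, glueP_piece, dbl_inr, piece_doubleEquiv_inl]

theorem comap_proj_glueS (V : ∀ b, Setoid (Z b)) :
    (glueS e V).comap proj = glueS (doubleEquiv e) fun b => (V b).comap proj := by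
  ext a a'
  obtain ⟨b, a, rfl⟩ := exists_piece (doubleEquiv e) a
  obtain ⟨b', a', rfl⟩ := exists_piece (doubleEquiv e) a'
  rw [Setoid.comap_rel, proj_piece, proj_piece]
  constructor
  · intro h
    obtain rfl := eq_of_glueS h
    exact glueS_piece.2 (glueS_piece.1 h)
  · intro h
    obtain rfl := eq_of_glueS h
    exact glueS_piece.2 (glueS_piece.1 h :)

theorem sep_glueP [Finite X] (f : ∀ b, Equiv.Perm (Z b ⊕ Z b)) :
    Sep (glueP (doubleEquiv e) f) ↔ ∀ b, Sep (f b) := by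
  constructor
  · intro h b z z' hz
    refine (piece e b).injective (h _ _ ?_)
    rw [← piece_doubleEquiv_inr, ← piece_doubleEquiv_inr, cyc_glueP]
    exact glueS_piece.2 hz
  · intro h x x' hx
    obtain ⟨b, z, rfl⟩ := exists_piece e x
    obtain ⟨b', z', rfl⟩ := exists_piece e x'
    rw [← piece_doubleEquiv_inr, ← piece_doubleEquiv_inr, cyc_glueP] at hx
    obtain rfl := eq_of_glueS hx
    rw [h b z z' (glueS_piece.1 hx)]

variable [Fintype ι] [∀ b, Fintype (Z b)] [Fintype X]

/-- A colouring of the whole set is a family of colourings of the pieces, and weights are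
multiplicative, so the sum of products is a product of sums. -/
theorem colourSum_glue (s : X → Bool)
    (p : ∀ b, Setoid (Z b ⊕ Z b) × Equiv.Perm (Z b ⊕ Z b)) :
    colourSum k₁ k₂ s (glue (doubleEquiv e) p) =
      ∏ b, colourSum k₁ k₂ (s ∘ piece e b) (p b) := by
  simp only [colourSum, pairVal_glue, prod_univ_sum, Fintype.piFinset_univ]
  refine Fintype.sum_equiv ((e.arrowCongr (Equiv.refl Bool)).symm.trans
    (Equiv.piCurry fun _ _ => Bool)) _ _ fun f => prod_congr rfl fun b _ => ?_
  congr 1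
  · funext a
    rcases a with z | z <;> rfl
  · funext a
    rcases a with z | z <;> rfl

theorem sum_colourSum_glue (s : X → Bool) (σ : ∀ b, Equiv.Perm (Z b)) :
    ∑ p ∈ (planarPairs ((glueS e fun _ => ⊤).comap proj) (dbl (glueP e σ))).filter
      fun p => Sep (p.2⁻¹ * dbl (glueP e σ)), colourSum k₁ k₂ s p =
      ∏ b, anticommCumulant k₁ k₂ (σ b) (s ∘ piece e b) := by
  rw [dbl_glueP, comap_proj_glueS]
  refine sum_planarPairs_glue _ _ (fun p => ?_) fun p => colourSum_glue k₁ k₂ e s p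
  rw [glue, glueP_inv, glueP_mul, sep_glueP]

end Glue

theorem anticommCumulant_congr {X X' : Type*} [Fintype X] [Fintype X'] (e : X' ≃ X)
    {γ : Equiv.Perm X} {γ' : Equiv.Perm X'} (h : ∀ x, e (γ' x) = γ (e x)) (s : X → Bool) :
    anticommCumulant k₁ k₂ γ' (s ∘ e) = anticommCumulant k₁ k₂ γ s := by
  have h3 := sum_colourSum_glue k₁ k₂ (unitEquiv e) s fun _ => γ'
  rw [glueP_unitEquiv e h, glueS_unitEquiv_top, Fintype.prod_unique] at h3
  exact h3.symm

/-- The sum over a fibre of the map to partitioned permutations of the original set is a product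
over blocks. -/
theorem exists_sum_colourSum_eq_prod {X : Type*} [Fintype X] {V : Setoid X} {σ : Equiv.Perm X}
    (h : cyc σ ≤ V) (s : X → Bool) :
    ∃ σ' : ∀ b : Quotient V, Equiv.Perm {x // Quotient.mk V x = b},
      (∀ b x, (σ' b x : X) = σ x) ∧ (∀ b x y, cyc (σ' b) x y ↔ cyc σ x y) ∧
      ∑ p ∈ (planarPairs (V.comap proj) (dbl σ)).filter fun p => Sep (p.2⁻¹ * dbl σ),
        colourSum k₁ k₂ s p = ∏ b, anticommCumulant k₁ k₂ (σ' b) (s ∘ Subtype.val) := by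
  let e : (Σ b : Quotient V, {x // Quotient.mk V x = b}) ≃ X := Equiv.sigmaFiberEquiv (Quotient.mk V)
  have hV : V = glueS e fun _ => ⊤ := by
    ext x y
    constructor
    · intro hxy
      exact ⟨Quotient.mk V y, ⟨x, Quotient.sound hxy⟩, ⟨y, rfl⟩, rfl, rfl, trivial⟩
    · rintro ⟨b, z, z', rfl, rfl, -⟩
      exact Quotient.exact (z.2.trans z'.2.symm)
  obtain ⟨σ', hσ'⟩ := exists_eq_glueP (h.trans hV.le)
  refine ⟨σ', fun b x => ?_, fun b x y => ?_, ?_⟩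
  · rw [hσ']
    exact (glueP_piece (e := e) σ' b x).symm
  · rw [hσ', cyc_glueP]
    exact (glueS_piece (e := e) (U := fun b => cyc (σ' b)) (z := x) (z' := y)).symm
  · have h3 := sum_colourSum_glue k₁ k₂ e s σ'
    rw [← hσ', ← hV] at h3
    exact h3

end Double

/-! ### Planar permutations of a cycle are the non-crossing ones -/

section Planar

variable {N : ℕ}

/-- The elements at which a permutation does not increase. -/
def weakDescents (f : Equiv.Perm (Fin N)) : Finset (Fin N) := univ.filter fun i => f i ≤ i

theorem exists_max_cyc (f : Equiv.Perm (Fin N)) (i : Fin N) :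
    ∃ j, cyc f i j ∧ ∀ k, cyc f i k → k ≤ j := by
  obtain ⟨j, hj, hmax⟩ := (univ.filter fun j => cyc f i j).exists_max_image id
    ⟨i, mem_filter.2 ⟨mem_univ _, Setoid.refl' _ i⟩⟩
  exact ⟨j, (mem_filter.1 hj).2, fun k hk => hmax k (mem_filter.2 ⟨mem_univ _, hk⟩)⟩

theorem cyc_apply_right (f : Equiv.Perm (Fin N)) (i : Fin N) : cyc f i (f i) :=
  cyc_le_iff.1 le_rfl i

theorem surjective_weakDescents (f : Equiv.Perm (Fin N)) :
    Function.Surjective fun i : weakDescents f => (Quotient.mk (cyc f) i.1) := by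
  intro q
  induction q using Quotient.inductionOn with | _ i =>
  obtain ⟨j, hj, hmax⟩ := exists_max_cyc f i
  exact ⟨⟨j, mem_filter.2 ⟨mem_univ _, hmax _ (Setoid.trans' _ hj (cyc_apply_right f j))⟩⟩,
    Quotient.sound (Setoid.symm' _ hj)⟩

/-- The largest element of each cycle is a weak descent. -/
theorem nc_le_weakDescents (f : Equiv.Perm (Fin N)) : nc f ≤ (weakDescents f).card := by
  have h := Nat.card_le_card_of_surjective _ (surjective_weakDescents f)
  rwa [Nat.card_eq_fintype_card (α := weakDescents f), Fintype.card_coe] at h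

/-- All cycles of the permutation are increasing up to a cyclic rotation. -/
def Ascending (f : Equiv.Perm (Fin N)) : Prop := ∀ i j, f i ≤ i → cyc f i j → j ≤ i

/-- Equality means that each cycle has only one weak descent, which must be its maximum. -/
theorem nc_eq_weakDescents_iff (f : Equiv.Perm (Fin N)) :
    nc f = (weakDescents f).card ↔ Ascending f := by
  have hcard : nc f = (weakDescents f).card ↔
      Function.Injective fun i : weakDescents f => (Quotient.mk (cyc f) i.1) := by
    rw [← Fintype.card_coe (weakDescents f), ← Nat.card_eq_fintype_card]
    constructor
    · exact fun h => ((Nat.bijective_iff_surjective_and_card _).2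
        ⟨surjective_weakDescents f, h.symm⟩).1
    · exact fun h => (Nat.card_congr (Equiv.ofBijective _ ⟨h, surjective_weakDescents f⟩)).symm
  rw [hcard]
  constructor
  · intro hinj i j hi hij
    obtain ⟨k, hk, hmax⟩ := exists_max_cyc f i
    have hk' : f k ≤ k := hmax _ (Setoid.trans' _ hk (cyc_apply_right f k))
    have := @hinj ⟨i, mem_filter.2 ⟨mem_univ _, hi⟩⟩ ⟨k, mem_filter.2 ⟨mem_univ _, hk'⟩⟩
      (Quotient.sound hk)
    have hik : i = k := congrArg Subtype.val this
    exact hik ▸ hmax j hij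
  · rintro h ⟨i, hi⟩ ⟨j, hj⟩ hij
    have hij' : cyc f i j := Quotient.exact hij
    exact Subtype.ext (le_antisymm (h j i (mem_filter.1 hj).2 (Setoid.symm' _ hij'))
      (h i j (mem_filter.1 hi).2 hij'))

theorem perm_apply_inv_apply {Y : Type*} (f : Equiv.Perm Y) (y : Y) : f (f⁻¹ y) = y := by simp

/-- For `i = K j` the value `π i` is the cyclic successor of `j`. Hence `K j ≤ j` says that `i < π
i` or that `π i` is the first element. The weak descents of `K` thus match the strict ascents of `π`
and one further element. -/
theorem weakDescents_add_weakDescents (hN : 1 ≤ N) (π : Equiv.Perm (Fin N)) :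
    (weakDescents π).card + (weakDescents (π⁻¹ * finRotate N)).card = N + 1 := by
  set K := π⁻¹ * finRotate N with hK
  have h1 : (weakDescents K).card = (univ.filter fun i => (π i).val = 0 ∨ i < π i).card := by
    refine card_bij (fun j _ => K j) (fun j hj => ?_) (fun j _ j' _ h => K.injective h)
      fun i hi => ⟨K⁻¹ i, ?_, by simp⟩
    · have hj' := (mem_filter.1 hj).2
      refine mem_filter.2 ⟨mem_univ _, ?_⟩
      have e : π (K j) = finRotate N j := by simp [hK]
      have hv := val_finRotate j
      rw [← e] at hv
      rw [Fin.lt_def]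
      rw [Fin.le_def] at hj'
      split_ifs at hv <;> omega
    · have hi' := (mem_filter.1 hi).2
      refine mem_filter.2 ⟨mem_univ _, ?_⟩
      have e : finRotate N (K⁻¹ i) = π i := by
        rw [hK, mul_inv_rev, inv_inv, ← Equiv.Perm.mul_apply, mul_inv_cancel_left]
      have hv := val_finRotate (K⁻¹ i)
      rw [e] at hv
      rw [perm_apply_inv_apply, Fin.le_def]
      rw [Fin.lt_def] at hi'
      have := i.isLt
      split_ifs at hv <;> omega
  have h2 : (univ.filter fun i => (π i).val = 0 ∨ i < π i) =
      insert (π⁻¹ ⟨0, hN⟩) (univ.filter fun i => i < π i) := by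
    ext i
    simp only [mem_filter, mem_univ, true_and, mem_insert, Equiv.Perm.eq_inv_iff_eq, Fin.ext_iff]
  have h3 : (univ.filter fun i => i < π i).card + (weakDescents π).card = N := by
    have := card_filter_add_card_filter_not (s := univ) fun i => i < π i
    rw [card_univ, Fintype.card_fin] at this
    simpa only [not_lt, weakDescents] using this
  rw [h1, h2, card_insert_of_notMem]
  · omega
  · simp [-Fin.val_fin_lt, -Fin.not_lt, Fin.lt_def]

theorem nc_add_nc_eq_iff_ascending (hN : 1 ≤ N) (π : Equiv.Perm (Fin N)) :
    nc π + nc (π⁻¹ * finRotate N) = N + 1 ↔ Ascending π ∧ Ascending (π⁻¹ * finRotate N) := by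
  have h1 := weakDescents_add_weakDescents hN π
  have h2 := nc_le_weakDescents π
  have h3 := nc_le_weakDescents (π⁻¹ * finRotate N)
  rw [← nc_eq_weakDescents_iff, ← nc_eq_weakDescents_iff]
  omega

theorem Ascending.le_of_cyc {f : Equiv.Perm (Fin N)} (h : Ascending f) {i j : Fin N}
    (hi : f i ≤ i) (hij : cyc f i j) : f i ≤ j := by
  obtain ⟨m, hm, hmin⟩ := (univ.filter fun j => cyc f i j).exists_min_image id
    ⟨i, mem_filter.2 ⟨mem_univ _, Setoid.refl' _ i⟩⟩
  have hm' : cyc f i m := (mem_filter.1 hm).2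
  have hp : cyc f (f⁻¹ m) m := ⟨1, by simp⟩
  have hp' : cyc f i (f⁻¹ m) := Setoid.trans' _ hm' (Setoid.symm' _ hp)
  have hle : m ≤ f⁻¹ m := hmin _ (mem_filter.2 ⟨mem_univ _, hp'⟩)
  have e : f⁻¹ m = i := le_antisymm (h i _ hi hp')
    (h _ i (by rwa [perm_apply_inv_apply]) (Setoid.symm' _ hp'))
  rw [← e, perm_apply_inv_apply]
  exact hmin j (mem_filter.2 ⟨mem_univ _, hij⟩)

/-- Descent on `j` through its predecessor `p` in the cycle. If `j ≤ p`, then `j` is the minimum of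
the cycle, contrary to `i < j`. If `p = i`, then `f i = j`. Otherwise `p` and `i`, in increasing
order, form the same configuration with a smaller second element. -/
theorem Ascending.not_between {f : Equiv.Perm (Fin N)} (h : Ascending f) (i j : Fin N)
    (hij : cyc f i j) (h1 : i < j) (h2 : j < f i) : False := by
  induction hn : j.val using Nat.strong_induction_on generalizing i j with
  | _ n ih =>
    have hp : cyc f (f⁻¹ j) j := ⟨1, by simp⟩
    have hp' : cyc f i (f⁻¹ j) := Setoid.trans' _ hij (Setoid.symm' _ hp)
    have e : f (f⁻¹ j) = j := by simp
    rcases le_or_gt j (f⁻¹ j) with hle | hlt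
    · have := h.le_of_cyc (e.trans_le hle) (Setoid.symm' _ hp')
      rw [e] at this
      exact absurd h1 (not_lt.2 this)
    · rcases lt_trichotomy (f⁻¹ j) i with hc | hc | hc
      · exact ih i.val (hn ▸ h1) (f⁻¹ j) i (Setoid.symm' _ hp') hc (by rwa [e]) rfl
      · rw [← hc, e] at h2
        exact lt_irrefl _ h2
      · exact ih (f⁻¹ j).val (hn ▸ hlt) i (f⁻¹ j) hp' hc (hlt.trans h2) rfl

/-- Take the largest element of the cycle below `t`. If its image were below `t` too, it would be a
weak descent, hence the maximum of the cycle, although `v` is larger. -/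
theorem Ascending.exists_crossing {f : Equiv.Perm (Fin N)} (h : Ascending f) {u v t : Fin N}
    (huv : cyc f u v) (hu : u < t) (hv : t ≤ v) :
    ∃ a, cyc f u a ∧ u ≤ a ∧ a < t ∧ t ≤ f a := by
  obtain ⟨a, ha, hmax⟩ := (univ.filter fun j => cyc f u j ∧ j < t).exists_max_image id
    ⟨u, mem_filter.2 ⟨mem_univ _, Setoid.refl' _ u, hu⟩⟩
  obtain ⟨-, ha1, ha2⟩ := mem_filter.1 ha
  refine ⟨a, ha1, hmax u (mem_filter.2 ⟨mem_univ _, Setoid.refl' _ u, hu⟩), ha2, ?_⟩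
  by_contra hcon
  have hle : f a ≤ a := hmax (f a) (mem_filter.2 ⟨mem_univ _,
    Setoid.trans' _ ha1 (cyc_apply_right f a), not_le.1 hcon⟩)
  exact absurd (hv.trans (h a v hle (Setoid.trans' _ (Setoid.symm' _ ha1) huv))) (not_le.2 ha2)

/-- From arcs `a → π a` and `x → π x` that cross, another crossing with a larger `x` is produced.
The cycle of `K` through `x` contains `π x - 1`, so some step `z → K z` of it passes `π a`. As `π (K
z) = z + 1`, the cycle of `π` through `K z` has elements on both sides of `π a`, and its arc `x' → π
x'` over `π a` starts at `x' ≥ z + 1 > x`. -/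
theorem Ascending.not_crossing {π : Equiv.Perm (Fin N)} (h : Ascending π)
    (hK : Ascending (π⁻¹ * finRotate N)) (a x : Fin N) (h1 : a < x) (h2 : x < π a)
    (h3 : π a < π x) : False := by
  induction hn : N - x.val using Nat.strong_induction_on generalizing x with
  | _ n ih =>
    set K := π⁻¹ * finRotate N with hKdef
    have hKval : ∀ (i : Fin N) (hi : i.val + 1 < N), π (K i) = ⟨i.val + 1, hi⟩ := by
      intro i hi
      have e : π (K i) = finRotate N i := by simp [hKdef]
      rw [e]
      refine Fin.ext ?_
      rw [val_finRotate, if_neg (by omega)]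
    have hb := (π a).isLt
    have hy := (π x).isLt
    rw [Fin.lt_def] at h1 h2 h3
    have ey : K ⟨(π x).val - 1, by omega⟩ = x := π.injective (by
      rw [hKval _ (by simp only; omega)]
      exact Fin.ext (by simp only; omega))
    have eb : K ⟨(π a).val - 1, by omega⟩ = a := π.injective (by
      rw [hKval _ (by simp only; omega)]
      exact Fin.ext (by simp only; omega))
    have hxy : cyc K x ⟨(π x).val - 1, by omega⟩ := by
      have := cyc_apply_right K ⟨(π x).val - 1, by omega⟩
      rw [ey] at this
      exact Setoid.symm' _ this
    obtain ⟨z, -, hz1, hz2, hz3⟩ := hK.exists_crossing (t := π a) hxy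
      (Fin.lt_def.2 h2) (Fin.le_def.2 (by simp only; omega))
    rw [Fin.le_def] at hz1 hz3
    rw [Fin.lt_def] at hz2
    have hzne : z.val + 1 ≠ (π a).val := by
      intro hz
      -- This `z` is sent by `K` to `a`, which is too small to lie beyond `π a`.
      have : z = ⟨(π a).val - 1, by omega⟩ := Fin.ext (by simp only; omega)
      rw [this, eb] at hz3
      omega
    have ew : π (K z) = ⟨z.val + 1, by omega⟩ := hKval z (by omega)
    have hwd : π (K z) ≤ K z := by
      rw [ew, Fin.le_def]
      simp only
      omega
    have hw := cyc_apply_right π (K z)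
    have hwb : K z ≠ π a := by
      intro hwb
      have := h.le_of_cyc hwd (j := a) (by rw [hwb]; exact Setoid.symm' _ (cyc_apply_right π a))
      rw [ew, Fin.le_def] at this
      simp only at this
      omega
    obtain ⟨x', -, hx1, hx2, hx3⟩ := h.exists_crossing (t := π a) (Setoid.symm' _ hw)
      (by rw [ew, Fin.lt_def]; simp only; omega) (Fin.le_def.2 hz3)
    rw [ew, Fin.le_def] at hx1
    simp only at hx1
    have hne : π a ≠ π x' := fun he => by
      have := π.injective he
      subst this
      omega
    exact ih (N - x'.val) (by omega) x' (Fin.lt_def.2 (by omega)) hx2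
      (lt_of_le_of_ne hx3 hne) rfl

theorem mem_parts_cyclePartition {π : Equiv.Perm (Fin N)} {V : Finset (Fin N)} {i j : Fin N}
    (hV : V ∈ (cyclePartition π).parts) (hi : i ∈ V) : j ∈ V ↔ cyc π i j := by
  rw [← Finpartition.part_eq_of_mem _ hV hi]
  exact mem_part_cyclePartition π i j

/-- The cycle count is maximal exactly when `π` and its complement `K = π⁻¹ * finRotate N` are both
ascending. What remains is that, for ascending `π`, being non-crossing amounts to `K` being
ascending. -/
theorem isNoncrossingPerm_iff (hN : 1 ≤ N) (π : Equiv.Perm (Fin N)) :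
    IsNoncrossingPerm π ↔ nc π + nc (π⁻¹ * finRotate N) = N + 1 := by
  rw [nc_add_nc_eq_iff_ascending hN]
  constructor
  · rintro ⟨h1, h2⟩
    have hasc : Ascending π := fun i j hi hij => ((h2 i j hij).2 hi).2
    refine ⟨hasc, fun j x hj hjx => ?_⟩
    set K := π⁻¹ * finRotate N with hKdef
    by_cases hjN : j.val + 1 = N
    · rw [Fin.le_def]
      omega
    have hKval : ∀ (i : Fin N) (hi : i.val + 1 < N), π (K i) = ⟨i.val + 1, hi⟩ := by
      intro i hi
      have e : π (K i) = finRotate N i := by simp [hKdef]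
      rw [e]
      refine Fin.ext ?_
      rw [val_finRotate, if_neg (by omega)]
    have ej := hKval j (by omega)
    -- The interval from `K j` to `j` is invariant under `K`: leaving it on either side would give a
    -- crossing of the arcs `K j → j + 1` and `K x → x + 1`, or, within one cycle, an element
    -- strictly between `K j` and its successor. So `j` is the largest element of its `K`-cycle.
    have inv : ∀ x, K j ≤ x → x ≤ j → K j ≤ K x ∧ K x ≤ j := by
      intro x hx1 hx2
      rcases hx2.eq_or_lt with rfl | hlt
      · exact ⟨le_rfl, hj⟩
      have ex := hKval x (by omega)
      rw [Fin.lt_def] at hlt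
      rw [Fin.le_def] at hx1 hx2
      have hcx := cyc_apply_right π (K x)
      have hcj := cyc_apply_right π (K j)
      by_cases hs : cyc π (K j) (K x)
      · exfalso
        refine (h2 (K j) (π (K x)) (Setoid.trans' _ hs hcx)).1 ⟨?_, ?_⟩
        · rw [ex, Fin.lt_def]
          simp only
          omega
        · rw [ex, ej, Fin.lt_def]
          simp only
          omega
      · have hP : ∀ i, i ∈ (cyclePartition π).part i := fun i =>
          (cyclePartition π).mem_part (mem_univ i)
        have hm : ∀ i, (cyclePartition π).part i ∈ (cyclePartition π).parts := fun i =>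
          (cyclePartition π).part_mem.2 (mem_univ i)
        have hne : (cyclePartition π).part (K j) ≠ (cyclePartition π).part (K x) := by
          intro he
          exact hs ((mem_part_cyclePartition π _ _).1 (he ▸ hP (K x)))
        have m1 := (mem_part_cyclePartition π _ _).2 hcj
        have m2 := (mem_part_cyclePartition π _ _).2 hcx
        have n1 : K x ≠ K j := fun he => hs (he ▸ Setoid.refl' _ _)
        have n2 : K x ≠ π (K j) := fun he => hs (he ▸ hcj)
        by_contra hcon
        rcases lt_or_ge (K x) (K j) with hc | hc
        · refine hne (h1 (K x) (K j) (π (K x)) (π (K j)) hc ?_ ?_ _ (hm (K x)) _ (hm (K j))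
            (hP _) m2 (hP _) m1).symm
          · rw [ex, Fin.lt_def]
            simp only
            omega
          · rw [ex, ej, Fin.lt_def]
            simp only
            omega
        · have hgt : j < K x := not_le.1 fun hle => hcon ⟨hc, hle⟩
          have n2' : (K x).val ≠ j.val + 1 := fun he => n2 (by rw [ej]; exact Fin.ext he)
          rw [Fin.lt_def] at hgt
          refine hne (h1 (K j) (π (K x)) (π (K j)) (K x) ?_ ?_ ?_ _ (hm (K j)) _ (hm (K x))
            (hP _) m1 m2 (hP _))
          · rw [ex, Fin.lt_def]
            simp only
            omega
          · rw [ex, ej, Fin.lt_def]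
            simp only
            omega
          · rw [ej, Fin.lt_def]
            simp only
            omega
    obtain ⟨k, rfl⟩ := Equiv.Perm.SameCycle.exists_nat_pow_eq hjx
    have : K j ≤ (K ^ k) j ∧ (K ^ k) j ≤ j := by
      clear hjx
      induction k with
      | zero => exact ⟨hj, le_rfl⟩
      | succ k ih =>
        rw [pow_succ', Equiv.Perm.mul_apply]
        exact inv _ ih.1 ih.2
    exact this.2
  · rintro ⟨h, hK⟩
    refine ⟨fun i j k l hij hjk hkl V hV W hW hi hk hj hl => ?_, fun i j hij =>
      ⟨fun h1 => h.not_between i j hij h1.1 h1.2, fun h1 => ⟨h.le_of_cyc h1 hij, h i j h1 hij⟩⟩⟩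
    by_contra hne
    have hik : cyc π i k := (mem_parts_cyclePartition hV hi).1 hk
    have hjl : cyc π j l := (mem_parts_cyclePartition hW hj).1 hl
    have hdis : ¬ cyc π i j := fun hc => hne (by
      rw [← Finpartition.part_eq_of_mem _ hW hj]
      refine (Finpartition.part_eq_of_mem _ hV ?_).symm
      exact (mem_parts_cyclePartition hV hi).2 hc)
    -- A crossing of two blocks is sharpened to one of two arcs: an arc of the first cycle over `j`,
    -- ending at `π a ≤ k`, and then an arc of the second cycle over `π a`.
    obtain ⟨a, ha, -, ha1, ha2⟩ := h.exists_crossing hik hij hjk.le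
    have hab : cyc π i (π a) := Setoid.trans' _ ha (cyc_apply_right π a)
    have hak : π a ≤ k := not_lt.1 fun hlt =>
      h.not_between a k (Setoid.trans' _ (Setoid.symm' _ ha) hik) (ha1.trans hjk) hlt
    have ha3 : j < π a := lt_of_le_of_ne ha2 fun he => hdis (he ▸ hab)
    obtain ⟨x, hx, hx1, hx2, hx3⟩ := h.exists_crossing hjl ha3 (hak.trans hkl.le)
    have hx4 : π a < π x := lt_of_le_of_ne hx3 fun he => hdis (by
      have := Setoid.trans' _ hx (cyc_apply_right π x)
      rw [← he] at this
      exact Setoid.trans' _ hab (Setoid.symm' _ this))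
    exact h.not_crossing hK a x (ha1.trans_le hx1) hx2 hx4

end Planar

/-! ### Planar partitioned permutations of one or two cycles -/

section Finpartition

variable {N : ℕ}

/-- The equivalence relation of a partition. -/
def toSetoid (P : Finpartition (univ : Finset (Fin N))) : Setoid (Fin N) := Setoid.ker P.part

theorem cls_toSetoid (P : Finpartition (univ : Finset (Fin N))) (i : Fin N) :
    cls (toSetoid P) (Quotient.mk _ i) = P.part i := by
  ext j
  rw [mem_cls_mk, P.mem_part_iff_part_eq_part (mem_univ _) (mem_univ _)]
  exact eq_comm

theorem blocks_toSetoid (P : Finpartition (univ : Finset (Fin N))) :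
    blocks (toSetoid P) = P.parts := by
  ext V
  rw [mem_blocks]
  constructor
  · rintro ⟨i, rfl⟩
    rw [cls_toSetoid]
    exact P.part_mem.2 (mem_univ i)
  · intro hV
    obtain ⟨i, hi⟩ := P.nonempty_of_mem_parts hV
    exact ⟨i, by rw [cls_toSetoid, P.part_eq_of_mem hV hi]⟩

/-- The partition of an equivalence relation. -/
def ofSetoid (U : Setoid (Fin N)) : Finpartition (univ : Finset (Fin N)) := Finpartition.ofSetoid U

theorem part_ofSetoid (U : Setoid (Fin N)) (i : Fin N) :
    (ofSetoid U).part i = cls U (Quotient.mk U i) := by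
  ext j
  rw [mem_cls_mk]
  exact Finpartition.mem_part_ofSetoid_iff_rel

theorem toSetoid_ofSetoid (U : Setoid (Fin N)) : toSetoid (ofSetoid U) = U := by
  ext i j
  change (ofSetoid U).part i = (ofSetoid U).part j ↔ _
  rw [part_ofSetoid, part_ofSetoid, (cls_injective U).eq_iff]
  exact Quotient.eq

theorem ofSetoid_toSetoid (P : Finpartition (univ : Finset (Fin N))) :
    ofSetoid (toSetoid P) = P := by
  refine Finpartition.ext ?_
  rw [← blocks_toSetoid, toSetoid_ofSetoid, blocks_toSetoid]

theorem parts_ofSetoid (U : Setoid (Fin N)) : (ofSetoid U).parts = blocks U := by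
  rw [← blocks_toSetoid, toSetoid_ofSetoid]

theorem cyclePartition_eq (π : Equiv.Perm (Fin N)) : cyclePartition π = ofSetoid (cyc π) := rfl

theorem numCycles_eq (π : Equiv.Perm (Fin N)) : numCycles π = nc π := by
  rw [numCycles, cyclePartition_eq, parts_ofSetoid, card_blocks]

end Finpartition

/-! ### Blocks of a partition after merging two of them -/

section JoinPair

variable {Y : Type*} [Fintype Y] [DecidableEq Y] {s : Setoid Y} {x y : Y}

theorem eq_of_blocks_eq {t : Setoid Y} (h : blocks s = blocks t) : s = t := by
  have key : ∀ {s t : Setoid Y}, blocks s = blocks t → s ≤ t := fun {s t} h a b hab => by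
    have h1 : cls s (Quotient.mk s a) ∈ blocks t := h ▸ mem_blocks.2 ⟨a, rfl⟩
    obtain ⟨c, hc⟩ := mem_blocks.1 h1
    have ha : a ∈ cls t (Quotient.mk t c) := hc ▸ mem_cls_mk.2 (Setoid.refl' s a)
    have hb : b ∈ cls t (Quotient.mk t c) := hc ▸ mem_cls_mk.2 hab
    exact Setoid.trans' _ (Setoid.symm' _ (mem_cls_mk.1 ha)) (mem_cls_mk.1 hb)
  exact le_antisymm (key h) (key h.symm)

theorem cls_eq_cls_iff {a b : Y} : cls s (Quotient.mk s a) = cls s (Quotient.mk s b) ↔ s a b := by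
  rw [(cls_injective s).eq_iff]
  exact Quotient.eq

theorem cls_joinPair_self : cls (joinPair s x y) (Quotient.mk _ x) =
    cls s (Quotient.mk s x) ∪ cls s (Quotient.mk s y) := by
  ext a
  rw [mem_union, mem_cls_mk, mem_cls_mk, mem_cls_mk, joinPair_apply]
  constructor
  · rintro (h | ⟨-, h⟩ | ⟨-, h⟩)
    · exact Or.inl h
    · exact Or.inr h
    · exact Or.inl h
  · rintro (h | h)
    · exact Or.inl h
    · exact Or.inr (Or.inl ⟨Setoid.refl' _ x, h⟩)

theorem cls_joinPair_of_not {a : Y} (hx : ¬ s a x) (hy : ¬ s a y) :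
    cls (joinPair s x y) (Quotient.mk _ a) = cls s (Quotient.mk s a) := by
  ext b
  rw [mem_cls_mk, mem_cls_mk, joinPair_apply]
  tauto

theorem blocks_joinPair : blocks (joinPair s x y) =
    insert (cls s (Quotient.mk s x) ∪ cls s (Quotient.mk s y))
      (((blocks s).erase (cls s (Quotient.mk s x))).erase (cls s (Quotient.mk s y))) := by
  ext B
  rw [mem_insert, mem_erase, mem_erase, mem_blocks, mem_blocks]
  constructor
  · rintro ⟨a, rfl⟩
    by_cases h : joinPair s x y x a
    · left
      rw [← cls_joinPair_self]
      exact (cls_eq_cls_iff.2 h).symm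
    · right
      have hx : ¬ s a x := fun h' => h (Or.inl (Setoid.symm' _ h'))
      have hy : ¬ s a y := fun h' => h (Or.inr (Or.inl ⟨Setoid.refl' _ x, Setoid.symm' _ h'⟩))
      rw [cls_joinPair_of_not hx hy]
      exact ⟨fun h' => hy (cls_eq_cls_iff.1 h'), fun h' => hx (cls_eq_cls_iff.1 h'), a, rfl⟩
  · rintro (rfl | ⟨h1, h2, a, rfl⟩)
    · exact ⟨x, cls_joinPair_self.symm⟩
    · refine ⟨a, (cls_joinPair_of_not (fun h => h2 ?_) fun h => h1 ?_).symm⟩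
      · exact cls_eq_cls_iff.2 h
      · exact cls_eq_cls_iff.2 h

end JoinPair

/-! ### One cycle -/

/-- All joins with a single cycle are `⊤`, so there is nothing to merge across and defect `0` leaves
only `U = cyc π` and the genus condition. -/
theorem mem_planarPairs_of_transitive {Y : Type*} [Fintype Y] [Nonempty Y] {γ : Equiv.Perm Y}
    (hγ : cyc γ = ⊤) {p : Setoid Y × Equiv.Perm Y} : p ∈ planarPairs ⊤ γ ↔
      p.1 = cyc p.2 ∧ nc p.2 + nc (p.2⁻¹ * γ) = Nat.card Y + 1 := by
  have h1 : nc γ = 1 := by rw [nc, hγ, nq_top]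
  rw [mem_planarPairs, hγ, sup_top_eq]
  constructor
  · rintro ⟨h2, -, h3⟩
    rw [defect_eq_zero_iff h2, hγ, sup_top_eq, sup_top_eq, nq_top] at h3
    refine ⟨(eq_of_le_of_nq_le h2 ?_).symm, by omega⟩
    have := h3.2
    unfold nc at this
    omega
  · rintro ⟨h2, h3⟩
    refine ⟨h2.ge, rfl, ?_⟩
    rw [defect_eq_zero_iff h2.ge, h2, hγ, sup_top_eq, nq_top]
    exact ⟨by omega, rfl⟩

theorem cyc_finRotate (n : ℕ) : cyc (finRotate n) = ⊤ :=
  eq_top_iff.2 fun i j _ => sameCycle_finRotate i j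

theorem mem_planarPairs_finRotate {n : ℕ} (hn : 1 ≤ n) {p : Setoid (Fin n) × Equiv.Perm (Fin n)} :
    p ∈ planarPairs ⊤ (finRotate n) ↔ p.1 = cyc p.2 ∧ IsNoncrossingPerm p.2 := by
  have : Nonempty (Fin n) := ⟨⟨0, hn⟩⟩
  rw [mem_planarPairs_of_transitive (cyc_finRotate n), isNoncrossingPerm_iff hn, Nat.card_eq_fintype_card,
    Fintype.card_fin]

theorem eq_of_isNoncrossingPerm {N : ℕ} {π σ : Equiv.Perm (Fin N)} (hπ : IsNoncrossingPerm π)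
    (hσ : IsNoncrossingPerm σ) (h : cyc π = cyc σ) : π = σ := by
  have key : ∀ {π σ : Equiv.Perm (Fin N)}, IsNoncrossingPerm π → IsNoncrossingPerm σ →
      cyc π = cyc σ → ∀ i, π i ≤ σ i := by
    intro π σ hπ hσ h i
    have h1 : cyc π i (σ i) := h ▸ cyc_apply_right σ i
    have h2 : cyc σ i (π i) := h ▸ cyc_apply_right π i
    by_contra hcon
    rw [not_le] at hcon
    by_cases hi : i < σ i
    · exact (hπ.2 i (σ i) h1).1 ⟨hi, hcon⟩
    · have h3 := (hσ.2 i (π i) h2).2 (not_lt.1 hi)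
      have h4 := (hπ.2 i (σ i) h1).2 h3.2
      exact absurd h4.1 (not_le.2 hcon)
  exact Equiv.ext fun i => le_antisymm (key hπ hσ h i) (key hσ hπ h.symm i)

/-- The permutation whose cycles are the blocks of a given partition, in increasing order. -/
theorem exists_isNoncrossingPerm {N : ℕ} {P : Finpartition (univ : Finset (Fin N))}
    (hP : IsNoncrossing P) : ∃ π, IsNoncrossingPerm π ∧ cyclePartition π = P := by
  set U := toSetoid P with hU
  let Z : Quotient U → Type := fun b => {x // Quotient.mk U x = b}
  let e : (Σ b, Z b) ≃ Fin N := Equiv.sigmaFiberEquiv (Quotient.mk U)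
  -- Each block is listed in increasing order and rotated; the order conditions are then those
  -- already known for `finRotate`.
  let o : ∀ b, Fin (Fintype.card (Z b)) ≃o Z b := fun b => Fintype.orderIsoFinOfCardEq (Z b) rfl
  let σ : ∀ b, Equiv.Perm (Z b) := fun b => (o b).toEquiv.permCongr (finRotate _)
  have hσo : ∀ b u, σ b (o b u) = o b (finRotate _ u) := fun b u => by simp [σ, Equiv.permCongr_apply]
  have hσ : ∀ b, cyc (σ b) = ⊤ := fun b => by
    have h1 : cyc (finRotate (Fintype.card (Z b))) ≤ (cyc (σ b)).comap (o b) :=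
      cyc_le_iff.2 fun u => by
        rw [Setoid.comap_rel, ← hσo]
        exact cyc_le_iff.1 le_rfl _
    refine eq_top_iff.2 fun z z' _ => ?_
    have := h1 (sameCycle_finRotate ((o b).symm z) ((o b).symm z'))
    rwa [Setoid.comap_rel, OrderIso.apply_symm_apply, OrderIso.apply_symm_apply] at this
  have hUe : U = glueS e fun _ => ⊤ := by
    ext x y
    constructor
    · intro hxy
      exact ⟨Quotient.mk U y, ⟨x, Quotient.sound hxy⟩, ⟨y, rfl⟩, rfl, rfl, trivial⟩
    · rintro ⟨b, z, z', rfl, rfl, -⟩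
      exact Quotient.exact (z.2.trans z'.2.symm)
  have hcyc : cyc (glueP e σ) = U := by
    rw [cyc_glueP]
    exact (congrArg (glueS e) (funext hσ)).trans hUe.symm
  have hpart : cyclePartition (glueP e σ) = P := by
    rw [cyclePartition_eq, hcyc, hU, ofSetoid_toSetoid]
  refine ⟨glueP e σ, ⟨by rwa [hpart], fun i j hij => ?_⟩, hpart⟩
  obtain ⟨b, z, z', rfl, rfl, -⟩ := (hUe ▸ (hcyc ▸ hij : U i j) : (glueS e fun _ => ⊤) i j)
  obtain ⟨u, rfl⟩ := (o b).surjective z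
  obtain ⟨v, rfl⟩ := (o b).surjective z'
  rw [glueP_piece, hσo]
  have hlt : ∀ u v, piece e b (o b u) < piece e b (o b v) ↔ u < v := fun u v =>
    (o b).lt_iff_lt
  have hle : ∀ u v, piece e b (o b u) ≤ piece e b (o b v) ↔ u ≤ v := fun u v =>
    (o b).le_iff_le
  rw [hlt, hlt, hle, hle, hle]
  exact (isNoncrossingPerm_finRotate _).2 u v (sameCycle_finRotate u v)

/-! ### Two cycles -/

section Gamma

variable {n m : ℕ}

theorem cyc_prodPerm_castAdd {π₁ : Equiv.Perm (Fin n)} {π₂ : Equiv.Perm (Fin m)} {i j : Fin n} :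
    cyc (prodPerm π₁ π₂) (Fin.castAdd m i) (Fin.castAdd m j) ↔ cyc π₁ i j := by
  rw [cyc_apply, sameCycle_castAdd]
  constructor
  · rintro ⟨l, h, hl⟩
    rwa [Fin.castAdd_injective n m hl]
  · exact fun h => ⟨j, h, rfl⟩

theorem cyc_prodPerm_natAdd {π₁ : Equiv.Perm (Fin n)} {π₂ : Equiv.Perm (Fin m)} {i j : Fin m} :
    cyc (prodPerm π₁ π₂) (Fin.natAdd n i) (Fin.natAdd n j) ↔ cyc π₂ i j := by
  rw [cyc_apply, sameCycle_natAdd]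
  constructor
  · rintro ⟨l, h, hl⟩
    rwa [Fin.natAdd_injective m n hl]
  · exact fun h => ⟨j, h, rfl⟩

theorem not_cyc_prodPerm {π₁ : Equiv.Perm (Fin n)} {π₂ : Equiv.Perm (Fin m)} {i : Fin n}
    {j : Fin m} : ¬ cyc (prodPerm π₁ π₂) (Fin.castAdd m i) (Fin.natAdd n j) := by
  rw [cyc_apply, sameCycle_castAdd]
  rintro ⟨l, -, h⟩
  have := congrArg Fin.val h
  simp only [Fin.val_natAdd, Fin.val_castAdd] at this
  omega

theorem nc_prodPerm (π₁ : Equiv.Perm (Fin n)) (π₂ : Equiv.Perm (Fin m)) :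
    nc (prodPerm π₁ π₂) = nc π₁ + nc π₂ := by
  let F : Quotient (cyc π₁) ⊕ Quotient (cyc π₂) → Quotient (cyc (prodPerm π₁ π₂)) := Sum.elim
    (Quotient.map (Fin.castAdd m) fun _ _ h => cyc_prodPerm_castAdd.2 h)
    (Quotient.map (Fin.natAdd n) fun _ _ h => cyc_prodPerm_natAdd.2 h)
  have hF : Function.Bijective F := by
    constructor
    · rintro (q | q) (q' | q') h
      all_goals
        induction q using Quotient.inductionOn
        induction q' using Quotient.inductionOn
        have h' := Quotient.exact h
      · exact congrArg Sum.inl (Quotient.sound (cyc_prodPerm_castAdd.1 h'))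
      · exact absurd h' not_cyc_prodPerm
      · exact absurd (Setoid.symm' _ h') not_cyc_prodPerm
      · exact congrArg Sum.inr (Quotient.sound (cyc_prodPerm_natAdd.1 h'))
    · intro q
      induction q using Quotient.inductionOn with | _ i =>
      refine Fin.addCases (fun j => ?_) (fun j => ?_) i
      · exact ⟨Sum.inl (Quotient.mk _ j), rfl⟩
      · exact ⟨Sum.inr (Quotient.mk _ j), rfl⟩
  rw [nc, nq, ← Nat.card_congr (Equiv.ofBijective F hF), Nat.card_sum]
  rfl

theorem prodPerm_inv_mul (π₁ σ₁ : Equiv.Perm (Fin n)) (π₂ σ₂ : Equiv.Perm (Fin m)) :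
    (prodPerm π₁ π₂)⁻¹ * prodPerm σ₁ σ₂ = prodPerm (π₁⁻¹ * σ₁) (π₂⁻¹ * σ₂) := by
  rw [inv_mul_eq_iff_eq_mul]
  ext i
  refine Fin.addCases (fun j => ?_) (fun j => ?_) i
  · simp [prodPerm_castAdd]
  · simp [prodPerm_natAdd]

theorem cyc_gamma (i j : Fin (n + m)) : cyc (gamma n m) i j ↔ (i.val < n ↔ j.val < n) := by
  refine Fin.addCases (fun i => ?_) (fun i => ?_) i <;>
  refine Fin.addCases (fun j => ?_) (fun j => ?_) j <;> unfold gamma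
  · rw [cyc_prodPerm_castAdd]
    simp [cyc_apply, sameCycle_finRotate]
  · simp [not_cyc_prodPerm]
  · rw [Setoid.comm']
    simp [not_cyc_prodPerm]
  · rw [cyc_prodPerm_natAdd]
    simp [cyc_apply, sameCycle_finRotate]

theorem nc_gamma (hn : 1 ≤ n) (hm : 1 ≤ m) : nc (gamma n m) = 2 := by
  have : Nonempty (Fin n) := ⟨⟨0, hn⟩⟩
  have : Nonempty (Fin m) := ⟨⟨0, hm⟩⟩
  rw [gamma, nc_prodPerm, nc, nc, cyc_finRotate, cyc_finRotate, nq_top, nq_top]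

theorem exists_eq_prodPerm {π : Equiv.Perm (Fin (n + m))} (h : cyc π ≤ cyc (gamma n m)) :
    ∃ π₁ π₂, π = prodPerm π₁ π₂ := by
  set τ : Equiv.Perm (Fin n ⊕ Fin m) := finSumFinEquiv.symm.permCongr π with hτ
  have hmaps : Set.MapsTo τ (Set.range Sum.inl) (Set.range Sum.inl) := by
    rintro _ ⟨i, rfl⟩
    have h1 := (cyc_gamma _ _).1 (cyc_le_iff.1 h (Fin.castAdd m i))
    have h2 : (π (Fin.castAdd m i)).val < n := h1.1 i.isLt
    refine ⟨⟨_, h2⟩, ?_⟩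
    rw [hτ, Equiv.permCongr_apply, Equiv.symm_symm, finSumFinEquiv_apply_left,
      Equiv.eq_symm_apply, finSumFinEquiv_apply_left]
    rfl
  obtain ⟨⟨π₁, π₂⟩, h3⟩ := Equiv.Perm.mem_sumCongrHom_range_of_perm_mapsTo_inl hmaps
  refine ⟨π₁, π₂, ?_⟩
  have h4 : Equiv.sumCongr π₁ π₂ = τ := h3
  rw [prodPerm, h4, hτ]
  ext i
  simp [Equiv.permCongr_apply]

theorem cyc_prodPerm_le_gamma (π₁ : Equiv.Perm (Fin n)) (π₂ : Equiv.Perm (Fin m)) :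
    cyc (prodPerm π₁ π₂) ≤ cyc (gamma n m) := cyc_le_iff.2 fun i => by
  rw [cyc_gamma]
  refine Fin.addCases (fun j => ?_) (fun j => ?_) i
  · simp [prodPerm_castAdd]
  · simp [prodPerm_natAdd]

/-- By the genus inequality the two factors contribute at most `n + 1` and `m + 1`, so the total is
attained only if both bounds are. -/
theorem noncrossing_prodPerm_iff (hn : 1 ≤ n) (hm : 1 ≤ m) (π₁ : Equiv.Perm (Fin n))
    (π₂ : Equiv.Perm (Fin m)) : (IsNoncrossingPerm π₁ ∧ IsNoncrossingPerm π₂) ↔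
      nc (prodPerm π₁ π₂) + nc ((prodPerm π₁ π₂)⁻¹ * gamma n m) = n + m + 2 := by
  have : Nonempty (Fin n) := ⟨⟨0, hn⟩⟩
  have : Nonempty (Fin m) := ⟨⟨0, hm⟩⟩
  rw [gamma, prodPerm_inv_mul, nc_prodPerm, nc_prodPerm, isNoncrossingPerm_iff hn,
    isNoncrossingPerm_iff hm]
  have h1 := nc_add_nc_add_nc_le π₁ (finRotate n)
  have h2 := nc_add_nc_add_nc_le π₂ (finRotate m)
  have h3 : nc (finRotate n) = 1 := by rw [nc, cyc_finRotate, nq_top]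
  have h4 : nc (finRotate m) = 1 := by rw [nc, cyc_finRotate, nq_top]
  rw [cyc_finRotate, sup_top_eq, nq_top, Nat.card_eq_fintype_card, Fintype.card_fin] at h1 h2
  omega

theorem mem_annularNC {π : Equiv.Perm (Fin (n + m))} : π ∈ annularNC n m ↔
    cyc π ⊔ cyc (gamma n m) = ⊤ ∧ nc π + nc (π⁻¹ * gamma n m) = n + m := by
  simp [annularNC, numCycles_eq]

theorem mem_typeTwo_iff {U : Setoid (Fin (n + m))} {π : Equiv.Perm (Fin (n + m))} :
    (ofSetoid U, π) ∈ typeTwo n m ↔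
      (∃ π₁ π₂, IsNoncrossingPerm π₁ ∧ IsNoncrossingPerm π₂ ∧ π = prodPerm π₁ π₂) ∧
      ∃ (i : Fin n) (j : Fin m), U = joinPair (cyc π) (Fin.castAdd m i) (Fin.natAdd n j) := by
  simp only [typeTwo, mem_filter, mem_univ, true_and, IsTypeTwo, cyclePartition_eq, parts_ofSetoid]
  refine and_congr_right fun hπ => ?_
  have hle : cyc π ≤ cyc (gamma n m) := by
    obtain ⟨π₁, π₂, -, -, rfl⟩ := hπ
    exact cyc_prodPerm_le_gamma π₁ π₂
  constructor
  · rintro ⟨A, hA, B, hB, hAl, hBr, hU⟩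
    obtain ⟨x, rfl⟩ := mem_blocks.1 hA
    obtain ⟨y, rfl⟩ := mem_blocks.1 hB
    have hx := hAl x (mem_cls_mk.2 (Setoid.refl' _ x))
    have hy := hBr y (mem_cls_mk.2 (Setoid.refl' _ y))
    refine ⟨⟨x.val, hx⟩, ⟨y.val - n, by omega⟩, eq_of_blocks_eq ?_⟩
    have ex : Fin.castAdd m ⟨x.val, hx⟩ = x := rfl
    have ey : Fin.natAdd n ⟨y.val - n, by omega⟩ = y := Fin.ext (by simp; omega)
    rw [hU, ex, ey, blocks_joinPair]
  · rintro ⟨i, j, rfl⟩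
    refine ⟨_, mem_blocks.2 ⟨Fin.castAdd m i, rfl⟩, _, mem_blocks.2 ⟨Fin.natAdd n j, rfl⟩, ?_, ?_,
      blocks_joinPair⟩
    · intro k hk
      have := (cyc_gamma _ _).1 (hle (mem_cls_mk.1 hk))
      simpa using this
    · intro k hk
      have := (cyc_gamma _ _).1 (hle (mem_cls_mk.1 hk))
      simpa using this

/-- The planar partitioned permutations of two cycles are the annular non-crossing permutations and
the pairs of type 2. -/
theorem mem_planarPairs_gamma (hn : 1 ≤ n) (hm : 1 ≤ m)
    {U : Setoid (Fin (n + m))} {π : Equiv.Perm (Fin (n + m))} :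
    (U, π) ∈ planarPairs ⊤ (gamma n m) ↔
      (π ∈ annularNC n m ∧ U = cyc π) ∨ (ofSetoid U, π) ∈ typeTwo n m := by
  have hne : Nonempty (Fin (n + m)) := ⟨⟨0, by omega⟩⟩
  have hγ := nc_gamma hn hm
  have hcard : Nat.card (Fin (n + m)) = n + m := by rw [Nat.card_eq_fintype_card, Fintype.card_fin]
  rw [mem_planarPairs, mem_typeTwo_iff, mem_annularNC]
  constructor
  · rintro ⟨h1, h2, h3⟩
    simp only at h1 h2 h3
    rw [defect_eq_zero_iff h1, h2, hγ, hcard, nq_top] at h3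
    obtain ⟨h3, h4⟩ := h3
    have h5 : nq (cyc π ⊔ cyc (gamma n m)) ≤ nc (gamma n m) := nq_le_of_le le_sup_right
    have h6 : 1 ≤ nq (cyc π ⊔ cyc (gamma n m)) := one_le_nq
    -- One block: `π` already joins the two circles, and defect `0` forbids any merging. Two blocks:
    -- `π` is a product, and defect `0` forces exactly one merging of two cycles.
    rcases (by omega : nq (cyc π ⊔ cyc (gamma n m)) = 1 ∨ nq (cyc π ⊔ cyc (gamma n m)) = 2)
      with h7 | h7
    · left
      refine ⟨⟨eq_top_of_nq_le_one h7.le, by omega⟩, (eq_of_le_of_nq_le h1 ?_).symm⟩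
      change nc π ≤ _
      omega
    · right
      have h8 : cyc (gamma n m) = cyc π ⊔ cyc (gamma n m) :=
        eq_of_le_of_nq_le le_sup_right (by change nc _ ≤ _; omega)
      have h9 : cyc π ≤ cyc (gamma n m) := h8 ▸ le_sup_left
      obtain ⟨π₁, π₂, rfl⟩ := exists_eq_prodPerm h9
      obtain ⟨hπ₁, hπ₂⟩ := (noncrossing_prodPerm_iff hn hm π₁ π₂).2 (by omega)
      refine ⟨⟨π₁, π₂, hπ₁, hπ₂, rfl⟩, ?_⟩
      -- If `U` related no elements of different circles, then `U ⊔ cyc (gamma n m)` would have two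
      -- blocks instead of one.
      have h10 : ∃ (i : Fin n) (j : Fin m), U (Fin.castAdd m i) (Fin.natAdd n j) := by
        by_contra hcon
        push Not at hcon
        have h11 : U ≤ cyc (gamma n m) := by
          intro x y
          refine Fin.addCases (fun i => ?_) (fun i => ?_) x <;>
          refine Fin.addCases (fun j => ?_) (fun j => ?_) y <;> rw [cyc_gamma]
          · simp
          · exact fun h => absurd h (hcon i j)
          · exact fun h => absurd (Setoid.symm' _ h) (hcon j i)
          · simp
        rw [sup_eq_right.2 h11] at h2
        rw [nc, h2, nq_top] at hγ
        omega
      obtain ⟨i, j, hij⟩ := h10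
      exact ⟨i, j, eq_joinPair h1 (by change nc _ = _; omega) not_cyc_prodPerm hij⟩
  · rintro (⟨⟨h1, h2⟩, rfl⟩ | ⟨⟨π₁, π₂, hπ₁, hπ₂, rfl⟩, i, j, rfl⟩)
    · refine ⟨le_rfl, h1, ?_⟩
      simp only
      rw [defect_eq_zero_iff le_rfl, h1, nq_top, hγ, hcard]
      exact ⟨by omega, rfl⟩
    · have h1 := (noncrossing_prodPerm_iff hn hm π₁ π₂).1 ⟨hπ₁, hπ₂⟩
      have h2 := cyc_prodPerm_le_gamma π₁ π₂
      have h3 := nq_joinPair (s := cyc (prodPerm π₁ π₂)) (x := Fin.castAdd m i)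
        (y := Fin.natAdd n j) not_cyc_prodPerm
      have h4 := nq_joinPair (s := cyc (gamma n m)) (x := Fin.castAdd m i)
        (y := Fin.natAdd n j) not_cyc_prodPerm
      have h5 : joinPair (cyc (gamma n m)) (Fin.castAdd m i) (Fin.natAdd n j) = ⊤ :=
        eq_top_of_nq_le_one (by unfold nc at hγ; omega)
      have h6 : joinPair (cyc (prodPerm π₁ π₂)) (Fin.castAdd m i) (Fin.natAdd n j) ⊔
          cyc (gamma n m) = ⊤ := by
        rw [joinPair_sup, sup_eq_right.2 h2, h5]
      refine ⟨le_joinPair, h6, ?_⟩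
      simp only
      rw [defect_eq_zero_iff le_joinPair, h6, nq_top, sup_eq_right.2 h2, hcard]
      unfold nc at *
      omega

theorem not_annularNC_of_typeTwo (hn : 1 ≤ n) (hm : 1 ≤ m)
    {p : Finpartition (univ : Finset (Fin (n + m))) × Equiv.Perm (Fin (n + m))}
    (h : p ∈ typeTwo n m) : p.2 ∉ annularNC n m := by
  have hne : Nonempty (Fin (n + m)) := ⟨⟨0, by omega⟩⟩
  obtain ⟨U, π⟩ := p
  rw [← ofSetoid_toSetoid U, mem_typeTwo_iff] at h
  obtain ⟨⟨π₁, π₂, -, -, rfl⟩, -⟩ := h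
  rw [mem_annularNC]
  rintro ⟨h1, -⟩
  have h2 := nc_gamma hn hm
  rw [sup_eq_right.2 (cyc_prodPerm_le_gamma π₁ π₂)] at h1
  rw [nc, h1, nq_top] at h2
  omega

/-- Sums over planar partitioned permutations of two cycles. -/
theorem sum_planarPairs_gamma (hn : 1 ≤ n) (hm : 1 ≤ m) {R : Type*} [AddCommMonoid R]
    (w : Setoid (Fin (n + m)) × Equiv.Perm (Fin (n + m)) → R) :
    ∑ p ∈ planarPairs ⊤ (gamma n m), w p =
      ∑ π ∈ annularNC n m, w (cyc π, π) + ∑ p ∈ typeTwo n m, w (toSetoid p.1, p.2) := by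
  have h : planarPairs ⊤ (gamma n m) = (annularNC n m).image (fun π => (cyc π, π)) ∪
      (typeTwo n m).image fun p => (toSetoid p.1, p.2) := by
    ext ⟨U, π⟩
    rw [mem_planarPairs_gamma hn hm, mem_union, mem_image, mem_image]
    refine or_congr ?_ ?_
    · constructor
      · rintro ⟨h, rfl⟩
        exact ⟨π, h, rfl⟩
      · rintro ⟨π', h, h'⟩
        cases h'
        exact ⟨h, rfl⟩
    · constructor
      · exact fun h => ⟨_, h, by rw [toSetoid_ofSetoid]⟩
      · rintro ⟨p, h, h'⟩
        cases h'
        rwa [ofSetoid_toSetoid]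
  rw [h, sum_union, sum_image, sum_image]
  · rintro ⟨U, π⟩ _ ⟨U', π'⟩ _ heq
    obtain ⟨h1, rfl⟩ := Prod.mk.inj heq
    simp only at h1
    rw [← ofSetoid_toSetoid U, h1, ofSetoid_toSetoid]
  · exact fun π _ π' _ h => (Prod.mk.inj h).2
  · rw [disjoint_left]
    intro x h1 h2
    obtain ⟨π, hπ, rfl⟩ := mem_image.1 h1
    obtain ⟨p, hp, hpx⟩ := mem_image.1 h2
    have := not_annularNC_of_typeTwo hn hm hp
    rw [(Prod.mk.inj hpx).2] at this
    exact this hπ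

end Gamma

/-! ### Moments of words -/

section Words

variable {A : Type*} [Ring A] [Algebra ℂ A] (S : SecondOrderSpace A) {L : Type*} [Fintype L]
  (l : L → A)

/-- All mixed cumulants of the letters vanish. -/
def LettersFree : Prop :=
  (∀ (n : ℕ) (w : Fin n → L), (∃ i j, w i ≠ w j) → S.cumulant n (fun i => l (w i)) = 0) ∧
  ∀ (n m : ℕ) (w : Fin (n + m) → L), 1 ≤ n → 1 ≤ m → (∃ i j, w i ≠ w j) →
    S.cumulant₂ n m (fun i => l (w (Fin.castAdd m i))) (fun j => l (w (Fin.natAdd n j))) = 0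

/-- The first order cumulants of the letters. -/
abbrev letterCumulant (c : L) (n : ℕ) : ℂ := S.cumulantOf (l c) n

/-- The second order cumulants of the letters. -/
abbrev letterCumulant₂ (c : L) (n m : ℕ) : ℂ := S.cumulantOf₂ (l c) n m

variable {S l} {Y : Type*} {w : Y → L}

theorem cumulant_word (h : LettersFree S l) {B : Finset Y} (hB : B.Nonempty) {u : Fin B.card → Y}
    (hu : ∀ k, u k ∈ B) (hsurj : ∀ y ∈ B, ∃ k, u k = y) :
    S.cumulant B.card (fun k => l (w (u k))) =
      ∑ c, if ∀ y ∈ B, w y = c then letterCumulant S l c B.card else 0 := by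
  obtain ⟨y₀, hy₀⟩ := hB
  by_cases hc : ∀ y ∈ B, w y = w y₀
  · rw [sum_eq_single (w y₀), if_pos hc]
    · unfold letterCumulant SecondOrderSpace.cumulantOf
      congr 1
      funext k
      rw [hc _ (hu k)]
    · exact fun c _ hne => if_neg fun h' => hne (h' y₀ hy₀).symm
    · exact fun h => absurd (mem_univ _) h
  · push Not at hc
    obtain ⟨y, hy, hne⟩ := hc
    obtain ⟨k, rfl⟩ := hsurj y hy
    obtain ⟨k₀, rfl⟩ := hsurj y₀ hy₀
    rw [h.1 _ (fun k => w (u k)) ⟨k, k₀, hne⟩]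
    exact (sum_eq_zero fun c _ => if_neg fun h' => hne ((h' _ hy).trans (h' _ hy₀).symm)).symm

theorem cumulant₂_word [DecidableEq Y] (h : LettersFree S l) {B B' : Finset Y} (hB : B.Nonempty)
    (hB' : B'.Nonempty) {u : Fin B.card → Y} {u' : Fin B'.card → Y}
    (hu : ∀ k, u k ∈ B) (hsurj : ∀ y ∈ B, ∃ k, u k = y) (hu' : ∀ k, u' k ∈ B')
    (hsurj' : ∀ y ∈ B', ∃ k, u' k = y) :
    S.cumulant₂ B.card B'.card (fun k => l (w (u k))) (fun k => l (w (u' k))) =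
      ∑ c, if ∀ y ∈ B ∪ B', w y = c then letterCumulant₂ S l c B.card B'.card else 0 := by
  obtain ⟨y₀, hy₀⟩ := id hB
  have hy₀' : y₀ ∈ B ∪ B' := mem_union_left _ hy₀
  by_cases hc : ∀ y ∈ B ∪ B', w y = w y₀
  · rw [sum_eq_single (w y₀), if_pos hc]
    · unfold letterCumulant₂ SecondOrderSpace.cumulantOf₂
      congr 1
      · funext k
        rw [hc _ (mem_union_left _ (hu k))]
      · funext k
        rw [hc _ (mem_union_right _ (hu' k))]
    · exact fun c _ hne => if_neg fun h' => hne (h' y₀ hy₀').symm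
    · exact fun h => absurd (mem_univ _) h
  · push Not at hc
    obtain ⟨y, hy, hne⟩ := hc
    have key := h.2 B.card B'.card (Fin.append (fun k => w (u k)) fun k => w (u' k))
      (card_pos.2 hB) (card_pos.2 hB') (by
        obtain ⟨k₀, hk₀⟩ := hsurj y₀ hy₀
        rcases mem_union.1 hy with hy | hy
        · obtain ⟨k, hk⟩ := hsurj y hy
          exact ⟨Fin.castAdd _ k, Fin.castAdd _ k₀, by
            rwa [Fin.append_left, Fin.append_left, hk, hk₀]⟩
        · obtain ⟨k, hk⟩ := hsurj' y hy
          exact ⟨Fin.natAdd _ k, Fin.castAdd _ k₀, by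
            rwa [Fin.append_left, Fin.append_right, hk, hk₀]⟩)
    simp only [Fin.append_left, Fin.append_right] at key
    rw [key]
    exact (sum_eq_zero fun c _ => if_neg fun h' => hne ((h' _ hy).trans (h' _ hy₀').symm)).symm

/-- The cumulant of a word along a single cycle. -/
theorem cumulant_eq_blockVal (h : LettersFree S l) {B : Finset Y} (hB : B.Nonempty)
    {u : Fin B.card → Y} (hu : ∀ k, u k ∈ B) (hsurj : ∀ y ∈ B, ∃ k, u k = y) {π : Equiv.Perm Y}
    {s : Y → Bool} (hπ : ∀ y ∈ B, ∀ y' ∈ B, cyc π y y') :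
    S.cumulant B.card (fun k => l (w (u k))) =
      blockVal (letterCumulant S l) (letterCumulant₂ S l) π w s B := by
  rw [cumulant_word h hB hu hsurj]
  simp only [blockVal, letterVal, if_pos hπ]

variable {N : ℕ} {w : Fin N → L}

theorem exists_orderEmbOfFin_eq {V : Finset (Fin N)} {y : Fin N} (hy : y ∈ V) :
    ∃ k, V.orderEmbOfFin rfl k = y := by
  have := range_orderEmbOfFin V rfl
  have hy' : y ∈ Set.range (V.orderEmbOfFin rfl) := by rw [this]; exact hy
  exact hy'

theorem cumulant_restrict (h : LettersFree S l) {V : Finset (Fin N)} (hV : V.Nonempty)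
    {π : Equiv.Perm (Fin N)} {s : Fin N → Bool} (hπ : ∀ y ∈ V, ∀ y' ∈ V, cyc π y y') :
    S.cumulant V.card (restrict (fun i => l (w i)) V) =
      blockVal (letterCumulant S l) (letterCumulant₂ S l) π w s V :=
  cumulant_eq_blockVal h hV (u := V.orderEmbOfFin rfl) (orderEmbOfFin_mem V rfl)
    (fun _ hy => exists_orderEmbOfFin_eq hy) hπ

theorem cls_nonempty {Y : Type*} [Fintype Y] {U : Setoid Y} {B : Finset Y} (hB : B ∈ blocks U) :
    B.Nonempty := by
  obtain ⟨y, rfl⟩ := mem_blocks.1 hB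
  exact ⟨y, mem_cls_mk.2 (Setoid.refl' _ y)⟩

theorem rel_of_mem_blocks {Y : Type*} [Fintype Y] {U : Setoid Y} {B : Finset Y} (hB : B ∈ blocks U)
    {y y' : Y} (hy : y ∈ B) (hy' : y' ∈ B) : U y y' := by
  obtain ⟨z, rfl⟩ := mem_blocks.1 hB
  exact Setoid.trans' _ (Setoid.symm' _ (mem_cls_mk.1 hy)) (mem_cls_mk.1 hy')

/-- Non-crossing partitions correspond to planar pairs by letting each block run in increasing
order. Every block is a single cycle, so second order cumulants do not occur and `s` is arbitrary.
-/
theorem moment_word (h : LettersFree S l) {n : ℕ} (hn : 1 ≤ n) (w : Fin n → L)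
    (s : Fin n → Bool) : S.φ (List.ofFn fun i => l (w i)).prod =
      ∑ p ∈ planarPairs ⊤ (finRotate n),
        pairVal (letterCumulant S l) (letterCumulant₂ S l) w s p := by
  rw [S.moment_eq_sum hn]
  symm
  refine sum_bij (fun p _ => cyclePartition p.2) (fun p hp => ?_) (fun p hp p' hp' heq => ?_)
    (fun P hP => ?_) fun p hp => ?_
  · simp only [noncrossingPartitions, mem_filter, mem_univ, true_and]
    exact ((mem_planarPairs_finRotate hn).1 hp).2.1
  · obtain ⟨h1, h2⟩ := (mem_planarPairs_finRotate hn).1 hp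
    obtain ⟨h3, h4⟩ := (mem_planarPairs_finRotate hn).1 hp'
    rw [cyclePartition_eq, cyclePartition_eq] at heq
    have h5 : cyc p.2 = cyc p'.2 := by rw [← toSetoid_ofSetoid (cyc p.2), heq, toSetoid_ofSetoid]
    exact Prod.ext (by rw [h1, h3, h5]) (eq_of_isNoncrossingPerm h2 h4 h5)
  · simp only [noncrossingPartitions, mem_filter, mem_univ, true_and] at hP
    obtain ⟨π, hπ, rfl⟩ := exists_isNoncrossingPerm hP
    exact ⟨(cyc π, π), (mem_planarPairs_finRotate hn).2 ⟨rfl, hπ⟩, rfl⟩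
  · obtain ⟨h1, -⟩ := (mem_planarPairs_finRotate hn).1 hp
    rw [cyclePartition_eq, parts_ofSetoid, pairVal, h1]
    exact prod_congr rfl fun B hB => (cumulant_restrict h (cls_nonempty hB) fun y hy y' hy' =>
      rel_of_mem_blocks hB hy hy').symm

theorem exists_pow_eq_of_cyc {Y : Type*} [Fintype Y] {π : Equiv.Perm Y} {i j : Y}
    (h : cyc π i j) : ∃ k < (cls (cyc π) (Quotient.mk _ i)).card, (π ^ k) i = j := by
  by_cases hi : π i = i
  · refine ⟨0, card_pos.2 (cls_nonempty (mem_blocks.2 ⟨i, rfl⟩)), ?_⟩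
    obtain ⟨k, rfl⟩ := Equiv.Perm.SameCycle.exists_nat_pow_eq h
    exact ((Equiv.Perm.pow_apply_eq_self_of_apply_eq_self hi k).symm)
  · have hs : cls (cyc π) (Quotient.mk _ i) = (π.cycleOf i).support := by
      ext y
      rw [mem_cls_mk, Equiv.Perm.mem_support_cycleOf_iff, Equiv.Perm.mem_support]
      exact ⟨fun hy => ⟨hy, hi⟩, fun hy => hy.1⟩
    rw [hs]
    exact Equiv.Perm.SameCycle.exists_pow_eq_of_mem_support h (Equiv.Perm.mem_support.2 hi)

theorem cumulantPerm_eq_pairVal (h : LettersFree S l) (π : Equiv.Perm (Fin N))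
    (s : Fin N → Bool) : S.cumulantPerm π (fun i => l (w i)) =
      pairVal (letterCumulant S l) (letterCumulant₂ S l) w s (cyc π, π) := by
  rw [pairVal, prod_blocks, SecondOrderSpace.cumulantPerm]
  refine prod_bij (fun i _ => Quotient.mk (cyc π) i) (fun _ _ => mem_univ _)
    (fun i hi j hj heq => ?_) (fun q _ => ?_) fun i hi => ?_
  · have hij : cyc π i j := Quotient.exact heq
    exact le_antisymm ((mem_filter.1 hi).2 j hij) ((mem_filter.1 hj).2 i (Setoid.symm' _ hij))
  · induction q using Quotient.inductionOn with | _ i =>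
    obtain ⟨m, hm, hmin⟩ := (univ.filter fun j => cyc π i j).exists_min_image id
      ⟨i, mem_filter.2 ⟨mem_univ _, Setoid.refl' _ i⟩⟩
    have hm' : cyc π i m := (mem_filter.1 hm).2
    refine ⟨m, mem_filter.2 ⟨mem_univ _, fun j hj => ?_⟩, Quotient.sound (Setoid.symm' _ hm')⟩
    exact hmin j (mem_filter.2 ⟨mem_univ _, Setoid.trans' _ hm' hj⟩)
  · have e : (cyclePartition π).part i = cls (cyc π) (Quotient.mk _ i) := part_ofSetoid _ i
    rw [e]
    have hB : cls (cyc π) (Quotient.mk _ i) ∈ blocks (cyc π) := mem_blocks.2 ⟨i, rfl⟩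
    refine cumulant_eq_blockVal h (cls_nonempty hB)
      (u := fun k : Fin (cls (cyc π) (Quotient.mk _ i)).card => (π ^ k.val) i)
      (fun k => mem_cls_mk.2 ⟨k.val, by rw [zpow_natCast]⟩) (fun y hy => ?_)
      fun y hy y' hy' => rel_of_mem_blocks hB hy hy'
    obtain ⟨k, hk, hk'⟩ := exists_pow_eq_of_cyc (mem_cls_mk.1 hy)
    exact ⟨⟨k, hk⟩, hk'⟩

/-! ### Pairs of type 2 and second order moments of words -/

section TypeTwo

variable {n m : ℕ}

/-- The elements of the first cycle of `γ_{n,m}`. -/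
abbrev leftSide (n m : ℕ) (i : Fin (n + m)) : Bool := decide (i.val < n)

theorem leftCycle_ofSetoid {π : Equiv.Perm (Fin (n + m))} (hπ : cyc π ≤ cyc (gamma n m))
    (i : Fin n) (j : Fin m) :
    leftCycle n m (ofSetoid (joinPair (cyc π) (Fin.castAdd m i) (Fin.natAdd n j))) =
      cls (cyc π) (Quotient.mk _ (Fin.castAdd m i)) := by
  have hs : ∀ {a b}, cyc π a b → (a.val < n ↔ b.val < n) := fun h => (cyc_gamma _ _).1 (hπ h)
  ext k
  simp only [leftCycle, mem_filter, mem_univ, true_and, part_ofSetoid, mem_cls_mk, joinPair_apply]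
  constructor
  · rintro ⟨hk, k', h | ⟨h, -⟩ | ⟨h, -⟩, hk'⟩
    · have := hs h
      omega
    · exact Setoid.symm' _ h
    · have := hs h
      simp at this
      omega
  · intro h
    have := hs h
    simp only [Fin.val_castAdd, Fin.is_lt, true_iff] at this
    exact ⟨this, Fin.natAdd n j, Or.inr (Or.inl ⟨Setoid.symm' _ h, Setoid.refl' _ _⟩), by simp⟩

theorem rightCycle_ofSetoid {π : Equiv.Perm (Fin (n + m))} (hπ : cyc π ≤ cyc (gamma n m))
    (i : Fin n) (j : Fin m) :
    rightCycle n m (ofSetoid (joinPair (cyc π) (Fin.castAdd m i) (Fin.natAdd n j))) =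
      cls (cyc π) (Quotient.mk _ (Fin.natAdd n j)) := by
  have hs : ∀ {a b}, cyc π a b → (a.val < n ↔ b.val < n) := fun h => (cyc_gamma _ _).1 (hπ h)
  ext k
  simp only [rightCycle, mem_filter, mem_univ, true_and, part_ofSetoid, mem_cls_mk, joinPair_apply]
  constructor
  · rintro ⟨hk, k', h | ⟨h, -⟩ | ⟨h, -⟩, hk'⟩
    · have := hs h
      omega
    · have := hs h
      simp at this
      omega
    · exact Setoid.symm' _ h
  · intro h
    have := hs h
    simp only [Fin.val_natAdd] at this
    exact ⟨by omega, Fin.castAdd m i, Or.inr (Or.inr ⟨Setoid.symm' _ h, Setoid.refl' _ _⟩),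
      by simp⟩

theorem mergedBlock_ofSetoid {π : Equiv.Perm (Fin (n + m))} (hπ : cyc π ≤ cyc (gamma n m))
    (i : Fin n) (j : Fin m) :
    mergedBlock n m (ofSetoid (joinPair (cyc π) (Fin.castAdd m i) (Fin.natAdd n j))) =
      cls (joinPair (cyc π) (Fin.castAdd m i) (Fin.natAdd n j))
        (Quotient.mk _ (Fin.castAdd m i)) := by
  rw [mergedBlock, leftCycle_ofSetoid hπ, rightCycle_ofSetoid hπ, cls_joinPair_self]

/-- The shape of a pair of type 2. -/
structure TypeTwoData (n m : ℕ) (U : Finpartition (univ : Finset (Fin (n + m))))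
    (π : Equiv.Perm (Fin (n + m))) : Prop where
  le_gamma : cyc π ≤ cyc (gamma n m)
  left_nonempty : (leftCycle n m U).Nonempty
  right_nonempty : (rightCycle n m U).Nonempty
  left_cyc : ∀ y ∈ leftCycle n m U, ∀ y' ∈ leftCycle n m U, cyc π y y'
  right_cyc : ∀ y ∈ rightCycle n m U, ∀ y' ∈ rightCycle n m U, cyc π y y'
  merged_mem : mergedBlock n m U ∈ U.parts
  cyc_of_ne : ∀ V ∈ U.parts, V ≠ mergedBlock n m U → ∀ y ∈ V, ∀ y' ∈ V, cyc π y y'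
  nc_eq : nc π = nq (toSetoid U) + 1

theorem typeTwoData {U : Finpartition (univ : Finset (Fin (n + m)))} {π : Equiv.Perm (Fin (n + m))}
    (h : (U, π) ∈ typeTwo n m) : TypeTwoData n m U π := by
  rw [← ofSetoid_toSetoid U, mem_typeTwo_iff] at h
  obtain ⟨⟨π₁, π₂, -, -, hπ⟩, i, j, hU⟩ := h
  have hle : cyc π ≤ cyc (gamma n m) := hπ ▸ cyc_prodPerm_le_gamma π₁ π₂
  have hU' : U = ofSetoid (joinPair (cyc π) (Fin.castAdd m i) (Fin.natAdd n j)) := by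
    rw [← hU, ofSetoid_toSetoid]
  refine ⟨hle, ?_, ?_, ?_, ?_, ?_, ?_, ?_⟩
  · rw [hU', leftCycle_ofSetoid hle]
    exact cls_nonempty (mem_blocks.2 ⟨_, rfl⟩)
  · rw [hU', rightCycle_ofSetoid hle]
    exact cls_nonempty (mem_blocks.2 ⟨_, rfl⟩)
  · rw [hU', leftCycle_ofSetoid hle]
    exact fun y hy y' hy' => rel_of_mem_blocks (mem_blocks.2 ⟨_, rfl⟩) hy hy'
  · rw [hU', rightCycle_ofSetoid hle]
    exact fun y hy y' hy' => rel_of_mem_blocks (mem_blocks.2 ⟨_, rfl⟩) hy hy'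
  · rw [hU', mergedBlock_ofSetoid hle, parts_ofSetoid]
    exact mem_blocks.2 ⟨_, rfl⟩
  · intro V hV hne y hy y' hy'
    rw [hU', parts_ofSetoid] at hV
    rw [hU', mergedBlock_ofSetoid hle] at hne
    obtain ⟨z, rfl⟩ := mem_blocks.1 hV
    have hz : ¬ joinPair (cyc π) (Fin.castAdd m i) (Fin.natAdd n j) z (Fin.castAdd m i) :=
      fun h => hne (cls_eq_cls_iff.2 h)
    have hzx : ¬ cyc π z (Fin.castAdd m i) := fun h => hz (Or.inl h)
    have hzy : ¬ cyc π z (Fin.natAdd n j) := fun h =>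
      hz (Or.inr (Or.inr ⟨h, Setoid.refl' _ _⟩))
    rw [cls_joinPair_of_not hzx hzy] at hy hy'
    exact Setoid.trans' _ (Setoid.symm' _ (mem_cls_mk.1 hy)) (mem_cls_mk.1 hy')
  · rw [hU, nq_joinPair]
    rw [hπ]
    exact not_cyc_prodPerm

theorem mergedBlock_filter_left (U : Finpartition (univ : Finset (Fin (n + m)))) :
    ((mergedBlock n m U).filter fun y => leftSide n m y) = leftCycle n m U := by
  ext i
  simp only [mergedBlock, leftCycle, rightCycle, mem_filter, mem_union, mem_univ, true_and,
    decide_eq_true_eq]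
  constructor
  · rintro ⟨h | h, h'⟩
    · exact h
    · omega
  · exact fun h => ⟨Or.inl h, h.1⟩

theorem mergedBlock_filter_right (U : Finpartition (univ : Finset (Fin (n + m)))) :
    ((mergedBlock n m U).filter fun y => ¬ leftSide n m y) = rightCycle n m U := by
  ext i
  simp only [mergedBlock, leftCycle, rightCycle, mem_filter, mem_union, mem_univ, true_and,
    decide_eq_true_eq]
  constructor
  · rintro ⟨h | h, h'⟩
    · omega
    · exact h
  · exact fun h => ⟨Or.inr h, by omega⟩

theorem TypeTwoData.not_cyc {U : Finpartition (univ : Finset (Fin (n + m)))}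
    {π : Equiv.Perm (Fin (n + m))} (h : TypeTwoData n m U π) :
    ¬ ∀ y ∈ mergedBlock n m U, ∀ y' ∈ mergedBlock n m U, cyc π y y' := by
  intro hcon
  obtain ⟨x, hx⟩ := h.left_nonempty
  obtain ⟨y, hy⟩ := h.right_nonempty
  have hxy := (cyc_gamma _ _).1 (h.le_gamma
    (hcon x (mem_union_left _ hx) y (mem_union_right _ hy)))
  simp only [leftCycle, rightCycle, mem_filter] at hx hy
  omega

theorem TypeTwoData.letterVal_merged {U : Finpartition (univ : Finset (Fin (n + m)))}
    {π : Equiv.Perm (Fin (n + m))} (h : TypeTwoData n m U π) (k₁ : L → ℕ → ℂ)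
    (k₂ : L → ℕ → ℕ → ℂ) (c : L) :
    letterVal k₁ k₂ π (leftSide n m) (mergedBlock n m U) c =
      k₂ c (leftCycle n m U).card (rightCycle n m U).card := by
  rw [letterVal, if_neg h.not_cyc, mergedBlock_filter_left, mergedBlock_filter_right]

theorem secondMoment_word (h : LettersFree S l) (hn : 1 ≤ n) (hm : 1 ≤ m) (w : Fin (n + m) → L) :
    S.φ₂ (List.ofFn fun i => l (w (Fin.castAdd m i))).prod
        (List.ofFn fun i => l (w (Fin.natAdd n i))).prod =
      ∑ p ∈ planarPairs ⊤ (gamma n m),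
        pairVal (letterCumulant S l) (letterCumulant₂ S l) w (leftSide n m) p := by
  have happ : Fin.append (fun i => l (w (Fin.castAdd m i))) (fun i => l (w (Fin.natAdd n i))) =
      fun i => l (w i) := by
    funext i
    refine Fin.addCases (fun j => ?_) (fun j => ?_) i
    · rw [Fin.append_left]
    · rw [Fin.append_right]
  rw [S.secondMoment_eq_sum hn hm, sum_planarPairs_gamma hn hm, happ]
  refine congrArg₂ (· + ·) (sum_congr rfl fun π _ => cumulantPerm_eq_pairVal h π _)
    (sum_congr rfl ?_)
  rintro ⟨U, π⟩ hp
  have hd := typeTwoData hp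
  rw [pairVal, blocks_toSetoid, ← mul_prod_erase _ _ hd.merged_mem]
  refine congrArg₂ (· * ·) ?_ (prod_congr rfl fun V hV => ?_)
  · simp only [blockVal, hd.letterVal_merged]
    refine (cumulant₂_word (w := w) h hd.left_nonempty hd.right_nonempty
      (u := (leftCycle n m U).orderEmbOfFin rfl) (u' := (rightCycle n m U).orderEmbOfFin rfl)
      (orderEmbOfFin_mem _ rfl) (fun _ hy => exists_orderEmbOfFin_eq hy)
      (orderEmbOfFin_mem _ rfl) (fun _ hy => exists_orderEmbOfFin_eq hy)).trans
      (sum_congr rfl fun c _ => by unfold mergedBlock; congr)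
  · obtain ⟨h1, h2⟩ := mem_erase.1 hV
    exact cumulant_restrict h (U.nonempty_of_mem_parts h2) (hd.cyc_of_ne V h2 h1)

end TypeTwo

end Words

/-! ### Transport along bijections -/

section Transport

variable {Y Y' : Type*} [Fintype Y] [Fintype Y'] (e : Y' ≃ Y)

/-- Transport of a partitioned permutation along a bijection. -/
def transport (p : Setoid Y' × Equiv.Perm Y') : Setoid Y × Equiv.Perm Y :=
  glue (unitEquiv e) fun _ => p

variable {e}

theorem transport_fst_apply (p : Setoid Y' × Equiv.Perm Y') (y y' : Y') :
    (transport e p).1 (e y) (e y') ↔ p.1 y y' :=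
  glueS_piece (e := unitEquiv e) (U := fun _ => p.1) (b := ())

theorem transport_snd_apply (p : Setoid Y' × Equiv.Perm Y') (y : Y') :
    (transport e p).2 (e y) = e (p.2 y) :=
  glueP_piece (e := unitEquiv e) (fun _ => p.2) () y

theorem pairVal_transport {L : Type*} [Fintype L] (k₁ : L → ℕ → ℂ) (k₂ : L → ℕ → ℕ → ℂ)
    (g : Y → L) (s : Y → Bool) (p : Setoid Y' × Equiv.Perm Y') :
    pairVal k₁ k₂ g s (transport e p) = pairVal k₁ k₂ (g ∘ e) (s ∘ e) p := by
  rw [transport, pairVal_glue, Fintype.prod_unique]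
  rfl

theorem sum_planarPairs_transport {γ : Equiv.Perm Y} {γ' : Equiv.Perm Y'}
    (h : ∀ y, e (γ' y) = γ (e y)) (Q : Setoid Y × Equiv.Perm Y → Prop)
    (w : Setoid Y × Equiv.Perm Y → ℂ) :
    ∑ p ∈ (planarPairs ⊤ γ).filter Q, w p =
      ∑ p ∈ (planarPairs ⊤ γ').filter fun p => Q (transport e p), w (transport e p) := by
  have hp : ∀ p : Unit → Setoid Y' × Equiv.Perm Y', glue (unitEquiv e) p = transport e (p ()) :=
    fun _ => rfl
  have h3 := sum_planarPairs_glue (e := unitEquiv e) (fun _ : Unit => ⊤) (fun _ => γ') (Q := Q)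
    (Q' := fun _ p => Q (transport e p)) (w := w) (w' := fun _ p => w (transport e p))
    (fun p => by rw [hp, Unique.forall_iff])
    (fun p => by rw [hp, Fintype.prod_unique])
  rw [glueP_unitEquiv e h, glueS_unitEquiv_top] at h3
  rw [h3, Fintype.prod_unique]

theorem sum_planarPairs_transport' {γ : Equiv.Perm Y} {γ' : Equiv.Perm Y'}
    (h : ∀ y, e (γ' y) = γ (e y)) (w : Setoid Y × Equiv.Perm Y → ℂ) :
    ∑ p ∈ planarPairs ⊤ γ, w p = ∑ p ∈ planarPairs ⊤ γ', w (transport e p) := by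
  simpa using sum_planarPairs_transport h (fun _ => True) w

end Transport

/-! ### Products of `ab + ba` -/

section Expansion

variable {N M n m : ℕ}

/-- The bijection `2k - 1, 2k` of two copies of `[N]` with `[2N]`. -/
def pairEquiv (h : M = 2 * N) : Fin N ⊕ Fin N ≃ Fin M :=
  Equiv.ofBijective (Sum.elim (fun k => ⟨2 * k.val, by omega⟩) fun k => ⟨2 * k.val + 1, by omega⟩) <| by
    constructor
    · rintro (i | i) (j | j) hij <;> have := congrArg Fin.val hij <;> simp only [Sum.elim_inl,
        Sum.elim_inr] at this
      · exact congrArg Sum.inl (Fin.ext (by omega))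
      · omega
      · omega
      · exact congrArg Sum.inr (Fin.ext (by omega))
    · intro i
      rcases Nat.even_or_odd' i.val with ⟨k, hk | hk⟩
      · exact ⟨Sum.inl ⟨k, by omega⟩, Fin.ext hk.symm⟩
      · exact ⟨Sum.inr ⟨k, by omega⟩, Fin.ext hk.symm⟩

theorem val_pairEquiv_inl (h : M = 2 * N) (k : Fin N) :
    (pairEquiv h (Sum.inl k)).val = 2 * k.val := rfl

theorem val_pairEquiv_inr (h : M = 2 * N) (k : Fin N) :
    (pairEquiv h (Sum.inr k)).val = 2 * k.val + 1 := rfl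

theorem pairEquiv_finRotate (h : M = 2 * N) (a : Fin N ⊕ Fin N) :
    pairEquiv h (dbl (finRotate N) a) = finRotate M (pairEquiv h a) := by
  refine Fin.ext ?_
  rw [val_finRotate]
  rcases a with k | k
  · rw [dbl_inl, val_pairEquiv_inr, val_pairEquiv_inl, if_neg (by omega)]
  · rw [dbl_inr, val_pairEquiv_inr, val_pairEquiv_inl, val_finRotate]
    split_ifs <;> omega

theorem val_gamma (i : Fin (n + m)) : (gamma n m i).val =
    if i.val + 1 = n then 0 else if i.val + 1 = n + m then n else i.val + 1 := by
  refine Fin.addCases (fun j => ?_) (fun j => ?_) i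
  · rw [gamma, prodPerm_castAdd, Fin.val_castAdd, Fin.val_castAdd, val_finRotate]
    split_ifs <;> omega
  · rw [gamma, prodPerm_natAdd, Fin.val_natAdd, Fin.val_natAdd, val_finRotate]
    split_ifs <;> omega

theorem pairEquiv_gamma (hn : 1 ≤ n) (h : 2 * n + 2 * m = 2 * (n + m))
    (a : Fin (n + m) ⊕ Fin (n + m)) :
    pairEquiv h (dbl (gamma n m) a) = gamma (2 * n) (2 * m) (pairEquiv h a) := by
  refine Fin.ext ?_
  rw [val_gamma]
  rcases a with k | k
  · rw [dbl_inl, val_pairEquiv_inr, val_pairEquiv_inl, if_neg (by omega), if_neg (by omega)]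
  · rw [dbl_inr, val_pairEquiv_inr, val_pairEquiv_inl, val_gamma]
    split_ifs <;> omega

variable {A : Type*} [Ring A]

theorem prod_ofFn_sum {ι : Type*} [Fintype ι] (n : ℕ) (u : ι → A) :
    (List.ofFn fun _ : Fin n => ∑ c, u c).prod =
      ∑ f : Fin n → ι, (List.ofFn fun k => u (f k)).prod := by
  induction n with
  | zero => simp
  | succ n ih =>
    rw [List.ofFn_succ, List.prod_cons, ih, sum_mul_sum, ← sum_product', univ_product_univ]
    refine Fintype.sum_equiv (Fin.consEquiv fun _ => ι) _ _ fun f => ?_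
    rw [List.ofFn_succ, List.prod_cons]
    rfl

theorem prod_ofFn_pairs (h : M = 2 * N) (g : Fin N ⊕ Fin N → A) :
    (List.ofFn fun i => g ((pairEquiv h).symm i)).prod =
      (List.ofFn fun k => g (Sum.inl k) * g (Sum.inr k)).prod := by
  subst h
  rw [List.ofFn_mul', List.prod_flatten, List.map_ofFn]
  congr 2
  funext k
  have h0 : (pairEquiv rfl).symm ⟨2 * k.val + 0, by omega⟩ = Sum.inl k :=
    (Equiv.symm_apply_eq _).2 rfl
  have h1 : (pairEquiv rfl).symm ⟨2 * k.val + 1, by omega⟩ = Sum.inr k :=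
    (Equiv.symm_apply_eq _).2 rfl
  simp only [Function.comp_apply, List.ofFn_succ, List.ofFn_zero, List.prod_cons, List.prod_nil,
    mul_one, Fin.val_zero, Fin.val_succ, zero_add]
  rw [h0, h1]

variable [Algebra ℂ A]

/-- The letters `a` and `b`. -/
abbrev twoLetters (a b : A) (c : Bool) : A := if c then a else b

theorem lettersFree_twoLetters {S : SecondOrderSpace A} {a b : A} (h : S.SecondOrderFree a b) :
    LettersFree S (twoLetters a b) := h

/-- An alphabet of one letter has no mixed words. The word formulas thus apply to the single
variable `ab + ba` as well as to the free letters `a`, `b`. -/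
theorem lettersFree_unit (S : SecondOrderSpace A) (c : A) :
    LettersFree S (fun _ : Unit => c) :=
  ⟨fun _ _ ⟨_, _, h⟩ => absurd rfl h, fun _ _ _ _ _ ⟨_, _, h⟩ => absurd rfl h⟩

theorem prod_anticomm (a b : A) (h : M = 2 * N) :
    (List.ofFn fun _ : Fin N => a * b + b * a).prod =
      ∑ f : Fin N → Bool, (List.ofFn fun i =>
        twoLetters a b (colour f ((pairEquiv h).symm i))).prod := by
  have h1 : a * b + b * a = ∑ c : Bool, twoLetters a b c * twoLetters a b (!c) := by simp
  rw [h1, prod_ofFn_sum]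
  refine sum_congr rfl fun f _ => ?_
  rw [prod_ofFn_pairs h fun x => twoLetters a b (colour f x)]
  rfl

theorem moment_anticomm {S : SecondOrderSpace A} {a b : A} (h : S.SecondOrderFree a b) (hn : 1 ≤ n)
    (s : Fin n → Bool) : S.φ (List.ofFn fun _ : Fin n => a * b + b * a).prod =
      ∑ p ∈ planarPairs ⊤ (dbl (finRotate n)), colourSum (letterCumulant S (twoLetters a b))
        (letterCumulant₂ S (twoLetters a b)) s p := by
  have h2 : 2 * n = 2 * n := rfl
  rw [prod_anticomm a b h2, map_sum]
  simp only [colourSum_eq]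
  rw [sum_comm]
  refine sum_congr rfl fun f _ => ?_
  rw [moment_word (lettersFree_twoLetters h) (by omega)
    (fun i => colour f ((pairEquiv h2).symm i)) (fun i => side s ((pairEquiv h2).symm i)),
    sum_planarPairs_transport' (pairEquiv_finRotate h2)]
  refine sum_congr rfl fun p _ => ?_
  rw [pairVal_transport]
  congr 1 <;> funext x <;> simp

theorem secondMoment_anticomm {S : SecondOrderSpace A} {a b : A} (h : S.SecondOrderFree a b)
    (hn : 1 ≤ n) (hm : 1 ≤ m) : S.φ₂ (List.ofFn fun _ : Fin n => a * b + b * a).prod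
        (List.ofFn fun _ : Fin m => a * b + b * a).prod =
      ∑ p ∈ planarPairs ⊤ (dbl (gamma n m)), colourSum (letterCumulant S (twoLetters a b))
        (letterCumulant₂ S (twoLetters a b)) (leftSide n m) p := by
  have h2 : 2 * n + 2 * m = 2 * (n + m) := by ring
  rw [prod_anticomm a b (rfl : 2 * n = 2 * n), prod_anticomm a b (rfl : 2 * m = 2 * m), map_sum]
  simp only [LinearMap.coe_sum, Finset.sum_apply, map_sum, colourSum_eq]
  conv_lhs => rw [sum_comm]
  conv_rhs => rw [sum_comm]
  rw [← sum_product', univ_product_univ]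
  refine Fintype.sum_equiv (Fin.appendEquiv n m) _ _ fun f => ?_
  have key := secondMoment_word (lettersFree_twoLetters h) (n := 2 * n) (m := 2 * m) (by omega)
    (by omega) (fun i => colour (Fin.append f.1 f.2) ((pairEquiv h2).symm i))
  have e1 : ∀ i : Fin (2 * n), colour (Fin.append f.1 f.2)
      ((pairEquiv h2).symm (Fin.castAdd (2 * m) i)) = colour f.1 ((pairEquiv rfl).symm i) := by
    intro i
    obtain ⟨x, rfl⟩ := (pairEquiv rfl).surjective i
    rw [Equiv.symm_apply_apply]
    rcases x with k | k
    · have : (pairEquiv h2).symm (Fin.castAdd (2 * m) (pairEquiv rfl (Sum.inl k))) =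
          Sum.inl (Fin.castAdd m k) := (Equiv.symm_apply_eq _).2 rfl
      rw [this]
      simp
    · have : (pairEquiv h2).symm (Fin.castAdd (2 * m) (pairEquiv rfl (Sum.inr k))) =
          Sum.inr (Fin.castAdd m k) := (Equiv.symm_apply_eq _).2 rfl
      rw [this]
      simp
  have e2 : ∀ i : Fin (2 * m), colour (Fin.append f.1 f.2)
      ((pairEquiv h2).symm (Fin.natAdd (2 * n) i)) = colour f.2 ((pairEquiv rfl).symm i) := by
    intro i
    obtain ⟨x, rfl⟩ := (pairEquiv rfl).surjective i
    rw [Equiv.symm_apply_apply]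
    rcases x with k | k
    · have : (pairEquiv h2).symm (Fin.natAdd (2 * n) (pairEquiv rfl (Sum.inl k))) =
          Sum.inl (Fin.natAdd n k) := (Equiv.symm_apply_eq _).2 (Fin.ext (by
            simp only [Fin.val_natAdd, val_pairEquiv_inl]; ring))
      rw [this]
      simp
    · have : (pairEquiv h2).symm (Fin.natAdd (2 * n) (pairEquiv rfl (Sum.inr k))) =
          Sum.inr (Fin.natAdd n k) := (Equiv.symm_apply_eq _).2 (Fin.ext (by
            simp only [Fin.val_natAdd, val_pairEquiv_inr]; ring))
      rw [this]
      simp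
  simp only [e1, e2] at key
  rw [key, sum_planarPairs_transport' (pairEquiv_gamma hn h2)]
  refine sum_congr rfl fun p _ => ?_
  rw [pairVal_transport]
  congr 1
  · funext x
    simp [Fin.appendEquiv]
  · funext x
    rcases x with k | k
    · change decide (2 * k.val < 2 * n) = decide (k.val < n)
      exact decide_eq_decide.2 (by omega)
    · change decide (2 * k.val + 1 < 2 * n) = decide (k.val < n)
      exact decide_eq_decide.2 (by omega)

end Expansion

/-! ### Permutations with at most two cycles -/

section Enumerate

variable {Y : Type*} [Fintype Y]

/-- For `U = ⊤` the two block counts cancel, so with equally many cycles defect `0` says that `σ⁻¹ *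
γ` has as many cycles as there are elements. -/
theorem eq_of_top_mem_planarPairs {σ γ : Equiv.Perm Y} (h : (⊤, σ) ∈ planarPairs ⊤ γ)
    (hn : nc σ = nc γ) : σ = γ := by
  obtain ⟨-, -, h3⟩ := mem_planarPairs.1 h
  rw [defect, top_sup_eq] at h3
  have h5 : cyc (σ⁻¹ * γ) = ⊥ := (eq_of_le_of_nq_le bot_le (by
    rw [nq_bot]
    simp only [hn] at h3
    change nc (σ⁻¹ * γ) ≥ _
    omega)).symm
  exact inv_mul_eq_one.1 (eq_one_of_cyc_eq_bot h5)

/-- The elements of a cycle, listed along the cycle. -/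
theorem exists_cycle_equiv (σ : Equiv.Perm Y) (x : Y) : ∃ k, 1 ≤ k ∧
    ∃ e : Fin k ≃ {y // cyc σ x y}, ∀ i, (e (finRotate k i) : Y) = σ (e i) := by
  set B := cls (cyc σ) (Quotient.mk _ x) with hB
  have hBx : ∀ y, y ∈ B ↔ cyc σ x y := fun y => mem_cls_mk
  have hpos : 0 < B.card := card_pos.2 ⟨x, (hBx x).2 (Setoid.refl' _ x)⟩
  let u : Fin B.card → {y // cyc σ x y} := fun i => ⟨(σ ^ i.val) x, i.val, by rw [zpow_natCast]⟩
  have hcard : Fintype.card (Fin B.card) = Fintype.card {y // cyc σ x y} := by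
    rw [Fintype.card_fin, Fintype.card_subtype]
    congr 1
    ext y
    simp [hBx]
  have hu : Function.Bijective u := by
    refine (Fintype.bijective_iff_surjective_and_card u).2 ⟨?_, hcard⟩
    rintro ⟨y, hy⟩
    obtain ⟨k, hk, rfl⟩ := exists_pow_eq_of_cyc hy
    exact ⟨⟨k, hk⟩, rfl⟩
  have hinj : ∀ {i j : ℕ}, i < B.card → j < B.card → (σ ^ i) x = (σ ^ j) x → i = j :=
    fun hi hj h => congrArg Fin.val (hu.1 (Subtype.ext h : u ⟨_, hi⟩ = u ⟨_, hj⟩))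
  -- The orbit can close up only at `x`: a return to `σ^j x` with `j > 0` would, after cancelling
  -- `σ^j`, be an earlier return to `x`.
  have hlast : (σ ^ B.card) x = x := by
    obtain ⟨j, hj⟩ := hu.2 ⟨(σ ^ B.card) x, B.card, by rw [zpow_natCast]⟩
    have hj' : (σ ^ j.val) x = (σ ^ B.card) x := congrArg Subtype.val hj
    have h1 : (σ ^ (B.card - j.val)) x = x := by
      refine (σ ^ j.val).injective ?_
      rw [← Equiv.Perm.mul_apply, ← pow_add, Nat.add_sub_cancel' j.isLt.le, hj']
    rcases Nat.eq_zero_or_pos j.val with h0 | h0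
    · rw [← hj', h0, pow_zero, Equiv.Perm.one_apply]
    · have := hinj (i := B.card - j.val) (j := 0) (by omega) hpos (by
        rw [h1, pow_zero, Equiv.Perm.one_apply])
      omega
  refine ⟨B.card, hpos, Equiv.ofBijective u hu, fun i => ?_⟩
  change (σ ^ (finRotate B.card i).val) x = σ ((σ ^ i.val) x)
  rw [← Equiv.Perm.mul_apply, ← pow_succ', val_finRotate]
  split_ifs with h
  · rw [h, hlast, pow_zero, Equiv.Perm.one_apply]
  · rfl

theorem exists_finRotate_equiv [Nonempty Y] {σ : Equiv.Perm Y} (h : ∀ x y, cyc σ x y) :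
    ∃ k, 1 ≤ k ∧ ∃ e : Fin k ≃ Y, ∀ i, e (finRotate k i) = σ (e i) := by
  obtain ⟨x⟩ := ‹Nonempty Y›
  obtain ⟨k, hk, e, he⟩ := exists_cycle_equiv σ x
  exact ⟨k, hk, e.trans (Equiv.subtypeUnivEquiv (h x)), he⟩

theorem exists_gamma_equiv {σ : Equiv.Perm Y} {s : Y → Bool}
    (h : ∀ x y, cyc σ x y ↔ s x = s y) (h₁ : ∃ x, s x = true) (h₂ : ∃ x, s x = false) :
    ∃ p r, 1 ≤ p ∧ 1 ≤ r ∧ ∃ e : Fin (p + r) ≃ Y,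
      (∀ i, e (gamma p r i) = σ (e i)) ∧ s ∘ e = leftSide p r := by
  obtain ⟨x, hx⟩ := h₁
  obtain ⟨y, hy⟩ := h₂
  obtain ⟨p, hp, e₁, he₁⟩ := exists_cycle_equiv σ x
  obtain ⟨r, hr, e₂, he₂⟩ := exists_cycle_equiv σ y
  let F : Fin (p + r) → Y := Fin.append (fun i => (e₁ i : Y)) fun i => (e₂ i : Y)
  have hs₁ : ∀ i, s (e₁ i) = true := fun i => ((h _ _).1 (e₁ i).2).symm.trans hx
  have hs₂ : ∀ i, s (e₂ i) = false := fun i => ((h _ _).1 (e₂ i).2).symm.trans hy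
  have hF₁ : ∀ i, F (Fin.castAdd r i) = e₁ i := fun i => Fin.append_left _ _ i
  have hF₂ : ∀ i, F (Fin.natAdd p i) = e₂ i := fun i => Fin.append_right _ _ i
  have hF : Function.Bijective F := by
    constructor
    · intro i j
      refine Fin.addCases (fun i => ?_) (fun i => ?_) i <;>
      refine Fin.addCases (fun j => ?_) (fun j => ?_) j <;>
      simp only [hF₁, hF₂] <;> intro hij
      · rw [e₁.injective (Subtype.ext hij)]
      · have := hs₁ i
        rw [hij, hs₂] at this
        cases this
      · have := hs₂ i
        rw [hij, hs₁] at this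
        cases this
      · rw [e₂.injective (Subtype.ext hij)]
    · intro z
      cases hz : s z
      · obtain ⟨i, hi⟩ := e₂.surjective ⟨z, (h _ _).2 (hy.trans hz.symm)⟩
        exact ⟨Fin.natAdd p i, by rw [hF₂, hi]⟩
      · obtain ⟨i, hi⟩ := e₁.surjective ⟨z, (h _ _).2 (hx.trans hz.symm)⟩
        exact ⟨Fin.castAdd r i, by rw [hF₁, hi]⟩
  refine ⟨p, r, hp, hr, Equiv.ofBijective F hF, fun i => ?_, funext fun i => ?_⟩
  · refine Fin.addCases (fun i => ?_) (fun i => ?_) i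
    · rw [gamma, prodPerm_castAdd]
      simp only [Equiv.ofBijective_apply, hF₁, he₁]
    · rw [gamma, prodPerm_natAdd]
      simp only [Equiv.ofBijective_apply, hF₂, he₂]
  · refine Fin.addCases (fun i => ?_) (fun i => ?_) i
    · simp [hF₁, hs₁]
    · simp [hF₂, hs₂]

end Enumerate

theorem blocks_top {Y : Type*} [Fintype Y] [Nonempty Y] : blocks (⊤ : Setoid Y) = {univ} := by
  ext B
  rw [mem_blocks, mem_singleton]
  have h : ∀ y : Y, cls ⊤ (Quotient.mk ⊤ y) = univ := fun y =>
    eq_univ_of_forall fun z => mem_cls_mk.2 trivial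
  simp only [h, exists_const]

theorem eq_top_of_cls_eq_univ {Y : Type*} [Fintype Y] {V : Setoid Y} {q : Quotient V}
    (h : cls V q = univ) : V = ⊤ := eq_top_iff.2 fun x y _ =>
  Quotient.exact ((mem_cls.1 (h ▸ mem_univ x)).trans (mem_cls.1 (h ▸ mem_univ y)).symm)

theorem card_cls_lt {Y : Type*} [Fintype Y] {V : Setoid Y} (h : V ≠ ⊤) (q : Quotient V) :
    (cls V q).card < Fintype.card Y :=
  card_lt_univ_of_notMem (x := (not_forall.1 fun h' => h (eq_top_of_cls_eq_univ
    (eq_univ_of_forall h'))).choose) (not_forall.1 fun h' => h (eq_top_of_cls_eq_univ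
    (eq_univ_of_forall h'))).choose_spec

theorem card_filter_leftSide (n m : ℕ) :
    (univ.filter fun i => leftSide n m i = true).card = n := by
  have h : (univ.filter fun i => leftSide n m i = true) = univ.map (Fin.castAddEmb m) := by
    ext i
    rw [mem_filter, mem_map]
    refine Fin.addCases (fun j => ?_) (fun j => ?_) i
    · simp
    · simp only [mem_univ, true_and, decide_eq_true_eq, Fin.val_natAdd]
      exact ⟨fun h => by omega, fun ⟨k, hk⟩ => by
        have := congrArg Fin.val hk
        simp at this
        omega⟩
  rw [h, card_map, card_univ, Fintype.card_fin]

theorem card_filter_leftSide_eq_false (n m : ℕ) :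
    (univ.filter fun i => leftSide n m i = false).card = m := by
  have h := card_filter_add_card_filter_not (s := (univ : Finset (Fin (n + m))))
    (fun i => leftSide n m i = true)
  simp only [Bool.not_eq_true, card_filter_leftSide, card_univ, Fintype.card_fin] at h
  omega

/-! ### The cumulants of `ab + ba` -/

section Anticomm

variable {A : Type*} [Ring A] [Algebra ℂ A] (S : SecondOrderSpace A) (a b : A)

/-- The combined cumulants of the letters `a`, `b`. -/
abbrev combined {X : Type*} [Fintype X] (γ : Equiv.Perm X) (s : X → Bool) : ℂ :=
  anticommCumulant (letterCumulant S (twoLetters a b)) (letterCumulant₂ S (twoLetters a b)) γ s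

/-- The weight of a partitioned permutation in the moments of `ab + ba`. -/
abbrev anticommVal {X : Type*} [Fintype X] (s : X → Bool)
    (p : Setoid X × Equiv.Perm X) : ℂ :=
  pairVal (letterCumulant S fun _ : Unit => a * b + b * a)
    (letterCumulant₂ S fun _ : Unit => a * b + b * a) (fun _ => ()) s p

/-- The contribution of a partitioned permutation of the products `ab`, `ba`. -/
abbrev fibreSum {X : Type*} [Fintype X] (s : X → Bool) (p : Setoid X × Equiv.Perm X) : ℂ :=
  ∑ q ∈ (planarPairs (p.1.comap proj) (dbl p.2)).filter fun q => Sep (q.2⁻¹ * dbl p.2),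
    colourSum (letterCumulant S (twoLetters a b)) (letterCumulant₂ S (twoLetters a b)) s q

variable {S a b}

theorem anticommVal_top {X : Type*} [Fintype X] [Nonempty X] (s : X → Bool) (γ : Equiv.Perm X) :
    anticommVal S a b s (⊤, γ) = letterVal (letterCumulant S fun _ : Unit => a * b + b * a)
      (letterCumulant₂ S fun _ : Unit => a * b + b * a) γ s univ () := by
  rw [anticommVal, pairVal, blocks_top, prod_singleton]
  exact blockVal_of_forall _ _ univ_nonempty fun _ _ => rfl

variable {X : Type*} [Fintype X] {V : Setoid X} {σ : Equiv.Perm X} {s : X → Bool}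

/-- The inductive step in both orders. The fibre sum is a product over the blocks of `V`; each block
is relabelled as one standard cycle, or as two standard cycles on different sides, where the
combined cumulant is assumed to be known. -/
theorem fibreSum_eq_anticommVal (hσ : cyc σ ≤ V)
    (h : ∀ q : Quotient V,
      ((∀ y ∈ cls V q, ∀ y' ∈ cls V q, cyc σ y y') ∧
        ∀ s', combined S a b (finRotate (cls V q).card) s' =
          S.cumulantOf (a * b + b * a) (cls V q).card) ∨
      ((∀ y ∈ cls V q, ∀ y' ∈ cls V q, cyc σ y y' ↔ s y = s y') ∧
        (∃ y ∈ cls V q, s y = true) ∧ (∃ y ∈ cls V q, s y = false) ∧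
        ∀ n m, 1 ≤ n → 1 ≤ m → n + m = (cls V q).card →
          combined S a b (gamma n m) (leftSide n m) = S.cumulantOf₂ (a * b + b * a) n m)) :
    fibreSum S a b s (V, σ) = anticommVal S a b s (V, σ) := by
  obtain ⟨σ', h1, h2, h3⟩ := exists_sum_colourSum_eq_prod (letterCumulant S (twoLetters a b))
    (letterCumulant₂ S (twoLetters a b)) hσ s
  rw [fibreSum, h3, anticommVal, pairVal, prod_blocks]
  refine prod_congr rfl fun q _ => ?_
  obtain ⟨y₀, hy₀⟩ := cls_nonempty (U := V) (B := cls V q)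
    (Quotient.inductionOn q fun y => mem_blocks.2 ⟨y, rfl⟩)
  have hne : Nonempty {x // Quotient.mk V x = q} := ⟨⟨y₀, mem_cls.1 hy₀⟩⟩
  have hmem : ∀ x : {x // Quotient.mk V x = q}, (x : X) ∈ cls V q := fun x => mem_cls.2 x.2
  have hcard : Fintype.card {x // Quotient.mk V x = q} = (cls V q).card := Fintype.card_subtype _
  rw [blockVal_of_forall (c := ()) _ _ ⟨y₀, hy₀⟩ fun _ _ => rfl]
  rcases h q with ⟨h4, h5⟩ | ⟨h4, ⟨x, hx, hx'⟩, ⟨y, hy, hy'⟩, h5⟩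
  · obtain ⟨k, -, e, he⟩ := exists_finRotate_equiv (σ := σ' q) fun x y =>
      (h2 q x y).2 (h4 _ (hmem x) _ (hmem y))
    have hk : k = (cls V q).card := by rw [← hcard, ← Fintype.card_congr e, Fintype.card_fin]
    subst hk
    rw [← anticommCumulant_congr _ _ e he, letterVal, if_pos h4]
    exact h5 _
  · obtain ⟨p, r, hp, hr, e, he, hs⟩ := exists_gamma_equiv (σ := σ' q) (s := s ∘ Subtype.val)
      (fun x y => (h2 q x y).trans (h4 _ (hmem x) _ (hmem y)))
      ⟨⟨x, mem_cls.1 hx⟩, hx'⟩ ⟨⟨y, mem_cls.1 hy⟩, hy'⟩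
    have hk : p + r = (cls V q).card := by rw [← hcard, ← Fintype.card_congr e, Fintype.card_fin]
    rw [← anticommCumulant_congr _ _ e he, letterVal, if_neg, hs]
    · refine (h5 p r hp hr hk).trans ?_
      have key : ∀ c : Bool, ((cls V q).filter fun y => s y = c).card =
          (univ.filter fun i => leftSide p r i = c).card := fun c => by
        rw [← hs]
        refine (card_bij (fun i _ => (e i : X)) (fun i hi => ?_) (fun i _ j _ hij => ?_)
          fun y hy => ?_).symm
        · exact mem_filter.2 ⟨hmem _, (mem_filter.1 hi).2⟩
        · exact e.injective (Subtype.ext hij)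
        · obtain ⟨hy1, hy2⟩ := mem_filter.1 hy
          exact ⟨e.symm ⟨y, mem_cls.1 hy1⟩, mem_filter.2 ⟨mem_univ _, by simpa using hy2⟩, by simp⟩
      simp only [Bool.not_eq_true, key, card_filter_leftSide, card_filter_leftSide_eq_false]
    · intro hall
      have := (h4 x hx y hy).1 (hall x hx y hy)
      rw [hx', hy'] at this
      cases this

/-- The moment is expanded in the cumulants of `ab + ba` and in those of the letters, the latter
grouped by fibres. Pairs other than `(⊤, finRotate n)` have only smaller blocks and cancel by
induction. -/
theorem combined_finRotate (hab : S.SecondOrderFree a b) {n : ℕ} (hn : 1 ≤ n) (s : Fin n → Bool) :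
    combined S a b (finRotate n) s = S.cumulantOf (a * b + b * a) n := by
  induction n using Nat.strong_induction_on with | _ n ih =>
  have : Nonempty (Fin n) := ⟨⟨0, hn⟩⟩
  have h1 := moment_anticomm hab hn s
  rw [moment_word (lettersFree_unit S (a * b + b * a)) hn (fun _ => ()) s, sum_planarPairs_dbl]
    at h1
  have htop : (⊤, finRotate n) ∈ planarPairs ⊤ (finRotate n) := by
    rw [mem_planarPairs_of_transitive (cyc_finRotate n)]
    simp [cyc_finRotate, nc, cyc_one, nq_bot, nq_top, add_comm]
  rw [← add_sum_erase _ _ htop, ← add_sum_erase _ _ htop] at h1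
  have h2 : ∀ p ∈ (planarPairs ⊤ (finRotate n)).erase (⊤, finRotate n),
      fibreSum S a b s p = anticommVal S a b s p := by
    rintro ⟨V, σ⟩ hp
    obtain ⟨hne, hp⟩ := mem_erase.1 hp
    have hV : V = cyc σ := ((mem_planarPairs_of_transitive (cyc_finRotate n)).1 hp).1
    have hV' : V ≠ ⊤ := by
      intro hV'
      subst hV'
      refine hne (Prod.ext rfl (eq_of_top_mem_planarPairs hp ?_))
      rw [nc, nc, ← hV, cyc_finRotate]
    refine fibreSum_eq_anticommVal hV.ge fun q => Or.inl ⟨fun y hy y' hy' => ?_, fun s' => ?_⟩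
    · rw [← hV]
      exact Quotient.exact ((mem_cls.1 hy).trans (mem_cls.1 hy').symm)
    · refine ih _ ((card_cls_lt hV' q).trans_eq (Fintype.card_fin n)) (card_pos.2 ?_) s'
      exact cls_nonempty (Quotient.inductionOn q fun y => mem_blocks.2 ⟨y, rfl⟩)
  rw [sum_congr rfl fun p hp => (h2 p hp).symm] at h1
  have h3 := add_right_cancel h1
  have h4 := anticommVal_top (S := S) (a := a) (b := b) s (finRotate n)
  have hall : ∀ x ∈ univ, ∀ y ∈ univ, cyc (finRotate n) x y := fun x _ y _ =>
    sameCycle_finRotate x y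
  rw [letterVal, if_pos hall, card_univ, Fintype.card_fin] at h4
  -- Pulling `⊤` back to the doubled set gives `⊤` by definition, so the fibre sum of the one-block
  -- pair is literally `combined`.
  exact (h3.symm.trans h4 :)

/-- As in first order. Blocks that are single cycles are covered by `combined_finRotate`; the merged
block of a pair of type 2 is smaller than the whole set unless the pair is `(⊤, gamma n m)`, and is
covered by induction on `n + m`. -/
theorem combined_gamma (hab : S.SecondOrderFree a b) {n m : ℕ} (hn : 1 ≤ n) (hm : 1 ≤ m) :
    combined S a b (gamma n m) (leftSide n m) = S.cumulantOf₂ (a * b + b * a) n m := by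
  obtain ⟨N, hN⟩ : ∃ N, n + m = N := ⟨_, rfl⟩
  induction N using Nat.strong_induction_on generalizing n m with | _ N ih =>
  subst hN
  have : Nonempty (Fin (n + m)) := ⟨⟨0, by omega⟩⟩
  have h1 := secondMoment_anticomm hab hn hm
  rw [secondMoment_word (lettersFree_unit S (a * b + b * a)) hn hm (fun _ => ()),
    sum_planarPairs_dbl] at h1
  have htop : (⊤, gamma n m) ∈ planarPairs ⊤ (gamma n m) := by
    rw [mem_planarPairs]
    refine ⟨le_top, top_sup_eq _, ?_⟩
    simp only [defect, top_sup_eq, nq_top, inv_mul_cancel, nc, cyc_one, nq_bot]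
    ring
  rw [← add_sum_erase _ _ htop, ← add_sum_erase _ _ htop] at h1
  have h2 : ∀ p ∈ (planarPairs ⊤ (gamma n m)).erase (⊤, gamma n m),
      fibreSum S a b (leftSide n m) p = anticommVal S a b (leftSide n m) p := by
    rintro ⟨V, σ⟩ hp
    obtain ⟨hne, hp⟩ := mem_erase.1 hp
    have hpos : ∀ q : Quotient V, 1 ≤ (cls V q).card := fun q => card_pos.2
      (cls_nonempty (Quotient.inductionOn q fun y => mem_blocks.2 ⟨y, rfl⟩))
    refine fibreSum_eq_anticommVal (mem_planarPairs.1 hp).1 fun q => ?_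
    rcases (mem_planarPairs_gamma hn hm).1 hp with ⟨-, hV⟩ | h
    · refine Or.inl ⟨fun y hy y' hy' => ?_, fun s' => combined_finRotate hab (hpos q) s'⟩
      rw [← hV]
      exact Quotient.exact ((mem_cls.1 hy).trans (mem_cls.1 hy').symm)
    · have hd := typeTwoData h
      have hmem : cls V q ∈ (ofSetoid V).parts := by
        rw [parts_ofSetoid]
        exact Quotient.inductionOn q fun y => mem_blocks.2 ⟨y, rfl⟩
      by_cases hq : cls V q = mergedBlock n m (ofSetoid V)
      · refine Or.inr ?_
        rw [hq]
        have hleft : ∀ y ∈ mergedBlock n m (ofSetoid V), leftSide n m y = true →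
            y ∈ leftCycle n m (ofSetoid V) := fun y hy hy' => by
          rw [← mergedBlock_filter_left]
          exact mem_filter.2 ⟨hy, hy'⟩
        have hright : ∀ y ∈ mergedBlock n m (ofSetoid V), ¬ leftSide n m y = true →
            y ∈ rightCycle n m (ofSetoid V) := fun y hy hy' => by
          rw [← mergedBlock_filter_right]
          exact mem_filter.2 ⟨hy, hy'⟩
        refine ⟨fun y hy y' hy' => ⟨fun hyy' => ?_, fun hyy' => ?_⟩, ?_, ?_, fun p r hp' hr' hpr => ?_⟩
        · exact decide_eq_decide.2 ((cyc_gamma _ _).1 (hd.le_gamma hyy'))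
        · by_cases hy1 : leftSide n m y = true
          · exact hd.left_cyc _ (hleft y hy hy1) _ (hleft y' hy' (hyy'.symm.trans hy1))
          · exact hd.right_cyc _ (hright y hy hy1) _ (hright y' hy' (hyy' ▸ hy1))
        · obtain ⟨x, hx⟩ := hd.left_nonempty
          exact ⟨x, mem_union_left _ hx, decide_eq_true (mem_filter.1 hx).2.1⟩
        · obtain ⟨x, hx⟩ := hd.right_nonempty
          exact ⟨x, mem_union_right _ hx, decide_eq_false (not_lt.2 (mem_filter.1 hx).2.1)⟩
        · refine ih (p + r) ?_ hp' hr' rfl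
          rw [hpr, ← hq]
          refine (card_cls_lt (fun hV => hne ?_) q).trans_eq (Fintype.card_fin _)
          subst hV
          refine Prod.ext rfl (eq_of_top_mem_planarPairs hp ?_)
          have := hd.nc_eq
          rw [toSetoid_ofSetoid, nq_top] at this
          rw [this, nc_gamma hn hm]
      · exact Or.inl ⟨hd.cyc_of_ne _ hmem hq, fun s' => combined_finRotate hab (hpos q) s'⟩
  rw [sum_congr rfl fun p hp => (h2 p hp).symm] at h1
  have h3 := add_right_cancel h1
  have h4 := anticommVal_top (S := S) (a := a) (b := b) (leftSide n m) (gamma n m)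
  rw [letterVal, if_neg] at h4
  · simp only [Bool.not_eq_true, card_filter_leftSide, card_filter_leftSide_eq_false] at h4
    exact (h3.symm.trans h4 :)
  · intro hall
    have := (cyc_gamma _ _).1 (hall (Fin.castAdd m ⟨0, hn⟩) (mem_univ _)
      (Fin.natAdd n ⟨0, hm⟩) (mem_univ _))
    simp at this
    omega

end Anticomm

/-! ### Colourings of the graph of a partition -/

section Graph

variable {N : ℕ} {U : Finpartition (univ : Finset (Fin N))}

/-- The letters at the two ends of each edge differ. -/
def IsProper (g : Fin N → Bool) : Prop := ∀ i j, IsEdge i j → g i ≠ g j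

/-- The block of an element, as a vertex of the graph. -/
def vertex (U : Finpartition (univ : Finset (Fin N))) (i : Fin N) : {V // V ∈ U.parts} :=
  ⟨U.part i, U.part_mem.2 (mem_univ i)⟩

theorem vertex_eq {V : {V // V ∈ U.parts}} {i : Fin N} (hi : i ∈ V.1) : vertex U i = V :=
  Subtype.ext (Finpartition.part_eq_of_mem _ V.2 hi)

theorem exists_vertex_eq (V : {V // V ∈ U.parts}) : ∃ i, vertex U i = V := by
  obtain ⟨i, hi⟩ := U.nonempty_of_mem_parts V.2
  exact ⟨i, vertex_eq hi⟩

theorem vertex_eq_vertex_iff {i j : Fin N} : vertex U i = vertex U j ↔ toSetoid U i j :=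
  Subtype.ext_iff

theorem blockGraph_adj {V W : {V // V ∈ U.parts}} : (blockGraph U).Adj V W ↔
    V ≠ W ∧ ∃ i j, (IsEdge i j ∨ IsEdge j i) ∧ vertex U i = V ∧ vertex U j = W := by
  rw [blockGraph, SimpleGraph.fromRel_adj]
  refine and_congr_right fun _ => ⟨?_, ?_⟩
  · rintro (⟨i, j, h, hi, hj⟩ | ⟨i, j, h, hi, hj⟩)
    · exact ⟨i, j, Or.inl h, vertex_eq hi, vertex_eq hj⟩
    · exact ⟨j, i, Or.inr h, vertex_eq hj, vertex_eq hi⟩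
  · rintro ⟨i, j, h | h, rfl, rfl⟩
    · exact Or.inl ⟨i, j, h, U.mem_part (mem_univ _), U.mem_part (mem_univ _)⟩
    · exact Or.inr ⟨j, i, h, U.mem_part (mem_univ _), U.mem_part (mem_univ _)⟩

theorem eq_top_of_connected (hU : (blockGraph U).Connected) {t : Setoid (Fin N)}
    (h : toSetoid U ≤ t) (hedge : ∀ i j, IsEdge i j → t i j) : t = ⊤ := by
  have key : ∀ {V W : {V // V ∈ U.parts}} (_ : (blockGraph U).Walk V W) (i j : Fin N),
      vertex U i = V → vertex U j = W → t i j := by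
    intro V W p
    induction p with
    | nil => exact fun i j hi hj => h (vertex_eq_vertex_iff.1 (hi.trans hj.symm))
    | cons hadj _ ih =>
      intro i j hi hj
      obtain ⟨-, i', j', he, hi', hj'⟩ := blockGraph_adj.1 hadj
      refine Setoid.trans' _ (h (vertex_eq_vertex_iff.1 (hi.trans hi'.symm))) ?_
      refine Setoid.trans' _ ?_ (ih j' j hj' hj)
      exact he.elim (hedge _ _) fun he => Setoid.symm' _ (hedge _ _ he)
  exact eq_top_iff.2 fun i j _ => (hU.preconnected (vertex U i) (vertex U j)).elim fun p =>
    key p i j rfl rfl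

theorem connected_of_forall [Nonempty (Fin N)]
    (h : ∀ t : Setoid (Fin N), toSetoid U ≤ t → (∀ i j, IsEdge i j → t i j) → t = ⊤) :
    (blockGraph U).Connected := by
  let t : Setoid (Fin N) := (blockGraph U).reachableSetoid.comap (vertex U)
  have ht : t = ⊤ := by
    refine h t (fun i j hij => ?_) fun i j hij => ?_
    · change (blockGraph U).Reachable _ _
      rw [vertex_eq_vertex_iff.2 hij]
    · change (blockGraph U).Reachable _ _
      by_cases hne : vertex U i = vertex U j
      · rw [hne]
      · exact (blockGraph_adj.2 ⟨hne, i, j, Or.inl hij, rfl, rfl⟩).reachable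
  have hne : Nonempty {V // V ∈ U.parts} := ‹Nonempty (Fin N)›.map (vertex U)
  refine ⟨fun V W => ?_⟩
  obtain ⟨i, rfl⟩ := exists_vertex_eq V
  obtain ⟨j, rfl⟩ := exists_vertex_eq W
  exact (ht ▸ trivial : t i j)

/-- A colouring that is constant on blocks and changes along every edge descends to a 2-colouring of
the graph, and a walk has even length exactly when its ends have equal colours. -/
theorem even_dist_iff (hU : (blockGraph U).Connected) {g : Fin N → Bool}
    (hg : IsProper g) (hconst : ∀ i j, toSetoid U i j → g i = g j) (r i : Fin N) :
    Even ((blockGraph U).dist (vertex U r) (vertex U i)) ↔ g r = g i := by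
  choose m hm using exists_vertex_eq (U := U)
  have hgm : ∀ i, g (m (vertex U i)) = g i := fun i =>
    hconst _ _ (vertex_eq_vertex_iff.1 (hm (vertex U i)))
  let c : (blockGraph U).Coloring Bool := SimpleGraph.Coloring.mk (fun V => g (m V)) (by
    intro V W h
    obtain ⟨-, i, j, he, rfl, rfl⟩ := blockGraph_adj.1 h
    rw [hgm, hgm]
    exact he.elim (hg _ _) fun he => (hg _ _ he).symm)
  obtain ⟨p, hp⟩ := (hU.preconnected (vertex U r) (vertex U i)).exists_walk_length_eq_dist
  rw [← hp, c.even_length_iff_congr p]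
  change (g (m _) = true ↔ g (m _) = true) ↔ _
  rw [hgm, hgm]
  exact Bool.eq_iff_iff.symm

theorem evenDist_iff (hU : (blockGraph U).Connected) {g : Fin N → Bool}
    (hg : IsProper g) (hconst : ∀ i j, toSetoid U i j → g i = g j) (r i : Fin N) :
    EvenDist U (U.part r) (U.part i) ↔ g r = g i := by
  rw [← even_dist_iff hU hg hconst]
  exact ⟨fun ⟨_, _, _, h⟩ => h, fun h => ⟨_, _, hU.preconnected _ _, h⟩⟩

theorem oddDist_iff (hU : (blockGraph U).Connected) {g : Fin N → Bool}
    (hg : IsProper g) (hconst : ∀ i j, toSetoid U i j → g i = g j) (r i : Fin N) :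
    OddDist U (U.part r) (U.part i) ↔ ¬ g r = g i := by
  rw [← even_dist_iff hU hg hconst, Nat.not_even_iff_odd]
  exact ⟨fun ⟨_, _, _, h⟩ => h, fun h => ⟨_, _, hU.preconnected _ _, h⟩⟩

theorem isBipartiteGraph_iff : IsBipartiteGraph U ↔
    ∃ g : Fin N → Bool, IsProper g ∧ ∀ i j, toSetoid U i j → g i = g j := by
  constructor
  · rintro ⟨T, hT⟩
    refine ⟨fun i => decide (U.part i ∈ T), fun i j h h' => hT i j h (decide_eq_decide.1 h'),
      fun i j h => ?_⟩
    have h' : U.part i = U.part j := h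
    simp only [h']
  · rintro ⟨g, hg, hconst⟩
    refine ⟨{V | ∃ i ∈ V, g i = true}, fun i j h h' => hg i j h ?_⟩
    have key : ∀ i, U.part i ∈ {V : Finset (Fin N) | ∃ i ∈ V, g i = true} ↔ g i = true := by
      intro i
      refine ⟨?_, fun h => ⟨i, U.mem_part (mem_univ i), h⟩⟩
      rintro ⟨j, hj, hj'⟩
      rw [hconst i j, hj']
      exact ((U.mem_part_iff_part_eq_part (mem_univ _) (mem_univ _)).1 hj).symm
    rw [key, key] at h'
    exact Bool.eq_iff_iff.2 h'

variable (k₁ : Bool → ℕ → ℂ) (k₂ : Bool → ℕ → ℕ → ℂ) (π : Equiv.Perm (Fin N)) (s : Fin N → Bool)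

theorem sum_pairVal_of_not_isBipartiteGraph (h : ¬ IsBipartiteGraph U) :
    ∑ g ∈ univ.filter (IsProper (N := N)), pairVal k₁ k₂ g s (toSetoid U, π) = 0 := by
  refine sum_eq_zero fun g hg => ?_
  by_contra hne
  refine h (isBipartiteGraph_iff.2 ⟨g, (mem_filter.1 hg).2, fun i j hij => ?_⟩)
  by_contra hij'
  exact hne (pairVal_eq_zero k₁ k₂ hij hij')

/-- For a connected bipartite graph there are two proper colourings, which are determined by the
parity of the distance from a given block. -/
theorem sum_pairVal_of_isBipartiteGraph (h : IsBipartiteGraph U) (hU : (blockGraph U).Connected)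
    {R : Finset (Fin N)} (hR : R ∈ U.parts) :
    ∑ g ∈ univ.filter (IsProper (N := N)), pairVal k₁ k₂ g s (toSetoid U, π) =
      ∑ c : Bool, (∏ V ∈ evenBlocks U R, letterVal k₁ k₂ π s V c) *
        ∏ V ∈ oddBlocks U R, letterVal k₁ k₂ π s V (!c) := by
  obtain ⟨g, hg, hconst⟩ := isBipartiteGraph_iff.1 h
  obtain ⟨r, hr⟩ := U.nonempty_of_mem_parts hR
  obtain rfl : U.part r = R := Finpartition.part_eq_of_mem _ hR hr
  -- The proper colouring with value `c` on the root block: the elements that agree with `r` under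
  -- `g` receive `c`, the others the opposite letter.
  let G : Bool → Fin N → Bool := fun c i => if g r = g i then c else !c
  have hG : ∀ c, IsProper (G c) := fun c i j hij =>
    (by decide : ∀ c x y z : Bool, y ≠ z → (if x = y then c else !c) ≠ if x = z then c else !c)
      c (g r) (g i) (g j) (hg i j hij)
  have hGconst : ∀ c i j, toSetoid U i j → G c i = G c j := fun c i j hij => by
    simp only [G, hconst i j hij]
  have hGr : ∀ c, G c r = c := fun c => if_pos rfl
  symm
  refine sum_of_injOn G (fun c _ c' _ hcc => ?_) (fun c _ => ?_) (fun g' hg' hnot => ?_)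
    fun c _ => ?_
  · rw [← hGr c, ← hGr c', hcc]
  · simp [hG]
  · by_contra hne
    have hconst' : ∀ i j, toSetoid U i j → g' i = g' j := fun i j hij => by
      by_contra hij'
      exact hne (pairVal_eq_zero k₁ k₂ hij hij')
    refine hnot ⟨g' r, mem_univ _, funext fun i => ?_⟩
    -- Agreement with the root is the parity of the distance for either colouring, so `g'` is
    -- determined by its value at `r`.
    have h1 := (even_dist_iff hU hg hconst r i).symm.trans
      (even_dist_iff hU (mem_filter.1 hg').2 hconst' r i)
    simp only [G, h1]
    split_ifs with h2
    · exact h2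
    · exact (by decide : ∀ x y : Bool, x ≠ y → (!x) = y) _ _ h2
  · rw [pairVal, blocks_toSetoid, ← prod_filter_mul_prod_filter_not U.parts
      fun V => EvenDist U (U.part r) V]
    have hodd : oddBlocks U (U.part r) = U.parts.filter fun V => ¬ EvenDist U (U.part r) V := by
      refine filter_congr fun V hV => ?_
      obtain ⟨i, hi⟩ := exists_vertex_eq ⟨V, hV⟩
      obtain rfl : U.part i = V := congrArg Subtype.val hi
      rw [oddDist_iff hU hg hconst, evenDist_iff hU hg hconst]
    have hval : ∀ V ∈ U.parts, ∀ c', (∀ i ∈ V, G c i = c') →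
        letterVal k₁ k₂ π s V c' = blockVal k₁ k₂ π (G c) s V := fun V hV c' h' =>
      (blockVal_of_forall k₁ k₂ (U.nonempty_of_mem_parts hV) h').symm
    rw [hodd]
    refine congrArg₂ (· * ·) (prod_congr rfl fun V hV => ?_) (prod_congr rfl fun V hV => ?_)
    · obtain ⟨hV, he⟩ := mem_filter.1 hV
      refine hval V hV _ fun i hi => ?_
      rw [← Finpartition.part_eq_of_mem _ hV hi, evenDist_iff hU hg hconst] at he
      exact if_pos he
    · obtain ⟨hV, he⟩ := mem_filter.1 hV
      refine hval V hV _ fun i hi => ?_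
      rw [← Finpartition.part_eq_of_mem _ hV hi, evenDist_iff hU hg hconst] at he
      exact if_neg he

end Graph

/-! ### Passage to `[2n + 2m]` -/

section Final

theorem cyc_apply_equiv {Y Y' : Type*} [Fintype Y] [Fintype Y'] {e : Y' ≃ Y} {f : Equiv.Perm Y'}
    {g : Equiv.Perm Y} (h : ∀ y, e (f y) = g (e y)) {y y' : Y'} :
    cyc g (e y) (e y') ↔ cyc f y y' := by
  rw [← glueP_unitEquiv e h, cyc_glueP]
  exact glueS_piece (e := unitEquiv e) (U := fun _ => cyc f) (b := ())

theorem transport_mem_planarPairs {Y Y' : Type*} [Fintype Y] [Fintype Y'] {e : Y' ≃ Y}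
    {γ : Equiv.Perm Y} {γ' : Equiv.Perm Y'} (h : ∀ y, e (γ' y) = γ (e y))
    {p : Setoid Y' × Equiv.Perm Y'} :
    transport e p ∈ planarPairs ⊤ γ ↔ p ∈ planarPairs ⊤ γ' := by
  rw [← glueP_unitEquiv e h, ← glueS_unitEquiv_top e, transport, glue_mem_planarPairs, Unique.forall_iff]

theorem exists_transport_eq {Y Y' : Type*} [Fintype Y] [Fintype Y'] (e : Y' ≃ Y)
    (p : Setoid Y × Equiv.Perm Y) : ∃ p', transport e p' = p := by
  refine ⟨(p.1.comap e, e.symm.permCongr p.2), Prod.ext (Setoid.ext fun x y => ?_)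
    (Equiv.ext fun x => ?_)⟩
  · obtain ⟨x, rfl⟩ := e.surjective x
    obtain ⟨y, rfl⟩ := e.surjective y
    exact transport_fst_apply _ _ _
  · obtain ⟨x, rfl⟩ := e.surjective x
    rw [transport_snd_apply]
    simp

variable {n m : ℕ} {h2 : 2 * n + 2 * m = 2 * (n + m)}

theorem isEdge_pairEquiv_iff {N M : ℕ} {h : M = 2 * N} {i j : Fin M} :
    IsEdge i j ↔ ∃ k, i = pairEquiv h (Sum.inl k) ∧ j = pairEquiv h (Sum.inr k) := by
  constructor
  · rintro ⟨⟨k, hk⟩, hj⟩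
    have := i.isLt
    exact ⟨⟨k, by omega⟩, Fin.ext (by change i.val = 2 * k; omega),
      Fin.ext (by change j.val = 2 * k + 1; omega)⟩
  · rintro ⟨k, rfl, rfl⟩
    exact ⟨⟨k.val, by rw [val_pairEquiv_inl]; omega⟩, rfl⟩

theorem separatesEven_transport_iff (hn : 1 ≤ n)
    (p : Setoid (Fin (n + m) ⊕ Fin (n + m)) × Equiv.Perm (Fin (n + m) ⊕ Fin (n + m))) :
    SeparatesEven ((transport (pairEquiv h2) p).2⁻¹ * gamma (2 * n) (2 * m)) ↔
      Sep (p.2⁻¹ * dbl (gamma n m)) := by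
  have h : ∀ y, pairEquiv h2 ((p.2⁻¹ * dbl (gamma n m)) y) =
      ((transport (pairEquiv h2) p).2⁻¹ * gamma (2 * n) (2 * m)) (pairEquiv h2 y) := fun y => by
    rw [Equiv.Perm.mul_apply, Equiv.Perm.mul_apply, Equiv.Perm.eq_inv_iff_eq, transport_snd_apply,
      ← Equiv.Perm.mul_apply p.2, mul_inv_cancel, Equiv.Perm.one_apply, pairEquiv_gamma hn]
  constructor
  · intro hs x y hxy
    have := hs (pairEquiv h2 (Sum.inr x)) (pairEquiv h2 (Sum.inr y))
      ⟨x.val + 1, by rw [val_pairEquiv_inr]; ring⟩ ⟨y.val + 1, by rw [val_pairEquiv_inr]; ring⟩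
      ((cyc_apply_equiv h).2 hxy)
    exact Sum.inr_injective ((pairEquiv h2).injective this)
  · intro hs i j hi hj hij
    obtain ⟨x | x, rfl⟩ := (pairEquiv h2).surjective i
    · rw [val_pairEquiv_inl] at hi
      exact absurd hi (by simp [parity_simps])
    obtain ⟨y | y, rfl⟩ := (pairEquiv h2).surjective j
    · rw [val_pairEquiv_inl] at hj
      exact absurd hj (by simp [parity_simps])
    rw [hs x y ((cyc_apply_equiv h).1 hij)]

theorem le_sup_comap_of_edges {N M : ℕ} {h : M = 2 * N} {t : Setoid (Fin M)} :
    (∀ i j, IsEdge i j → t i j) ↔ (⊥ : Setoid (Fin N)).comap proj ≤ t.comap (pairEquiv h) := by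
  constructor
  · intro ht
    have key : ∀ k, t (pairEquiv h (Sum.inl k)) (pairEquiv h (Sum.inr k)) := fun k =>
      ht _ _ (isEdge_pairEquiv_iff.2 ⟨k, rfl, rfl⟩)
    rintro (x | x) (y | y) hxy <;> obtain rfl : x = y := hxy
    · exact Setoid.refl' _ _
    · exact key x
    · exact Setoid.symm' _ (key x)
    · exact Setoid.refl' _ _
  · rintro ht i j hij
    obtain ⟨k, rfl, rfl⟩ := (isEdge_pairEquiv_iff (h := h)).1 hij
    exact @ht (Sum.inl k) (Sum.inr k) rfl

/-- A partition containing `U` and all edges contains `dbl γ` by `Sep.cyc_dbl_le`, hence contains `U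
∨ dbl γ = ⊤`. -/
theorem connected_of_separatesEven (hn : 1 ≤ n)
    {U : Finpartition (univ : Finset (Fin (2 * n + 2 * m)))}
    {π : Equiv.Perm (Fin (2 * n + 2 * m))}
    (h : (toSetoid U, π) ∈ planarPairs ⊤ (gamma (2 * n) (2 * m)))
    (hs : SeparatesEven (π⁻¹ * gamma (2 * n) (2 * m))) : (blockGraph U).Connected := by
  have hne : Nonempty (Fin (2 * n + 2 * m)) := ⟨⟨0, by omega⟩⟩
  have h2 : 2 * n + 2 * m = 2 * (n + m) := by ring
  obtain ⟨p, hp⟩ := exists_transport_eq (pairEquiv h2) (toSetoid U, π)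
  obtain ⟨hU, rfl⟩ := Prod.ext_iff.1 hp
  rw [← hp, transport_mem_planarPairs (pairEquiv_gamma hn h2)] at h
  rw [separatesEven_transport_iff hn] at hs
  obtain ⟨h3, h4, -⟩ := mem_planarPairs.1 h
  refine connected_of_forall fun t ht hedge => ?_
  rw [le_sup_comap_of_edges (h := h2)] at hedge
  have h5 : p.1 ≤ t.comap (pairEquiv h2) := fun x y hxy => ht (by
    rw [← show _ = toSetoid U from hU]
    exact (transport_fst_apply _ _ _).2 hxy)
  have h6 : t.comap (pairEquiv h2) = ⊤ := top_le_iff.1 (h4.ge.trans (sup_le h5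
    (hs.cyc_dbl_le.trans (sup_le (h3.trans h5) hedge))))
  refine eq_top_iff.2 fun x y _ => ?_
  obtain ⟨x, rfl⟩ := (pairEquiv h2).surjective x
  obtain ⟨y, rfl⟩ := (pairEquiv h2).surjective y
  exact (h6 ▸ trivial : t.comap (pairEquiv h2) x y)

/-- Let `σ` be the permutation for which `π⁻¹ * dbl σ` separates even numbers. Connectedness makes
`U ∨ dbl σ` trivial, so `(⊤, σ)` is planar relative to `gamma n m`, and the two kinds of planar
pairs decide whether `σ = gamma n m`. -/
theorem separatesEven_of_connected (hn : 1 ≤ n) (hm : 1 ≤ m)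
    {U : Finpartition (univ : Finset (Fin (2 * n + 2 * m)))}
    {π : Equiv.Perm (Fin (2 * n + 2 * m))} (h : (U, π) ∈ typeTwo (2 * n) (2 * m))
    (hU : (blockGraph U).Connected) : SeparatesEven (π⁻¹ * gamma (2 * n) (2 * m)) := by
  have hne : Nonempty (Fin (n + m)) := ⟨⟨0, by omega⟩⟩
  have h2 : 2 * n + 2 * m = 2 * (n + m) := by ring
  have hp' : (toSetoid U, π) ∈ planarPairs ⊤ (gamma (2 * n) (2 * m)) :=
    (mem_planarPairs_gamma (by omega) (by omega)).2 (Or.inr (by rwa [ofSetoid_toSetoid]))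
  have hd := typeTwoData h
  obtain ⟨p, hp⟩ := exists_transport_eq (pairEquiv h2) (toSetoid U, π)
  obtain ⟨hpU, rfl⟩ := Prod.ext_iff.1 hp
  have hpU' : (transport (pairEquiv h2) p).1 = toSetoid U := hpU
  rw [← hp, transport_mem_planarPairs (pairEquiv_gamma hn h2)] at hp'
  rw [separatesEven_transport_iff hn]
  obtain ⟨σ, hσ⟩ := exists_sep p.2
  have h3 : p.1 ⊔ cyc (dbl σ) = (⊤ : Setoid (Fin (n + m))).comap proj := by
    refine top_le_iff.1 fun x y _ => ?_
    let t : Setoid (Fin (2 * n + 2 * m)) := (p.1 ⊔ cyc (dbl σ)).comap (pairEquiv h2).symm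
    have ht : ∀ x y, t (pairEquiv h2 x) (pairEquiv h2 y) ↔ (p.1 ⊔ cyc (dbl σ)) x y := fun x y => by
      rw [Setoid.comap_rel, Equiv.symm_apply_apply, Equiv.symm_apply_apply]
    rw [← ht, eq_top_of_connected hU (t := t)]
    · trivial
    · intro x y hxy
      obtain ⟨x, rfl⟩ := (pairEquiv h2).surjective x
      obtain ⟨y, rfl⟩ := (pairEquiv h2).surjective y
      rw [ht]
      rw [← hpU', transport_fst_apply] at hxy
      exact (le_sup_left : p.1 ≤ p.1 ⊔ cyc (dbl σ)) hxy
    · rw [le_sup_comap_of_edges (h := h2)]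
      intro x y hxy
      rw [Setoid.comap_rel, ht]
      refine (le_sup_right : cyc (dbl σ) ≤ p.1 ⊔ cyc (dbl σ)) ?_
      rw [cyc_dbl]
      exact (comap_proj_le_comap.2 bot_le) hxy
  obtain ⟨h4, h5⟩ := (mem_planarPairs_dbl_iff hσ h3 (gamma n m)).1 hp'
  rcases (mem_planarPairs_gamma hn hm).1 h4 with ⟨-, h6⟩ | h6
  -- If `σ` were one cycle, then so would be `dbl σ`, and planarity relative to it would force `U =
  -- cyc π`, although `U` merges two cycles.
  · exfalso
    have h7 : cyc (dbl σ) = ⊤ := by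
      rw [cyc_dbl, ← h6]
      rfl
    have h8 := ((mem_planarPairs_of_transitive h7).1 h5).1
    have h9 : toSetoid U = cyc (transport (pairEquiv h2) p).2 := by
      rw [← hpU']
      ext x y
      obtain ⟨x, rfl⟩ := (pairEquiv h2).surjective x
      obtain ⟨y, rfl⟩ := (pairEquiv h2).surjective y
      rw [transport_fst_apply, cyc_apply_equiv fun y => (transport_snd_apply p y).symm]
      exact Setoid.ext_iff.1 h8 x y
    have := hd.nc_eq
    rw [h9, nc] at this
    omega
  -- Here `⊤` arises from the cycles of `σ` by one merging, so `σ` has two cycles, as many as `gamma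
  -- n m`, and equals it.
  · have h7 := (typeTwoData h6).nc_eq
    rw [toSetoid_ofSetoid, nq_top] at h7
    rwa [eq_of_top_mem_planarPairs h4 (by rw [h7, nc_gamma hn hm])] at hσ

/-- Opposite colourings of the pairs are the proper letterings of `[2n + 2m]`: the letter at `2k -
1` is free and determines the one at `2k`. -/
theorem anticommCumulant_gamma (k₁ : Bool → ℕ → ℂ) (k₂ : Bool → ℕ → ℕ → ℂ) (hn : 1 ≤ n) :
    anticommCumulant k₁ k₂ (gamma n m) (leftSide n m) =
      ∑ p ∈ (planarPairs ⊤ (gamma (2 * n) (2 * m))).filter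
        fun p => SeparatesEven (p.2⁻¹ * gamma (2 * n) (2 * m)),
        ∑ g ∈ univ.filter (IsProper (N := 2 * n + 2 * m)),
          pairVal k₁ k₂ g (leftSide (2 * n) (2 * m)) p := by
  have h2 : 2 * n + 2 * m = 2 * (n + m) := by ring
  rw [sum_planarPairs_transport (pairEquiv_gamma hn h2), anticommCumulant]
  simp only [separatesEven_transport_iff hn]
  refine sum_congr rfl fun p _ => ?_
  rw [colourSum_eq]
  refine sum_bij (fun f _ => colour f ∘ (pairEquiv h2).symm) (fun f _ => ?_) (fun f _ f' _ hff => ?_)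
    (fun g hg => ?_) fun f _ => ?_
  · refine mem_filter.2 ⟨mem_univ _, fun i j hij => ?_⟩
    obtain ⟨k, rfl, rfl⟩ := (isEdge_pairEquiv_iff (h := h2)).1 hij
    simp
  · funext k
    have := congrFun hff (pairEquiv h2 (Sum.inl k))
    simpa using this
  · have hg' := (mem_filter.1 hg).2
    refine ⟨fun k => g (pairEquiv h2 (Sum.inl k)), mem_univ _, funext fun i => ?_⟩
    obtain ⟨k | k, rfl⟩ := (pairEquiv h2).surjective i
    · simp
    · have := hg' _ _ ((isEdge_pairEquiv_iff (h := h2)).2 ⟨k, rfl, rfl⟩)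
      simp only [Function.comp_apply, Equiv.symm_apply_apply, Sum.elim_inr]
      exact Bool.not_eq_eq_eq_not.2 (Bool.eq_not.2 this)
  · rw [pairVal_transport]
    congr 1
    · funext x
      simp
    · funext x
      rcases x with k | k
      · change decide (k.val < n) = decide (2 * k.val < 2 * n)
        exact decide_eq_decide.2 (by omega)
      · change decide (k.val < n) = decide (2 * k.val + 1 < 2 * n)
        exact decide_eq_decide.2 (by omega)

variable {A : Type*} [Ring A] [Algebra ℂ A] (S : SecondOrderSpace A) (a b : A)

theorem prod_letterVal_eq {N : ℕ} {σ : Finset (Finset (Fin N))} {π : Equiv.Perm (Fin N)}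
    (h : ∀ V ∈ σ, ∀ y ∈ V, ∀ y' ∈ V, cyc π y y') (s : Fin N → Bool) (c : Bool) :
    ∏ V ∈ σ, letterVal (letterCumulant S (twoLetters a b)) (letterCumulant₂ S (twoLetters a b)) π s
      V c = S.cumulantBlocks (twoLetters a b c) σ :=
  prod_congr rfl fun V hV => if_pos (h V hV)

theorem firstBlock_mem {N : ℕ} (hN : 1 ≤ N) (U : Finpartition (univ : Finset (Fin N))) :
    firstBlock U ∈ U.parts := by
  have h : firstBlock U = U.part ⟨0, hN⟩ := by
    ext i
    simp only [firstBlock, mem_filter, mem_univ, true_and]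
    constructor
    · rintro ⟨j, hj, hj0⟩
      obtain rfl : j = ⟨0, hN⟩ := Fin.ext hj0
      rw [U.mem_part_iff_part_eq_part (mem_univ _) (mem_univ _)] at hj ⊢
      exact hj.symm
    · intro hi
      refine ⟨⟨0, hN⟩, ?_, rfl⟩
      rw [U.mem_part_iff_part_eq_part (mem_univ _) (mem_univ _)] at hi ⊢
      exact hi.symm
  rw [h]
  exact U.part_mem.2 (mem_univ _)

theorem sum_pairVal_annularNC (hn : 1 ≤ n) (hm : 1 ≤ m) {π : Equiv.Perm (Fin (2 * n + 2 * m))}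
    (h : π ∈ annularNC (2 * n) (2 * m)) (hs : SeparatesEven (π⁻¹ * gamma (2 * n) (2 * m)))
    (hb : IsBipartiteGraph (cyclePartition π)) :
    ∑ g ∈ univ.filter (IsProper (N := 2 * n + 2 * m)), pairVal (letterCumulant S (twoLetters a b))
        (letterCumulant₂ S (twoLetters a b)) g (leftSide (2 * n) (2 * m)) (cyc π, π) =
      S.cumulantBlocks a (cycleEven π) * S.cumulantBlocks b (cycleOdd π) +
        S.cumulantBlocks b (cycleEven π) * S.cumulantBlocks a (cycleOdd π) := by
  have h1 : toSetoid (cyclePartition π) = cyc π := by rw [cyclePartition_eq, toSetoid_ofSetoid]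
  have hp : (toSetoid (cyclePartition π), π) ∈ planarPairs ⊤ (gamma (2 * n) (2 * m)) :=
    (mem_planarPairs_gamma (by omega) (by omega)).2 (Or.inl ⟨h, h1⟩)
  have hc : ∀ V ∈ (cyclePartition π).parts, ∀ y ∈ V, ∀ y' ∈ V, cyc π y y' := fun V hV y hy y' hy' =>
    rel_of_mem_blocks (by rwa [cyclePartition_eq, parts_ofSetoid] at hV) hy hy'
  have he : ∀ V ∈ evenBlocks (cyclePartition π) (firstBlock (cyclePartition π)), _ :=
    fun V hV => hc V (mem_filter.1 hV).1
  have ho : ∀ V ∈ oddBlocks (cyclePartition π) (firstBlock (cyclePartition π)), _ :=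
    fun V hV => hc V (mem_filter.1 hV).1
  rw [← h1, sum_pairVal_of_isBipartiteGraph _ _ _ _ hb (connected_of_separatesEven hn hp hs)
    (firstBlock_mem (by omega) _), Fintype.sum_bool,
    prod_letterVal_eq S a b he, prod_letterVal_eq S a b he, prod_letterVal_eq S a b ho,
    prod_letterVal_eq S a b ho]
  rfl

theorem sum_pairVal_typeTwo
    {U : Finpartition (univ : Finset (Fin (2 * n + 2 * m)))} {π : Equiv.Perm (Fin (2 * n + 2 * m))}
    (h : (U, π) ∈ typeTwo (2 * n) (2 * m)) (hU : (blockGraph U).Connected)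
    (hb : IsBipartiteGraph U) :
    ∑ g ∈ univ.filter (IsProper (N := 2 * n + 2 * m)), pairVal (letterCumulant S (twoLetters a b))
        (letterCumulant₂ S (twoLetters a b)) g (leftSide (2 * n) (2 * m)) (toSetoid U, π) =
      S.cumulantOf₂ a (leftCycle (2 * n) (2 * m) U).card (rightCycle (2 * n) (2 * m) U).card *
          S.cumulantBlocks a (typeTwoEven (2 * n) (2 * m) U) *
          S.cumulantBlocks b (typeTwoOdd (2 * n) (2 * m) U) +
        S.cumulantOf₂ b (leftCycle (2 * n) (2 * m) U).card (rightCycle (2 * n) (2 * m) U).card *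
          S.cumulantBlocks b (typeTwoEven (2 * n) (2 * m) U) *
          S.cumulantBlocks a (typeTwoOdd (2 * n) (2 * m) U) := by
  have hd := typeTwoData h
  set M := mergedBlock (2 * n) (2 * m) U with hM
  -- The merged block is at distance `0` from itself. Its factor is split off as the second order
  -- cumulant; all other blocks are single cycles.
  have hmem : M ∈ evenBlocks U M :=
    mem_filter.2 ⟨hd.merged_mem, hd.merged_mem, hd.merged_mem, SimpleGraph.Reachable.refl _, by simp⟩
  have heven : ∀ V ∈ (evenBlocks U M).erase M, ∀ y ∈ V, ∀ y' ∈ V, cyc π y y' := fun V hV =>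
    hd.cyc_of_ne V (mem_filter.1 (mem_of_mem_erase hV)).1 (ne_of_mem_erase hV)
  have hodd : ∀ V ∈ oddBlocks U M, ∀ y ∈ V, ∀ y' ∈ V, cyc π y y' := fun V hV =>
    hd.cyc_of_ne V (mem_filter.1 hV).1 fun hVM => by
      obtain ⟨-, h1, h2, -, h3⟩ := mem_filter.1 hV
      rw [show (⟨V, h2⟩ : {V // V ∈ U.parts}) = ⟨M, h1⟩ from Subtype.ext hVM,
        SimpleGraph.dist_self] at h3
      exact absurd h3 (by decide)
  rw [sum_pairVal_of_isBipartiteGraph _ _ _ _ hb hU hd.merged_mem, Fintype.sum_bool,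
    ← mul_prod_erase _ _ hmem, ← mul_prod_erase _ _ hmem, hd.letterVal_merged, hd.letterVal_merged,
    prod_letterVal_eq S a b heven, prod_letterVal_eq S a b heven, prod_letterVal_eq S a b hodd,
    prod_letterVal_eq S a b hodd]
  rfl

end Final

end Annular

end

/-! ### The second order cumulants of the anticommutator -/

theorem theorem1p3 {A : Type*} [Ring A] [Algebra ℂ A] (S : Annular.SecondOrderSpace A) (a b : A)
    (hab : S.SecondOrderFree a b) (n m : ℕ) (hn : 1 ≤ n) (hm : 1 ≤ m) :
    S.cumulantOf₂ (a * b + b * a) n m =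
      ∑ π ∈ Annular.setJ n m,
        (S.cumulantBlocks a (Annular.cycleEven π) * S.cumulantBlocks b (Annular.cycleOdd π) +
          S.cumulantBlocks b (Annular.cycleEven π) * S.cumulantBlocks a (Annular.cycleOdd π)) +
      ∑ p ∈ Annular.setX n m,
        (S.cumulantOf₂ a (Annular.leftCycle (2 * n) (2 * m) p.1).card
              (Annular.rightCycle (2 * n) (2 * m) p.1).card *
            S.cumulantBlocks a (Annular.typeTwoEven (2 * n) (2 * m) p.1) *
            S.cumulantBlocks b (Annular.typeTwoOdd (2 * n) (2 * m) p.1) +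
          S.cumulantOf₂ b (Annular.leftCycle (2 * n) (2 * m) p.1).card
              (Annular.rightCycle (2 * n) (2 * m) p.1).card *
            S.cumulantBlocks b (Annular.typeTwoEven (2 * n) (2 * m) p.1) *
            S.cumulantBlocks a (Annular.typeTwoOdd (2 * n) (2 * m) p.1)) := by
  classical
  refine (Annular.combined_gamma hab hn hm).symm.trans ?_
  rw [Annular.combined, Annular.anticommCumulant_gamma _ _ hn, Finset.sum_filter,
    Annular.sum_planarPairs_gamma (by omega) (by omega), Annular.setJ, Annular.setX,
    Finset.sum_filter, Finset.sum_filter]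
  refine congrArg₂ (· + ·) (Finset.sum_congr rfl fun π hπ => ?_)
    (Finset.sum_congr rfl fun p hp => ?_)
  · by_cases hs : Annular.SeparatesEven (π⁻¹ * Annular.gamma (2 * n) (2 * m))
    · by_cases hb : Annular.IsBipartiteGraph (Annular.cyclePartition π)
      · rw [if_pos hs, if_pos ⟨hb, hs⟩, Annular.sum_pairVal_annularNC S a b hn hm hπ hs hb]
      -- Without a bipartite graph every proper lettering has a mixed block, so the inner sum is
      -- zero.
      · rw [if_pos hs, if_neg fun h => hb h.1,
          ← Annular.sum_pairVal_of_not_isBipartiteGraph _ _ π _ hb, Annular.cyclePartition_eq,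
          Annular.toSetoid_ofSetoid]
    · rw [if_neg hs, if_neg fun h => hs h.2]
  · by_cases hb : Annular.IsBipartiteGraph p.1
    · by_cases hU : (Annular.blockGraph p.1).Connected
      · rw [if_pos (Annular.separatesEven_of_connected hn hm hp hU), if_pos ⟨hb, hU⟩,
          Annular.sum_pairVal_typeTwo S a b hp hU hb]
      -- A disconnected graph excludes separation of even numbers, so the pair is absent from both
      -- sums.
      · rw [if_neg, if_neg fun h => hU h.2]
        exact fun hs => hU (Annular.connected_of_separatesEven hn
          ((Annular.mem_planarPairs_gamma (by omega) (by omega)).2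
            (Or.inr (by rwa [Annular.ofSetoid_toSetoid]))) hs)
    · rw [Annular.sum_pairVal_of_not_isBipartiteGraph _ _ _ _ hb, ite_self, if_neg fun h => hb h.1]
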